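/- Let $N\ge 2$. For functions $\omega_1,\dots,\omega_{N-1}$, with $\omega_0=\omega_N=0$, put $F_j=1-\omega_j^2+\tfrac12(\omega_{j-1}^2+\omega_{j+1}^2)$ and $p_\theta=\frac1{4r^4}\sum_{j=1}^N(\omega_j^2-\omega_{j-1}^2-N-1+2j)^2$. Let $(r,\Psi,\kappa,S,\omega_j,U_j)$ be functions of $\tau>0$ which solve the static spherically symmetric $\mathfrak{su}(N)$ Einstein-Yang-Mills equations in regular form, $$\dot r=r\Psi,\quad \dot\omega_j=rU_j,\quad \dot\Psi=(\kappa-\Psi)\Psi-2\mu G,\quad (S\Psi)^{\cdot}=S(\kappa-\Psi)\Psi,$$ $$\dot U_j=-(\kappa-\Psi)U_j-\tfrac1r F_j\,\omega_j,\quad \dot\kappa=-\kappa^2+1+2\mu G,$$ where $S\neq0$, $\mu=\Psi^2=1-2m/r$, $\mu G=\sum_{j=1}^{N-1}U_j^2$ and $2\Psi\kappa=1+\Psi^2+2\mu G-2r^2p_\theta$, starting at $\tau=0$ from a regular non-degenerate event horizon $r=r_h>0$ (that is, as $\tau\to0^+$: $r\to r_h$, $\mu\to0$, $\mu/(r-r_h)$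 tends to a finite positive limit, and $\omega_j$ and $\omega_j'=d\omega_j/dr=U_j/\Psi$ have finite limits). Suppose that $\Psi(\tau)>0$ for all $\tau>0$ and that $r(\tau)\to\infty$ as $\tau\to\infty$. Then: 1. $\Psi\to1$ and $S$ has a finite nonzero limit as $\tau\to\infty$. 2. There is a critical point $(a_1,\dots,a_{N-1})$ of the flat space gauge field equations, i.e. $\left[1-a_j^2+\tfrac12(a_{j-1}^2+a_{j+1}^2)\right]a_j=0$ for $1\le j\le N-1$ with $a_0=a_N=0$, such that $\omega_j\to a_j$ and $\dot\omega_j\to0$ as $\tau\to\infty$ for every $j$. Moreover $a_j=0$ only if $\omega_j\equiv0$; in particular the critical point is not the origin unless all $\omega_j$ vanish identically. 3. The solution is a regular black hole. That is, as functions of $r$, the functions $m,S,\omega_j$ satisfy, for all $r>r_h$, $$r^2\mu\omega_j''+(2m-2r^3p_\theta)\omega_j'+F_j\,\omega_j=0,\quad m'=\mu G+r^2p_\theta,\quad S'/S=2G/r,\quad G=\sum_{j=1}^{N-1}\omega_j'^2,$$ with a regular non-degenerate event horizon at $r_h$, $\mu>0$ and $\omega_j,\omega_j'$ finite for all $r>r_h$;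 and the spacetime is asymptotically flat as $r\to\infty$: $\mu\to1$, $S$ has a finite nonzero limit (which can be normalized to $1$), and $m$ has a finite limit. 4. If moreover no $\omega_j$ ($1\le j\le N-1$) vanishes identically, then $a_j^2=j(N-j)$ for all $j$ and the solution belongs to the local family of solutions at infinity: up to the symmetries $\omega_j\to-\omega_j$, the functions $\mu$ and $\omega_j$ are, for large $r$, analytic functions of $1/r$ near $1/r=0$, and there are constants $M,c_1,\dots,c_{N-1}$ with $$\mu=1-\frac{2M}{r}+O(r^{-4}),\qquad \omega_j=\sqrt{j(N-j)}-\frac{c_j}{r}+O(r^{-2}).$$ -/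

import Mathlib

open Filter Topology Asymptotics

noncomputable section

/-- The factor `1 - ω_j² + (ω_{j-1}² + ω_{j+1}²) / 2` of the gauge field equations
(only used for `1 ≤ j`). -/
def gaugeFactor (w : ℕ → ℝ) (j : ℕ) : ℝ :=
  1 - w j ^ 2 + (1 / 2) * (w (j - 1) ^ 2 + w (j + 1) ^ 2)

/-- The tangential pressure
`p_θ = (1 / (4 r⁴)) ∑_{j=1}^N (ω_j² - ω_{j-1}² - N - 1 + 2 j)²`. -/
def pTheta (N : ℕ) (r : ℝ) (w : ℕ → ℝ) : ℝ :=
  1 / (4 * r ^ 4) *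
    ∑ j ∈ Finset.Icc 1 N, (w j ^ 2 - w (j - 1) ^ 2 - (N : ℝ) - 1 + 2 * (j : ℝ)) ^ 2

/-- `∑_{j=1}^{N-1} v_j²`. -/
def sumSq (N : ℕ) (v : ℕ → ℝ) : ℝ := ∑ j ∈ Finset.Ico 1 N, v j ^ 2

/-- `(r, Ψ, κ, S, ω_j, U_j)`, as functions of `τ > 0`, solve the static spherically symmetric
`su(N)` Einstein-Yang-Mills equations in the regular form, where `μ = Ψ²`, `dr/dτ = r Ψ`,
`U_j = Ψ dω_j/dr` (so that `μ G = ∑ U_j²`), and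
`κ = (1 + Ψ² + 2 μ G - 2 r² p_θ) / (2 Ψ)`. By convention `ω_0 = ω_N = 0`. -/
structure IsTauSolution (N : ℕ) (r Ψ κ S : ℝ → ℝ) (ω U : ℕ → ℝ → ℝ) : Prop where
  omega_zero : ∀ τ > 0, ω 0 τ = 0
  omega_N : ∀ τ > 0, ω N τ = 0
  S_ne : ∀ τ > 0, S τ ≠ 0
  kappa_def : ∀ τ > 0,
    2 * Ψ τ * κ τ = 1 + Ψ τ ^ 2 + 2 * sumSq N (fun j => U j τ)
      - 2 * r τ ^ 2 * pTheta N (r τ) (fun j => ω j τ)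
  r_eq : ∀ τ > 0, HasDerivAt r (r τ * Ψ τ) τ
  omega_eq : ∀ j, 1 ≤ j → j < N → ∀ τ > 0, HasDerivAt (ω j) (r τ * U j τ) τ
  Psi_eq : ∀ τ > 0,
    HasDerivAt Ψ ((κ τ - Ψ τ) * Ψ τ - 2 * sumSq N (fun j => U j τ)) τ
  S_eq : ∀ τ > 0, HasDerivAt (fun t => S t * Ψ t) (S τ * (κ τ - Ψ τ) * Ψ τ) τ
  U_eq : ∀ j, 1 ≤ j → j < N → ∀ τ > 0,
    HasDerivAt (U j)
      (-(κ τ - Ψ τ) * U j τ - 1 / r τ * gaugeFactor (fun i => ω i τ) j * ω j τ) τ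
  kappa_eq : ∀ τ > 0, HasDerivAt κ (-κ τ ^ 2 + 1 + 2 * sumSq N (fun j => U j τ)) τ

/-- A regular non-degenerate event horizon at radius `rh > 0`, approached along the filter `l`:
`r → rh`, `μ → μ(rh) = 0`, the derivative `μ'(rh) = lim μ / (r - rh)` exists, is finite and
positive, and all `ω_j` and `ω_j' = dω_j/dr` have finite limits. The filter `l` lives on the
values of whatever variable (`τ` or `r`) is used to parametrize the solution. -/
structure RegularHorizonAlong {α : Type} (N : ℕ) (l : Filter α) (rh : ℝ) (r μ : α → ℝ)
    (ω ω' : ℕ → α → ℝ) : Prop where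
  rh_pos : 0 < rh
  r_lim : Tendsto r l (𝓝 rh)
  mu_lim : Tendsto μ l (𝓝 0)
  dmu_lim : ∃ a > 0, Tendsto (fun x => μ x / (r x - rh)) l (𝓝 a)
  omega_lim : ∀ j, 1 ≤ j → j < N → ∃ a, Tendsto (ω j) l (𝓝 a)
  domega_lim : ∀ j, 1 ≤ j → j < N → ∃ a, Tendsto (ω' j) l (𝓝 a)

/-- Critical points of the flat space gauge field equations: `a_0 = a_N = 0` and
`(1 - a_j² + (a_{j-1}² + a_{j+1}²) / 2) a_j = 0` for `1 ≤ j ≤ N - 1`. -/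
def IsFlatCriticalPoint (N : ℕ) (a : ℕ → ℝ) : Prop :=
  a 0 = 0 ∧ a N = 0 ∧ ∀ j, 1 ≤ j → j < N → gaugeFactor a j * a j = 0

/-- The metric function `μ = 1 - 2 m(r) / r`. -/
def metricMu (m : ℝ → ℝ) (r : ℝ) : ℝ := 1 - 2 * m r / r

/-- `G = ∑_{j=1}^{N-1} (dω_j/dr)²`. -/
def radialG (N : ℕ) (w : ℕ → ℝ → ℝ) (r : ℝ) : ℝ := sumSq N (fun j => deriv (w j) r)

/-- `(m, S, ω_j)`, as functions of the radius `r`, solve the `su(N)` Einstein-Yang-Mills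
equations on the open set `I` of radii (with `ω_0 = ω_N = 0` and `S ≠ 0` there). -/
structure SolvesRadial (N : ℕ) (I : Set ℝ) (m S : ℝ → ℝ) (w : ℕ → ℝ → ℝ) : Prop where
  omega_zero : ∀ r ∈ I, w 0 r = 0
  omega_N : ∀ r ∈ I, w N r = 0
  S_ne : ∀ r ∈ I, S r ≠ 0
  diff : ∀ j, 1 ≤ j → j < N → ∀ r ∈ I, DifferentiableAt ℝ (w j) r
  diff_deriv : ∀ j, 1 ≤ j → j < N → ∀ r ∈ I, DifferentiableAt ℝ (deriv (w j)) r
  gauge_eq : ∀ j, 1 ≤ j → j < N → ∀ r ∈ I,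
    r ^ 2 * metricMu m r * deriv (deriv (w j)) r
      + (2 * m r - 2 * r ^ 3 * pTheta N r (fun i => w i r)) * deriv (w j) r
      + gaugeFactor (fun i => w i r) j * w j r = 0
  m_eq : ∀ r ∈ I, HasDerivAt m
    (metricMu m r * radialG N w r + r ^ 2 * pTheta N r (fun i => w i r)) r
  S_eq : ∀ r ∈ I, HasDerivAt S (2 * radialG N w r / r * S r) r

/-- Regular black hole solutions: a solution on `r > rh` with a regular event horizon at `rh`,
with `μ > 0` and `ω_j`, `ω_j'` finite (differentiable) for all `r > rh`, and asymptotically flat: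
as `r → ∞`, `μ → 1`, the lapse factor `S` has a finite nonzero limit and the mass function `m`
has a finite limit. -/
structure IsRegularBlackHole (N : ℕ) (rh : ℝ) (m S : ℝ → ℝ) (w : ℕ → ℝ → ℝ) : Prop where
  solves : SolvesRadial N (Set.Ioi rh) m S w
  horizon : RegularHorizonAlong N (𝓝[>] rh) rh id (metricMu m) w (fun j => deriv (w j))
  mu_pos : ∀ r > rh, 0 < metricMu m r
  mu_flat : Tendsto (metricMu m) atTop (𝓝 1)
  S_flat : ∃ Sinf : ℝ, Sinf ≠ 0 ∧ Tendsto S atTop (𝓝 Sinf)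
  m_flat : ∃ M : ℝ, Tendsto m atTop (𝓝 M)

/-- Membership in the family of local solutions near `r = ∞` that are analytic in `1 / r` with
`μ = 1 - 2 M / r + O(r⁻⁴)` and `ω_j = √(j (N - j)) - c_j / r + O(r⁻²)` for constants `M`, `c_j`.
The field equations are invariant under `ω_j → -ω_j` for each single `j`; `ε_j = ±1` are the
signs that bring the solution to this normalized form. -/
def InLocalFamilyAtInfinity (N : ℕ) (m S : ℝ → ℝ) (w : ℕ → ℝ → ℝ) : Prop :=
  (∃ r₀ > 0, SolvesRadial N (Set.Ioi r₀) m S w) ∧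
  ∃ (M : ℝ) (c ε : ℕ → ℝ),
    (∃ μhat : ℝ → ℝ, AnalyticAt ℝ μhat 0 ∧ ∀ᶠ r in atTop, metricMu m r = μhat (1 / r)) ∧
    ((fun r : ℝ => metricMu m r - (1 - 2 * M / r)) =O[atTop] fun r : ℝ => 1 / r ^ 4) ∧
    ∀ j, 1 ≤ j → j < N →
      (ε j = 1 ∨ ε j = -1) ∧
      (∃ what : ℝ → ℝ, AnalyticAt ℝ what 0 ∧ ∀ᶠ r in atTop, ε j * w j r = what (1 / r)) ∧
      ((fun r : ℝ => ε j * w j r - (Real.sqrt ((j : ℝ) * ((N : ℝ) - j)) - c j / r))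
        =O[atTop] fun r : ℝ => 1 / r ^ 2)

end

/-! ### Comparison arguments and blow-up for real differential inequalities -/

noncomputable section

/-! With `ω̇_j = r U_j` the gauge equations read `ω̈_j = (2Ψ - κ) ω̇_j - F_j ω_j`. Put `d_j = ω_j² -
j(N-j)`. Then `P = 4 r⁴ p_θ` is the sum of the squares of the first differences of `d`, `F_j` is
half its second difference, and the gradient of `P` is `-8 F_j ω_j`. Summation by parts
(`sum_mul_second_diff`) drives all the algebra.

Boundedness of the gauge field (`eventually_sumSq_omega_le`) is by contradiction. If `ρ = ∑ ω_j²` is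
unbounded, the virial identity makes it increasing from some time on. The mass bound `2m ≤ r` then
forces `ρ = O(r)`, the energy `∑ U_j²/2 - P/(8r²)` is bounded above, and so is `κ`. Since `P`
dominates `ρ²`, one gets `ρ'' ≥ -K ρ' + c ρ²`, which blows up in finite `τ`.

Once the field is bounded, `∑ U_j² → 0`, `Ψ → 1`, `κ → 1`, and the system is asymptotic to the
autonomous, anti-damped `ω̈_j = ω̇_j - F_j ω_j`. Its energy `∑ ω̇_j²/2 - P/8` is eventually monotone
and bounded. Barbalat's lemma gives `ω̇_j → 0` and then `F_j ω_j → 0`. Limit points are therefore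
critical points; a critical point is determined by its signs, so each coordinate takes finitely many
values there and cannot oscillate. If `a_j = 0`, then `F_j` has a limit at least `1`, and an
anti-damped oscillator that comes to rest is identically zero (`omega_eq_zero_of_tendsto_zero`). The
limits of `m` and `S` follow because their rates are `O(Ψ/r)`, which is the order of the derivative
of `1/r`.

If no `ω_j` vanishes identically, the limit is the vacuum `a_j² = j(N-j)`. A Lyapunov estimate gives
decay like a power of `z = 1/r` (`exists_abs_dev_le`). Put `ω_{i+1} = a_{i+1}(1 + 2u_i)` and expand
`u` in the binomials `i.choose l`. The linearization becomes triangular, and mode `l` has exponents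
`l + 1` and `-(l + 2)` in `z`. These integer exponents resonate and could produce logarithms. They
do not, because a product of polynomials in `i` of degrees `a` and `b` has degree at most `a + b`
(`newtonMul_eq_zero`): with mode `l` of size `z^(l+1)`, the quadratic terms in mode `l` have size
`z^(l+2)`. A bootstrap (`isBigO_step`) reaches this scaling up to an arbitrarily small loss, and the
rescaled modes solve a regular Fuchsian system with nonnegative exponents, whose continuous
solutions are analytic at `z = 0` (`exists_analyticAt_of_fuchsian`). -/

theorem sub_le_mul_of_hasDerivAt_le {f f' : ℝ → ℝ} {a b C : ℝ} (hab : a ≤ b)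
    (hf : ∀ t ∈ Set.Icc a b, HasDerivAt f (f' t) t) (hC : ∀ t ∈ Set.Ioo a b, f' t ≤ C) :
    f b - f a ≤ C * (b - a) := by
  apply (convex_Icc a b).image_sub_le_mul_sub_of_deriv_le
    (fun t ht => (hf t ht).continuousAt.continuousWithinAt)
    (fun t ht => ((hf t (interior_subset ht)).differentiableAt).differentiableWithinAt)
    (fun t ht => ?_) a (Set.left_mem_Icc.2 hab) b (Set.right_mem_Icc.2 hab) hab
  rw [interior_Icc] at ht
  rw [(hf t (Set.Ioo_subset_Icc_self ht)).deriv]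
  exact hC t ht

theorem mul_le_sub_of_le_hasDerivAt {f f' : ℝ → ℝ} {a b C : ℝ} (hab : a ≤ b)
    (hf : ∀ t ∈ Set.Icc a b, HasDerivAt f (f' t) t) (hC : ∀ t ∈ Set.Ioo a b, C ≤ f' t) :
    C * (b - a) ≤ f b - f a := by
  have := sub_le_mul_of_hasDerivAt_le (f := fun t => -f t) (f' := fun t => -f' t) (C := -C) hab
    (fun t ht => (hf t ht).neg) (fun t ht => neg_le_neg (hC t ht))
  linarith

/-- A differentiable function with nonpositive derivative wherever it exceeds `M` stays
below `M`. -/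
theorem le_of_hasDerivAt_nonpos_above {f f' : ℝ → ℝ} {t₀ M : ℝ}
    (hf : ∀ t ≥ t₀, HasDerivAt f (f' t) t) (h0 : f t₀ ≤ M)
    (hd : ∀ t ≥ t₀, M < f t → f' t ≤ 0) : ∀ t ≥ t₀, f t ≤ M := by
  intro t₁ ht₁
  by_contra! hlt
  have hcont : ContinuousOn f (Set.Icc t₀ t₁) :=
    fun t ht => (hf t ht.1).continuousAt.continuousWithinAt
  have hK : IsCompact {t ∈ Set.Icc t₀ t₁ | f t ≤ M} :=
    (isCompact_Icc (a := t₀) (b := t₁)).of_isClosed_subset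
      (hcont.preimage_isClosed_of_isClosed isClosed_Icc isClosed_Iic) fun x hx => hx.1
  obtain ⟨s, ⟨hs, hsM⟩, hmax⟩ := hK.exists_isGreatest ⟨t₀, ⟨le_rfl, ht₁⟩, h0⟩
  have hst : s ≤ t₁ := hs.2
  have := sub_le_mul_of_hasDerivAt_le (f := f) (f' := f') (C := 0) hst
    (fun t ht => hf t (hs.1.trans ht.1)) (fun t ht => by
      apply hd t (hs.1.trans ht.1.le)
      by_contra! hle
      exact absurd (hmax ⟨⟨hs.1.trans ht.1.le, ht.2.le⟩, hle⟩) (not_le.2 ht.1))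
  linarith

/-- A differentiable function that starts positive and has positive derivative at a possible
first zero stays positive. -/
theorem pos_of_hasDerivAt_pos_at_first_zero {f f' : ℝ → ℝ} {t₀ : ℝ}
    (hf : ∀ t ≥ t₀, HasDerivAt f (f' t) t) (h0 : 0 < f t₀)
    (hd : ∀ t > t₀, (∀ s ∈ Set.Ico t₀ t, 0 < f s) → f t = 0 → 0 < f' t) :
    ∀ t ≥ t₀, 0 < f t := by
  intro t₁ ht₁
  by_contra! hneg
  have hcont : ContinuousOn f (Set.Icc t₀ t₁) :=
    fun t ht => (hf t ht.1).continuousAt.continuousWithinAt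
  have hK : IsCompact {t ∈ Set.Icc t₀ t₁ | f t ≤ 0} :=
    (isCompact_Icc (a := t₀) (b := t₁)).of_isClosed_subset
      (hcont.preimage_isClosed_of_isClosed isClosed_Icc isClosed_Iic) fun x hx => hx.1
  obtain ⟨s, ⟨hs, hs0⟩, hmin⟩ := hK.exists_isLeast ⟨t₁, ⟨ht₁, le_rfl⟩, hneg⟩
  have hst : t₀ < s := lt_of_le_of_ne hs.1 (by rintro rfl; linarith)
  have hpos : ∀ x ∈ Set.Ico t₀ s, 0 < f x := by
    intro x hx
    by_contra! hx0
    exact absurd (hmin ⟨⟨hx.1, hx.2.le.trans hs.2⟩, hx0⟩) (not_le.2 hx.2)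
  have hzero : f s = 0 := by
    refine le_antisymm hs0 ?_
    have : Tendsto f (𝓝[<] s) (𝓝 (f s)) := (hf s hs.1).continuousAt.mono_left nhdsWithin_le_nhds
    refine ge_of_tendsto this ?_
    filter_upwards [Ioo_mem_nhdsLT hst] with x hx
    exact (hpos x ⟨hx.1.le, hx.2⟩).le
  have hds := hd s hst hpos hzero
  rw [← (hf s hs.1).deriv] at hds
  have h1 := eventually_nhdsWithin_sign_eq_of_deriv_pos hds hzero
  have h2 : ∀ᶠ x in 𝓝[<] s, SignType.sign (f x) = SignType.sign (x - s) :=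
    h1.filter_mono nhdsWithin_le_nhds
  obtain ⟨x, hx, hx'⟩ := (h2.and (Ioo_mem_nhdsLT hst)).exists
  rw [sign_pos (hpos x ⟨hx'.1.le, hx'.2⟩), sign_neg (by linarith [hx'.2])] at hx
  exact absurd hx (by decide)

theorem eventually_le_of_hasDerivAt {f f' : ℝ → ℝ} {M δ : ℝ} (hδ : 0 < δ)
    (h : ∀ᶠ t in atTop, HasDerivAt f (f' t) t ∧ (M < f t → f' t ≤ -δ)) :
    ∀ᶠ t in atTop, f t ≤ M := by
  obtain ⟨T, hT⟩ := eventually_atTop.1 h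
  suffices ∃ t₀ ≥ T, f t₀ ≤ M by
    obtain ⟨t₀, ht₀, hM⟩ := this
    filter_upwards [eventually_ge_atTop t₀] with t ht
    exact le_of_hasDerivAt_nonpos_above (fun t ht => (hT t (ht₀.trans ht)).1) hM
      (fun t ht hlt => by linarith [(hT t (ht₀.trans ht)).2 hlt]) t ht
  by_contra! hcon
  set b := T + (f T - M) / δ with hb
  have hfT := hcon T le_rfl
  have hTb : T ≤ b := by
    have : 0 ≤ (f T - M) / δ := div_nonneg (by linarith) hδ.le
    linarith
  have := sub_le_mul_of_hasDerivAt_le (f := f) (f' := f') (C := -δ) hTb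
    (fun t ht => (hT t ht.1).1) (fun t ht => (hT t ht.1.le).2 (hcon t ht.1.le))
  have h1 : -δ * (b - T) = -(f T - M) := by rw [hb]; field_simp; ring
  have h2 := hcon b hTb
  linarith

theorem eventually_ge_of_hasDerivAt {f f' : ℝ → ℝ} {M δ : ℝ} (hδ : 0 < δ)
    (h : ∀ᶠ t in atTop, HasDerivAt f (f' t) t ∧ (f t < M → δ ≤ f' t)) :
    ∀ᶠ t in atTop, M ≤ f t := by
  have := eventually_le_of_hasDerivAt (f := fun t => -f t) (f' := fun t => -f' t) (M := -M) hδ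
    (h.mono fun t ht => ⟨ht.1.neg, fun hlt => neg_le_neg (ht.2 (neg_lt_neg_iff.1 hlt))⟩)
  exact this.mono fun t ht => neg_le_neg_iff.1 ht

/-- If `f t ≥ ε`, the Lipschitz bound keeps `f ≥ ε/2` on an interval of fixed length `η`. There `H'
≥ ε/4`, so `H` gains `ε η / 4`, which contradicts its convergence. -/
theorem eventually_lt_of_tendsto_of_hasDerivAt_near {H H' f : ℝ → ℝ} {ℓ L ε : ℝ} (hL : 0 < L)
    (hε : 0 < ε) (hH : ∀ᶠ t in atTop, HasDerivAt H (H' t) t) (hlim : Tendsto H atTop (𝓝 ℓ))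
    (hf : Tendsto (fun t => H' t - f t) atTop (𝓝 0))
    (hLip : ∀ᶠ t in atTop, ∀ s ≥ t, |f s - f t| ≤ L * (s - t)) :
    ∀ᶠ t in atTop, f t < ε := by
  set η := ε / (2 * L) with hη
  have hηpos : 0 < η := by positivity
  have hLη : L * η = ε / 2 := by rw [hη]; field_simp
  have hcau : Tendsto (fun t => H (t + η) - H t) atTop (𝓝 0) := by
    have := (hlim.comp (tendsto_atTop_add_const_right atTop η tendsto_id)).sub hlim
    simpa using this
  have h1 : ∀ᶠ t in atTop, H (t + η) - H t < ε / 4 * η :=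
    hcau.eventually_lt_const (by positivity)
  have h2 : ∀ᶠ t in atTop, -(ε / 4) < H' t - f t := hf.eventually_const_lt (by linarith)
  obtain ⟨T, hT⟩ := eventually_atTop.1 (hH.and h2)
  filter_upwards [h1, hLip, eventually_ge_atTop T] with t ht hl htT
  by_contra! hge
  have := mul_le_sub_of_le_hasDerivAt (f := H) (f' := H') (C := ε / 4) (a := t) (b := t + η)
    (by linarith) (fun s hs => (hT s (htT.trans hs.1)).1) (fun s hs => by
      have ha := (hT s (htT.trans hs.1.le)).2
      have hb := abs_le.1 (hl s hs.1.le)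
      have hc : L * (s - t) ≤ L * η := by
        apply mul_le_mul_of_nonneg_left _ hL.le
        linarith [hs.2]
      linarith [hb.1])
  have h3 : t + η - t = η := by ring
  rw [h3] at this
  linarith

/-- A version of Barbalat's lemma. -/
theorem tendsto_zero_of_tendsto_of_hasDerivAt_near {H H' f : ℝ → ℝ} {ℓ L : ℝ} (hL : 0 < L)
    (hH : ∀ᶠ t in atTop, HasDerivAt H (H' t) t) (hlim : Tendsto H atTop (𝓝 ℓ))
    (hf : Tendsto (fun t => H' t - f t) atTop (𝓝 0))
    (hLip : ∀ᶠ t in atTop, ∀ s ≥ t, |f s - f t| ≤ L * (s - t)) :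
    Tendsto f atTop (𝓝 0) := by
  rw [tendsto_order]
  constructor
  · intro a ha
    have := eventually_lt_of_tendsto_of_hasDerivAt_near (H := fun t => -H t)
      (H' := fun t => -H' t) (f := fun t => -f t) (ε := -a) hL (by linarith)
      (hH.mono fun t ht => ht.neg) hlim.neg
      (by
        have := hf.neg
        simp only [neg_zero] at this
        refine this.congr fun t => by ring)
      (hLip.mono fun t ht s hs => by
        rw [← abs_neg]
        convert ht s hs using 2
        ring)
    filter_upwards [this] with t ht
    linarith
  · intro a ha
    exact eventually_lt_of_tendsto_of_hasDerivAt_near hL ha hH hlim hf hLip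

/-- A positive increasing solution of `ρ'' ≥ -K ρ' + c ρ²` with `c > 0` blows up in finite time. -/
theorem not_tendsto_atTop_of_quadratic_growth {ρ ρ' ρ'' : ℝ → ℝ} {T K c : ℝ} (hc : 0 < c)
    (h1 : ∀ t ≥ T, HasDerivAt ρ (ρ' t) t) (h2 : ∀ t ≥ T, HasDerivAt ρ' (ρ'' t) t)
    (hpos : ∀ t ≥ T, 0 < ρ' t) (hge : ∀ t ≥ T, -K * ρ' t + c * ρ t ^ 2 ≤ ρ'' t) :
    ¬ Tendsto ρ atTop atTop := by
  intro hlim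
  obtain ⟨T₁, hT₁⟩ := eventually_atTop.1
    ((hlim.eventually_ge_atTop (max 1 (K ^ 2 / c))).and (eventually_ge_atTop T))
  -- The friction-free energy would be `ρ'² / 2 - c ρ³ / 3`. The extra weight `ρ` on `ρ'²` leaves
  -- room to absorb `K ρ'`: the derivative of `Φ` is at least `ρ' ((ρ' - K ρ)² + (c ρ - K²) ρ²)`.
  set Φ : ℝ → ℝ := fun t => ρ t * ρ' t ^ 2 - c / 4 * ρ t ^ 4 with hΦ
  have hΦd : ∀ t ≥ T₁, HasDerivAt Φ (ρ' t * ρ' t ^ 2 + ρ t * (2 * ρ' t * ρ'' t)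
      - c / 4 * (4 * ρ t ^ 3 * ρ' t)) t := by
    intro t ht
    have hT := (hT₁ t ht).2
    have e1 := ((h1 t hT).mul ((h2 t hT).pow 2)).sub (((h1 t hT).pow 4).const_mul (c / 4))
    refine e1.congr_deriv ?_
    simp only [Pi.pow_apply]
    push_cast
    ring
  have hΦmono : ∀ t ≥ T₁, Φ T₁ ≤ Φ t := by
    intro t ht
    have := mul_le_sub_of_le_hasDerivAt (C := 0) ht (fun s hs => hΦd s hs.1) (fun s hs => by
      obtain ⟨hρ, hT⟩ := hT₁ s hs.1.le
      have hp := hpos s hT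
      have hg := hge s hT
      have hρ1 : 1 ≤ ρ s := (le_max_left _ _).trans hρ
      have hρK : K ^ 2 ≤ c * ρ s := by
        have := (le_max_right _ _).trans hρ
        rw [div_le_iff₀ hc] at this
        linarith
      have key : 0 ≤ ρ' s * (ρ' s ^ 2 + 2 * ρ s * ρ'' s - c * ρ s ^ 3) := by
        apply mul_nonneg hp.le
        have : 2 * ρ s * (-K * ρ' s + c * ρ s ^ 2) ≤ 2 * ρ s * ρ'' s :=
          mul_le_mul_of_nonneg_left hg (by linarith)
        nlinarith [sq_nonneg (ρ' s - K * ρ s), mul_le_mul_of_nonneg_left hρK (sq_nonneg (ρ s))]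
      nlinarith [key])
    linarith
  obtain ⟨T₂, hT₂⟩ := eventually_atTop.1
    ((hlim.eventually_ge_atTop (max 1 (-Φ T₁ * 8 / c))).and (eventually_ge_atTop T₁))
  set k := Real.sqrt (c / 8) with hk
  have hkpos : 0 < k := Real.sqrt_pos.2 (by positivity)
  have hksq : k ^ 2 = c / 8 := Real.sq_sqrt (by positivity)
  have hgrow : ∀ t ≥ T₂, k * (ρ t * Real.sqrt (ρ t)) ≤ ρ' t := by
    intro t ht
    obtain ⟨hρ, hT⟩ := hT₂ t ht
    have hρ1 : 1 ≤ ρ t := (le_max_left _ _).trans hρ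
    have hρΦ : -Φ T₁ ≤ c / 8 * ρ t := by
      have := (le_max_right _ _).trans hρ
      rw [div_le_iff₀ hc] at this
      linarith
    have hp := hpos t ((hT₁ t hT).2)
    have hm := hΦmono t hT
    have hsq : Real.sqrt (ρ t) ^ 2 = ρ t := Real.sq_sqrt (by linarith)
    apply le_of_sq_le_sq _ hp.le
    have e1 : (k * (ρ t * Real.sqrt (ρ t))) ^ 2 = c / 8 * ρ t ^ 3 := by
      rw [mul_pow, mul_pow, hksq, hsq]; ring
    rw [e1]
    have h4 : ρ t ≤ ρ t ^ 4 := le_self_pow₀ hρ1 (by norm_num)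
    have e2 : ρ t * (c / 8 * ρ t ^ 3) ≤ ρ t * ρ' t ^ 2 := by
      simp only [hΦ] at hm hρΦ
      nlinarith
    exact le_of_mul_le_mul_left e2 (by linarith)
  -- As `ρ' ≥ k ρ^(3/2)`, the function `ρ^(-1/2)` decreases at rate at least `k / 2` and would reach
  -- zero in finite time.
  set y : ℝ → ℝ := fun t => (Real.sqrt (ρ t))⁻¹ with hy
  have hyd : ∀ t ≥ T₂, HasDerivAt y (-(ρ' t / (2 * Real.sqrt (ρ t))) / Real.sqrt (ρ t) ^ 2) t := by
    intro t ht
    obtain ⟨hρ, hT⟩ := hT₂ t ht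
    have hρ1 : 1 ≤ ρ t := (le_max_left _ _).trans hρ
    exact ((h1 t (hT₁ t hT).2).sqrt (by linarith)).inv (Real.sqrt_pos.2 (by linarith)).ne'
  have hypos : ∀ t ≥ T₂, 0 < y t := fun t ht => by
    have hρ1 : 1 ≤ ρ t := (le_max_left _ _).trans (hT₂ t ht).1
    exact inv_pos.2 (Real.sqrt_pos.2 (by linarith))
  have hb : T₂ ≤ T₂ + 2 * y T₂ / k := by
    have := hypos T₂ le_rfl
    have : 0 < 2 * y T₂ / k := by positivity
    linarith
  have := sub_le_mul_of_hasDerivAt_le (C := -(k / 2)) hb (fun s hs => hyd s hs.1) (fun s hs => by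
    have hρ1 : 1 ≤ ρ s := (le_max_left _ _).trans (hT₂ s hs.1.le).1
    have hq : 0 < Real.sqrt (ρ s) := Real.sqrt_pos.2 (by linarith)
    have hsq : Real.sqrt (ρ s) ^ 2 = ρ s := Real.sq_sqrt (by linarith)
    have hg := hgrow s hs.1.le
    rw [hsq, neg_div, neg_le_neg_iff, div_div, div_le_div_iff₀ (by norm_num) (by positivity)]
    nlinarith)
  have e : -(k / 2) * (T₂ + 2 * y T₂ / k - T₂) = - y T₂ := by field_simp; ring
  rw [e] at this
  linarith [hypos _ hb]

theorem exists_tendsto_atTop_of_monotoneOn_Ici {f : ℝ → ℝ} {T C : ℝ}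
    (hf : MonotoneOn f (Set.Ici T)) (hC : ∀ t ≥ T, f t ≤ C) : ∃ ℓ, Tendsto f atTop (𝓝 ℓ) := by
  have hmono : Monotone fun t => f (max t T) := fun a b hab =>
    hf (Set.mem_Ici.2 (le_max_right _ _)) (Set.mem_Ici.2 (le_max_right _ _)) (max_le_max hab le_rfl)
  refine ⟨_, (tendsto_atTop_ciSup hmono ⟨C, ?_⟩).congr' ?_⟩
  · rintro _ ⟨t, rfl⟩
    exact hC _ (le_max_right _ _)
  · filter_upwards [eventually_ge_atTop T] with t ht
    simp [max_eq_left ht]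

end

/-! ### Algebra of the gauge potential and of flat critical points -/

noncomputable section

/-- The vacuum values `j (N - j)` of `ω_j²`. -/
def vacuumSq (N j : ℕ) : ℝ := (j : ℝ) * ((N : ℝ) - j)

/-- The potential `4 r⁴ p_θ` of the gauge field. -/
def gaugePotential (N : ℕ) (w : ℕ → ℝ) : ℝ :=
  ∑ j ∈ Finset.Icc 1 N, (w j ^ 2 - w (j - 1) ^ 2 - (N : ℝ) - 1 + 2 * (j : ℝ)) ^ 2

/-- The deviation of `ω_j²` from its vacuum value. -/
def vacuumDev (N : ℕ) (w : ℕ → ℝ) (j : ℕ) : ℝ := w j ^ 2 - vacuumSq N j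

theorem pTheta_eq_gaugePotential (N : ℕ) (r : ℝ) (w : ℕ → ℝ) :
    pTheta N r w = 1 / (4 * r ^ 4) * gaugePotential N w := rfl

theorem gaugePotential_nonneg (N : ℕ) (w : ℕ → ℝ) : 0 ≤ gaugePotential N w :=
  Finset.sum_nonneg fun _ _ => sq_nonneg _

theorem sumSq_nonneg (N : ℕ) (v : ℕ → ℝ) : 0 ≤ sumSq N v :=
  Finset.sum_nonneg fun _ _ => sq_nonneg _

theorem sum_Icc_one_succ {M : Type*} [AddCommMonoid M] (n : ℕ) (f : ℕ → M) :
    ∑ j ∈ Finset.Icc 1 (n + 1), f j = ∑ j ∈ Finset.Icc 1 n, f j + f (n + 1) :=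
  Finset.sum_Icc_succ_top (by omega) f

/-- Summation by parts with vanishing boundary values. -/
theorem sum_mul_second_diff {R : Type*} [CommRing R] {N : ℕ} (hN : 1 ≤ N) (x y : ℕ → R)
    (h0 : x 0 = 0) (hNx : x N = 0) :
    ∑ j ∈ Finset.Ico 1 N, x j * (2 * y j - y (j - 1) - y (j + 1)) =
      ∑ j ∈ Finset.Icc 1 N, (x j - x (j - 1)) * (y j - y (j - 1)) := by
  have key : ∀ n, ∑ j ∈ Finset.Icc 1 (n + 1), (x j - x (j - 1)) * (y j - y (j - 1)) =
      ∑ j ∈ Finset.Ico 1 (n + 1), x j * (2 * y j - y (j - 1) - y (j + 1))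
        + x (n + 1) * (y (n + 1) - y n) := by
    intro n
    induction n with
    | zero => simp [h0]
    | succ n ih =>
      rw [sum_Icc_one_succ, ih, Finset.sum_Ico_succ_top (b := n + 1) (by omega)]
      simp only [Nat.add_sub_cancel]
      ring
  obtain ⟨n, rfl⟩ : ∃ n, N = n + 1 := ⟨N - 1, by omega⟩
  rw [key n, hNx]
  ring

theorem vacuumSq_zero (N : ℕ) : vacuumSq N 0 = 0 := by simp [vacuumSq]

theorem vacuumSq_self (N : ℕ) : vacuumSq N N = 0 := by simp [vacuumSq]

theorem one_le_vacuumSq {N j : ℕ} (h1 : 1 ≤ j) (hj : j < N) : 1 ≤ vacuumSq N j := by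
  have h1' : (1 : ℝ) ≤ j := by exact_mod_cast h1
  have h2' : (j : ℝ) + 1 ≤ N := by exact_mod_cast hj
  unfold vacuumSq
  nlinarith

theorem vacuumSq_second_diff (N : ℕ) {j : ℕ} (h1 : 1 ≤ j) :
    2 * vacuumSq N j - vacuumSq N (j - 1) - vacuumSq N (j + 1) = 2 := by
  obtain ⟨i, rfl⟩ : ∃ i, j = i + 1 := ⟨j - 1, by omega⟩
  simp only [vacuumSq, Nat.add_sub_cancel]
  push_cast
  ring

theorem vacuumDev_zero {N : ℕ} {w : ℕ → ℝ} (h0 : w 0 = 0) : vacuumDev N w 0 = 0 := by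
  simp [vacuumDev, h0, vacuumSq_zero]

theorem vacuumDev_self {N : ℕ} {w : ℕ → ℝ} (hN : w N = 0) : vacuumDev N w N = 0 := by
  simp [vacuumDev, hN, vacuumSq_self]

theorem gaugeFactor_eq_vacuumDev (N : ℕ) (w : ℕ → ℝ) {j : ℕ} (h1 : 1 ≤ j) :
    gaugeFactor w j = -(1 / 2) *
      (2 * vacuumDev N w j - vacuumDev N w (j - 1) - vacuumDev N w (j + 1)) := by
  have := vacuumSq_second_diff N h1
  simp only [gaugeFactor, vacuumDev]
  linarith

theorem gaugePotential_eq_vacuumDev (N : ℕ) (w : ℕ → ℝ) :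
    gaugePotential N w =
      ∑ j ∈ Finset.Icc 1 N, (vacuumDev N w j - vacuumDev N w (j - 1)) ^ 2 := by
  refine Finset.sum_congr rfl fun j hj => ?_
  obtain ⟨i, rfl⟩ : ∃ i, j = i + 1 := ⟨j - 1, by have := (Finset.mem_Icc.1 hj).1; omega⟩
  simp only [vacuumDev, vacuumSq, Nat.add_sub_cancel]
  push_cast
  ring

/-- Discrete Poincaré inequality: telescoping from the boundary value and Cauchy–Schwarz. -/
theorem sq_le_mul_sum_sq_diff {N : ℕ} (d : ℕ → ℝ) (h0 : d 0 = 0) {j : ℕ} (hj : j ≤ N) :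
    d j ^ 2 ≤ N * ∑ i ∈ Finset.Icc 1 N, (d i - d (i - 1)) ^ 2 := by
  have h1 : ∀ n, d n = ∑ i ∈ Finset.Icc 1 n, (d i - d (i - 1)) := by
    intro n
    induction n with
    | zero => simp [h0]
    | succ n ih =>
      rw [sum_Icc_one_succ, ← ih]
      simp
  have h2 : d j ^ 2 ≤ j * ∑ i ∈ Finset.Icc 1 j, (d i - d (i - 1)) ^ 2 := by
    have := sq_sum_le_card_mul_sum_sq (s := Finset.Icc 1 j) (f := fun i => d i - d (i - 1))
    rw [← h1 j] at this
    simpa using this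
  refine h2.trans ?_
  have h3 : ∑ i ∈ Finset.Icc 1 j, (d i - d (i - 1)) ^ 2 ≤
      ∑ i ∈ Finset.Icc 1 N, (d i - d (i - 1)) ^ 2 :=
    Finset.sum_le_sum_of_subset_of_nonneg (Finset.Icc_subset_Icc_right hj)
      fun _ _ _ => sq_nonneg _
  gcongr

theorem sum_sq_le_mul_sum_sq_diff {N : ℕ} (d : ℕ → ℝ) (h0 : d 0 = 0) :
    ∑ j ∈ Finset.Ico 1 N, d j ^ 2 ≤
      (N : ℝ) ^ 2 * ∑ i ∈ Finset.Icc 1 N, (d i - d (i - 1)) ^ 2 := by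
  have hs : 0 ≤ ∑ i ∈ Finset.Icc 1 N, (d i - d (i - 1)) ^ 2 :=
    Finset.sum_nonneg fun _ _ => sq_nonneg _
  calc ∑ j ∈ Finset.Ico 1 N, d j ^ 2
      ≤ ∑ j ∈ Finset.Ico 1 N, (N * ∑ i ∈ Finset.Icc 1 N, (d i - d (i - 1)) ^ 2) :=
        Finset.sum_le_sum fun j hj =>
          sq_le_mul_sum_sq_diff d h0 (Finset.mem_Ico.1 hj).2.le
    _ = ((N - 1 : ℕ) : ℝ) * (N * ∑ i ∈ Finset.Icc 1 N, (d i - d (i - 1)) ^ 2) := by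
        simp
    _ ≤ (N : ℝ) * (N * ∑ i ∈ Finset.Icc 1 N, (d i - d (i - 1)) ^ 2) := by
        have : ((N - 1 : ℕ) : ℝ) ≤ N := by exact_mod_cast Nat.sub_le N 1
        gcongr
    _ = _ := by ring

/-- Maximum principle in energy form: summation by parts turns `∑ d_j (-Δ d)_j = 0` into the
vanishing of all first differences. The alternative `d j = 0` is what allows critical points with
some vanishing components. -/
theorem eq_zero_of_second_diff_eq_zero {N : ℕ} (hN : 1 ≤ N) (d : ℕ → ℝ) (h0 : d 0 = 0)
    (hd : d N = 0)
    (h : ∀ j, 1 ≤ j → j < N → d j = 0 ∨ 2 * d j - d (j - 1) - d (j + 1) = 0) :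
    ∀ j ≤ N, d j = 0 := by
  have h1 := sum_mul_second_diff hN d d h0 hd
  rw [Finset.sum_eq_zero (fun j hj => by
    rw [Finset.mem_Ico] at hj
    rcases h j hj.1 hj.2 with h | h <;> simp [h])] at h1
  intro j hj
  have h2 := sq_le_mul_sum_sq_diff d h0 hj
  have h3 : ∑ i ∈ Finset.Icc 1 N, (d i - d (i - 1)) ^ 2 = 0 := by
    rw [h1]; exact Finset.sum_congr rfl fun _ _ => by ring
  rw [h3, mul_zero] at h2
  exact pow_eq_zero_iff (two_ne_zero) |>.1 (le_antisymm h2 (sq_nonneg _))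

/-- Virial identity: pairing the force with `ω` itself. It supplies the term `P + 2ρ - 2Γ` in the
second derivative of `ρ = ∑ ω_j²`, where `Γ` is the vacuum value of `ρ`. -/
theorem sum_gaugeFactor_mul_sq {N : ℕ} (hN : 1 ≤ N) (w : ℕ → ℝ) (h0 : w 0 = 0) (hw : w N = 0) :
    ∑ j ∈ Finset.Ico 1 N, gaugeFactor w j * w j * w j =
      -(gaugePotential N w / 2 + sumSq N w - ∑ j ∈ Finset.Ico 1 N, vacuumSq N j) := by
  have e1 := sum_mul_second_diff hN (fun j => w j ^ 2) (vacuumDev N w) (by simp [h0]) (by simp [hw])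
  have e2 := sum_mul_second_diff hN (vacuumDev N w) (vacuumSq N) (vacuumDev_zero h0)
    (vacuumDev_self hw)
  have e3 : ∑ j ∈ Finset.Ico 1 N, gaugeFactor w j * w j * w j =
      -(1 / 2) * ∑ j ∈ Finset.Ico 1 N, w j ^ 2 *
        (2 * vacuumDev N w j - vacuumDev N w (j - 1) - vacuumDev N w (j + 1)) := by
    rw [Finset.mul_sum]
    refine Finset.sum_congr rfl fun j hj => ?_
    rw [gaugeFactor_eq_vacuumDev N w (Finset.mem_Ico.1 hj).1]
    ring
  have e4 : ∑ j ∈ Finset.Ico 1 N, vacuumDev N w j *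
      (2 * vacuumSq N j - vacuumSq N (j - 1) - vacuumSq N (j + 1)) =
      2 * (sumSq N w - ∑ j ∈ Finset.Ico 1 N, vacuumSq N j) := by
    rw [sumSq, ← Finset.sum_sub_distrib, Finset.mul_sum]
    refine Finset.sum_congr rfl fun j hj => ?_
    rw [vacuumSq_second_diff N (Finset.mem_Ico.1 hj).1, vacuumDev]
    ring
  have e5 : ∑ j ∈ Finset.Icc 1 N, (w j ^ 2 - w (j - 1) ^ 2) *
      (vacuumDev N w j - vacuumDev N w (j - 1)) =
      gaugePotential N w + ∑ j ∈ Finset.Icc 1 N, (vacuumDev N w j - vacuumDev N w (j - 1)) *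
        (vacuumSq N j - vacuumSq N (j - 1)) := by
    rw [gaugePotential_eq_vacuumDev, ← Finset.sum_add_distrib]
    refine Finset.sum_congr rfl fun j _ => ?_
    simp only [vacuumDev]
    ring
  rw [e3, e1, e5, ← e2, e4]
  ring

/-- Coercivity: the difference on the left is `∑ d_j`, controlled by the Poincaré inequality. Away
from the vacuum value the potential therefore grows at least like `(∑ ω_j²)²`. -/
theorem sq_sumSq_sub_le {N : ℕ} (w : ℕ → ℝ) (h0 : w 0 = 0) :
    (sumSq N w - ∑ j ∈ Finset.Ico 1 N, vacuumSq N j) ^ 2 ≤ (N : ℝ) ^ 3 * gaugePotential N w := by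
  have h1 := sum_sq_le_mul_sum_sq_diff (N := N) (vacuumDev N w) (vacuumDev_zero h0)
  rw [← gaugePotential_eq_vacuumDev] at h1
  have h2 := sq_sum_le_card_mul_sum_sq (s := Finset.Ico 1 N) (f := vacuumDev N w)
  have e : sumSq N w - ∑ j ∈ Finset.Ico 1 N, vacuumSq N j = ∑ j ∈ Finset.Ico 1 N, vacuumDev N w j := by
    rw [sumSq, ← Finset.sum_sub_distrib]; rfl
  rw [e]
  have h3 : ((Finset.Ico 1 N).card : ℝ) ≤ N := by
    rw [Nat.card_Ico]; exact_mod_cast Nat.sub_le N 1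
  calc _ ≤ _ := h2
    _ ≤ (N : ℝ) * ((N : ℝ) ^ 2 * gaugePotential N w) := by
      gcongr
    _ = _ := by ring

theorem gaugePotential_le {N : ℕ} (hN : 1 ≤ N) (w : ℕ → ℝ) (h0 : w 0 = 0) (hw : w N = 0) :
    gaugePotential N w ≤ 4 * (sumSq N w + ∑ j ∈ Finset.Ico 1 N, vacuumSq N j) ^ 2 := by
  have h1 := sum_mul_second_diff hN (vacuumDev N w) (vacuumDev N w) (vacuumDev_zero h0)
    (vacuumDev_self hw)
  have e : gaugePotential N w = ∑ j ∈ Finset.Icc 1 N,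
      (vacuumDev N w j - vacuumDev N w (j - 1)) * (vacuumDev N w j - vacuumDev N w (j - 1)) := by
    rw [gaugePotential_eq_vacuumDev]
    exact Finset.sum_congr rfl fun _ _ => by ring
  set σ := sumSq N w + ∑ j ∈ Finset.Ico 1 N, vacuumSq N j with hσ
  have hterm : ∀ j ∈ Finset.Ico 1 N, |vacuumDev N w j| ≤ w j ^ 2 + vacuumSq N j := by
    intro j hj
    rw [Finset.mem_Ico] at hj
    have := one_le_vacuumSq hj.1 hj.2
    rw [vacuumDev, abs_le]
    constructor <;> nlinarith [sq_nonneg (w j)]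
  have hsum : ∑ j ∈ Finset.Ico 1 N, |vacuumDev N w j| ≤ σ := by
    rw [hσ, sumSq, ← Finset.sum_add_distrib]
    exact Finset.sum_le_sum hterm
  have hσ0 : 0 ≤ σ := (Finset.sum_nonneg fun _ _ => abs_nonneg _).trans hsum
  have hle : ∀ j ≤ N, |vacuumDev N w j| ≤ σ := by
    intro j hj
    by_cases hj' : j ∈ Finset.Ico 1 N
    · exact (Finset.single_le_sum (f := fun j => |vacuumDev N w j|)
        (fun _ _ => abs_nonneg _) hj').trans hsum
    · have : j = 0 ∨ j = N := by
        rw [Finset.mem_Ico] at hj'; omega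
      rcases this with rfl | rfl
      · simpa [vacuumDev_zero h0] using hσ0
      · simpa [vacuumDev_self hw] using hσ0
  rw [e, ← h1]
  calc _ ≤ ∑ j ∈ Finset.Ico 1 N, |vacuumDev N w j| * (4 * σ) := by
        refine Finset.sum_le_sum fun j hj => ?_
        rw [Finset.mem_Ico] at hj
        refine (le_abs_self _).trans ?_
        rw [abs_mul]
        gcongr
        have a1 := abs_le.1 (hle j hj.2.le)
        have a2 := abs_le.1 (hle (j - 1) (by omega))
        have a3 := abs_le.1 (hle (j + 1) (by omega))
        rw [abs_le]
        constructor <;> linarith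
    _ = (∑ j ∈ Finset.Ico 1 N, |vacuumDev N w j|) * (4 * σ) := by rw [Finset.sum_mul]
    _ ≤ σ * (4 * σ) := by gcongr
    _ = 4 * σ ^ 2 := by ring

theorem hasDerivAt_gaugePotential {N : ℕ} (hN : 1 ≤ N) {w : ℕ → ℝ → ℝ} {v : ℕ → ℝ} {t : ℝ}
    (hw : ∀ j ≤ N, HasDerivAt (w j) (v j) t) (h0 : w 0 t = 0) (hwN : w N t = 0) :
    HasDerivAt (fun s => gaugePotential N fun j => w j s)
      (-8 * ∑ j ∈ Finset.Ico 1 N, gaugeFactor (fun j => w j t) j * w j t * v j) t := by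
  have h1 : HasDerivAt (fun s => gaugePotential N fun j => w j s)
      (∑ j ∈ Finset.Icc 1 N, 2 * (w j t ^ 2 - w (j - 1) t ^ 2 - (N : ℝ) - 1 + 2 * (j : ℝ)) *
        (2 * w j t * v j - 2 * w (j - 1) t * v (j - 1))) t := by
    unfold gaugePotential
    refine HasDerivAt.fun_sum fun j hj => ?_
    rw [Finset.mem_Icc] at hj
    have a1 := (hw j hj.2).fun_pow 2
    have a2 := (hw (j - 1) (by omega)).fun_pow 2
    refine (((((a1.fun_sub a2).sub_const (N : ℝ)).sub_const 1).add_const (2 * (j : ℝ))).fun_pow 2).congr_deriv ?_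
    push_cast
    ring
  refine h1.congr_deriv ?_
  have e1 := sum_mul_second_diff hN (fun j => 2 * w j t * v j) (vacuumDev N fun j => w j t)
    (by simp [h0]) (by simp [hwN])
  have e2 : ∑ j ∈ Finset.Icc 1 N, 2 * (w j t ^ 2 - w (j - 1) t ^ 2 - (N : ℝ) - 1 + 2 * (j : ℝ)) *
        (2 * w j t * v j - 2 * w (j - 1) t * v (j - 1)) =
      2 * ∑ j ∈ Finset.Icc 1 N, (2 * w j t * v j - 2 * w (j - 1) t * v (j - 1)) *
        (vacuumDev N (fun j => w j t) j - vacuumDev N (fun j => w j t) (j - 1)) := by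
    rw [Finset.mul_sum]
    refine Finset.sum_congr rfl fun j hj => ?_
    obtain ⟨i, rfl⟩ : ∃ i, j = i + 1 := ⟨j - 1, by have := (Finset.mem_Icc.1 hj).1; omega⟩
    simp only [vacuumDev, vacuumSq, Nat.add_sub_cancel]
    push_cast
    ring
  rw [e2, ← e1, Finset.mul_sum, Finset.mul_sum]
  refine Finset.sum_congr rfl fun j hj => ?_
  rw [gaugeFactor_eq_vacuumDev N _ (Finset.mem_Ico.1 hj).1]
  ring

/-- Where the components are nonzero both factors `F_j` vanish, so the difference of the squares has
zero second difference there; elsewhere that difference itself is zero. -/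
theorem IsFlatCriticalPoint.sq_eq_sq {N : ℕ} (hN : 1 ≤ N) {a b : ℕ → ℝ}
    (ha : IsFlatCriticalPoint N a) (hb : IsFlatCriticalPoint N b)
    (hab : ∀ j ≤ N, a j = 0 ↔ b j = 0) : ∀ j ≤ N, a j ^ 2 = b j ^ 2 := by
  have := eq_zero_of_second_diff_eq_zero hN (fun j => a j ^ 2 - b j ^ 2) (by simp [ha.1, hb.1])
    (by simp [ha.2.1, hb.2.1]) (fun j h1 h2 => by
      by_cases h : a j = 0
      · left
        simp [h, (hab j h2.le).1 h]
      · right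
        have e1 := (mul_eq_zero.1 (ha.2.2 j h1 h2)).resolve_right h
        have e2 := (mul_eq_zero.1 (hb.2.2 j h1 h2)).resolve_right fun h' => h ((hab j h2.le).2 h')
        simp only [gaugeFactor] at e1 e2
        linarith)
  intro j hj
  have := this j hj
  linarith

theorem finite_flatCriticalPoint_values {N : ℕ} (hN : 1 ≤ N) {j : ℕ} (hj : j ≤ N) :
    {c : ℝ | ∃ a, IsFlatCriticalPoint N a ∧ a j = c}.Finite := by
  classical
  set s : Set (ℕ → ℝ) := {a | IsFlatCriticalPoint N a} with hs
  -- The squares depend only on the zero set, so the sign vector determines the critical point on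
  -- indices up to `N`, and there are finitely many sign vectors.
  let F : s → (Fin (N + 1) → SignType) := fun a i => SignType.sign (a.1 i)
  have hF : ∀ a b : s, F a = F b → a.1 j = b.1 j := by
    intro a b hab
    have hsign : ∀ i ≤ N, SignType.sign (a.1 i) = SignType.sign (b.1 i) := fun i hi =>
      congrFun hab ⟨i, by omega⟩
    have hz : ∀ i ≤ N, a.1 i = 0 ↔ b.1 i = 0 := by
      intro i hi
      rw [← sign_eq_zero_iff, hsign i hi, sign_eq_zero_iff]
    have hsq := IsFlatCriticalPoint.sq_eq_sq hN a.2 b.2 hz j hj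
    have habs : |a.1 j| = |b.1 j| := (sq_eq_sq_iff_abs_eq_abs _ _).1 hsq
    rw [← sign_mul_abs (a.1 j), ← sign_mul_abs (b.1 j), habs, hsign j hj]
  have hfin : (Set.range F).Finite := Set.toFinite _
  have : {c : ℝ | ∃ a, IsFlatCriticalPoint N a ∧ a j = c} ⊆
      (fun σ => if h : ∃ a : s, F a = σ then h.choose.1 j else 0) '' Set.range F := by
    rintro c ⟨a, ha, rfl⟩
    refine ⟨F ⟨a, ha⟩, ⟨_, rfl⟩, ?_⟩
    have hex : ∃ b : s, F b = F ⟨a, ha⟩ := ⟨_, rfl⟩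
    simp only [hex, dif_pos]
    exact hF _ _ hex.choose_spec
  exact (hfin.image _).subset this

theorem IsFlatCriticalPoint.sq_eq_vacuumSq {N : ℕ} (hN : 1 ≤ N) {a : ℕ → ℝ}
    (ha : IsFlatCriticalPoint N a) (hne : ∀ j, 1 ≤ j → j < N → a j ≠ 0) :
    ∀ j ≤ N, a j ^ 2 = vacuumSq N j := by
  have := eq_zero_of_second_diff_eq_zero hN (vacuumDev N a) (vacuumDev_zero ha.1)
    (vacuumDev_self ha.2.1) (fun j h1 h2 => by
      right
      have e1 := (mul_eq_zero.1 (ha.2.2 j h1 h2)).resolve_right (hne j h1 h2)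
      rw [gaugeFactor_eq_vacuumDev N _ h1] at e1
      linarith)
  intro j hj
  have := this j hj
  rw [vacuumDev] at this
  linarith

end

/-! ### Evolution identities and boundedness of the gauge field -/

noncomputable section

/-- A solution with positive lapse variable and radius that extends to spatial infinity. -/
structure IsExteriorSolution (N : ℕ) (r Ψ κ S : ℝ → ℝ) (ω U : ℕ → ℝ → ℝ) : Prop
    extends IsTauSolution N r Ψ κ S ω U where
  one_le_N : 1 ≤ N
  r_pos : ∀ τ > 0, 0 < r τ
  Psi_pos : ∀ τ > 0, 0 < Ψ τ
  Psi_le_one : ∀ τ > 0, Ψ τ ≤ 1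
  r_tendsto : Tendsto r atTop atTop

/-- The sum of the vacuum values of `ω_j²`. -/
def vacuumSum (N : ℕ) : ℝ := ∑ j ∈ Finset.Ico 1 N, vacuumSq N j

theorem vacuumSum_nonneg (N : ℕ) : 0 ≤ vacuumSum N :=
  Finset.sum_nonneg fun j hj => by
    rw [Finset.mem_Ico] at hj
    linarith [one_le_vacuumSq hj.1 hj.2]

/-- The `τ`-derivatives of the gauge field functions. -/
def omegaDot (N : ℕ) (r : ℝ → ℝ) (U : ℕ → ℝ → ℝ) (j : ℕ) (τ : ℝ) : ℝ :=
  if 1 ≤ j ∧ j < N then r τ * U j τ else 0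

theorem IsTauSolution.two_mul_Psi_mul_kappa {N : ℕ} {r Ψ κ S : ℝ → ℝ} {ω U : ℕ → ℝ → ℝ}
    (h : IsTauSolution N r Ψ κ S ω U) {τ : ℝ} (hτ : 0 < τ) (hr : r τ ≠ 0) :
    2 * Ψ τ * κ τ = 1 + Ψ τ ^ 2 + 2 * sumSq N (fun j => U j τ)
      - gaugePotential N (fun j => ω j τ) / (2 * r τ ^ 2) := by
  rw [h.kappa_def τ hτ, pTheta_eq_gaugePotential]
  field_simp
  ring

theorem IsTauSolution.hasDerivAt_Psi {N : ℕ} {r Ψ κ S : ℝ → ℝ} {ω U : ℕ → ℝ → ℝ}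
    (h : IsTauSolution N r Ψ κ S ω U) {τ : ℝ} (hτ : 0 < τ) (hr : r τ ≠ 0) :
    HasDerivAt Ψ (1 / 2 * (1 - Ψ τ ^ 2 - 2 * sumSq N (fun j => U j τ)
      - gaugePotential N (fun j => ω j τ) / (2 * r τ ^ 2))) τ :=
  (h.Psi_eq τ hτ).congr_deriv (by linarith [h.two_mul_Psi_mul_kappa hτ hr])

namespace IsExteriorSolution

variable {N : ℕ} {r Ψ κ S : ℝ → ℝ} {ω U : ℕ → ℝ → ℝ} {τ : ℝ}

theorem hasDerivAt_omega (h : IsExteriorSolution N r Ψ κ S ω U) (hτ : 0 < τ) {j : ℕ}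
    (hj : j ≤ N) : HasDerivAt (ω j) (omegaDot N r U j τ) τ := by
  unfold omegaDot
  split_ifs with hj'
  · exact h.omega_eq j hj'.1 hj'.2 τ hτ
  · have hev : ω j =ᶠ[𝓝 τ] fun _ => 0 := by
      have : j = 0 ∨ j = N := by omega
      filter_upwards [Ioi_mem_nhds hτ] with t ht
      rcases this with rfl | rfl
      · exact h.omega_zero t ht
      · exact h.omega_N t ht
    exact (hasDerivAt_const τ (0 : ℝ)).congr_of_eventuallyEq hev

theorem hasDerivAt_r_mul_U (h : IsExteriorSolution N r Ψ κ S ω U) (hτ : 0 < τ) {j : ℕ}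
    (h1 : 1 ≤ j) (hj : j < N) : HasDerivAt (fun t => r t * U j t)
      ((2 * Ψ τ - κ τ) * (r τ * U j τ) - gaugeFactor (fun i => ω i τ) j * ω j τ) τ := by
  have hr := (h.r_pos τ hτ).ne'
  refine ((h.r_eq τ hτ).fun_mul (h.U_eq j h1 hj τ hτ)).congr_deriv ?_
  field_simp
  ring

theorem hasDerivAt_sumSq_omega (h : IsExteriorSolution N r Ψ κ S ω U) (hτ : 0 < τ) :
    HasDerivAt (fun t => sumSq N fun j => ω j t)
      (2 * ∑ j ∈ Finset.Ico 1 N, ω j τ * (r τ * U j τ)) τ := by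
  unfold sumSq
  rw [Finset.mul_sum]
  refine HasDerivAt.fun_sum fun j hj => ?_
  rw [Finset.mem_Ico] at hj
  refine ((h.omega_eq j hj.1 hj.2 τ hτ).fun_pow 2).congr_deriv ?_
  push_cast
  ring

theorem hasDerivAt_sum_omega_mul (h : IsExteriorSolution N r Ψ κ S ω U) (hτ : 0 < τ) :
    HasDerivAt (fun t => 2 * ∑ j ∈ Finset.Ico 1 N, ω j t * (r t * U j t))
      (2 * r τ ^ 2 * sumSq N (fun j => U j τ)
        + (2 * Ψ τ - κ τ) * (2 * ∑ j ∈ Finset.Ico 1 N, ω j τ * (r τ * U j τ))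
        + gaugePotential N (fun j => ω j τ) + 2 * sumSq N (fun j => ω j τ)
        - 2 * vacuumSum N) τ := by
  have h1 : HasDerivAt (fun t => 2 * ∑ j ∈ Finset.Ico 1 N, ω j t * (r t * U j t))
      (2 * ∑ j ∈ Finset.Ico 1 N, (r τ * U j τ * (r τ * U j τ) + ω j τ *
        ((2 * Ψ τ - κ τ) * (r τ * U j τ) - gaugeFactor (fun i => ω i τ) j * ω j τ))) τ := by
    refine HasDerivAt.const_mul _ (HasDerivAt.fun_sum fun j hj => ?_)
    rw [Finset.mem_Ico] at hj
    exact (h.omega_eq j hj.1 hj.2 τ hτ).fun_mul (h.hasDerivAt_r_mul_U hτ hj.1 hj.2)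
  refine h1.congr_deriv ?_
  have e := sum_gaugeFactor_mul_sq h.one_le_N (fun j => ω j τ) (h.omega_zero τ hτ)
    (h.omega_N τ hτ)
  have e2 : ∑ j ∈ Finset.Ico 1 N, (r τ * U j τ * (r τ * U j τ) + ω j τ *
        ((2 * Ψ τ - κ τ) * (r τ * U j τ) - gaugeFactor (fun i => ω i τ) j * ω j τ)) =
      r τ ^ 2 * sumSq N (fun j => U j τ)
        + (2 * Ψ τ - κ τ) * ∑ j ∈ Finset.Ico 1 N, ω j τ * (r τ * U j τ)
        - ∑ j ∈ Finset.Ico 1 N, gaugeFactor (fun i => ω i τ) j * ω j τ * ω j τ := by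
    rw [sumSq, Finset.mul_sum, Finset.mul_sum, ← Finset.sum_add_distrib,
      ← Finset.sum_sub_distrib]
    exact Finset.sum_congr rfl fun _ _ => by ring
  rw [e2, e, vacuumSum]
  ring

theorem hasDerivAt_sumSq_U (h : IsExteriorSolution N r Ψ κ S ω U) (hτ : 0 < τ) :
    HasDerivAt (fun t => sumSq N fun j => U j t)
      (-2 * (κ τ - Ψ τ) * sumSq N (fun j => U j τ)
        - 2 / r τ * ∑ j ∈ Finset.Ico 1 N, gaugeFactor (fun i => ω i τ) j * ω j τ * U j τ) τ := by
  unfold sumSq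
  rw [Finset.mul_sum, Finset.mul_sum, ← Finset.sum_sub_distrib]
  refine HasDerivAt.fun_sum fun j hj => ?_
  rw [Finset.mem_Ico] at hj
  refine ((h.U_eq j hj.1 hj.2 τ hτ).fun_pow 2).congr_deriv ?_
  push_cast
  ring

theorem hasDerivAt_gaugePotential (h : IsExteriorSolution N r Ψ κ S ω U) (hτ : 0 < τ) :
    HasDerivAt (fun t => gaugePotential N fun j => ω j t)
      (-8 * r τ * ∑ j ∈ Finset.Ico 1 N, gaugeFactor (fun i => ω i τ) j * ω j τ * U j τ) τ := by
  refine (_root_.hasDerivAt_gaugePotential h.one_le_N (v := fun j => omegaDot N r U j τ)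
    (fun j hj => h.hasDerivAt_omega hτ hj) (h.omega_zero τ hτ) (h.omega_N τ hτ)).congr_deriv ?_
  rw [Finset.mul_sum, Finset.mul_sum]
  refine Finset.sum_congr rfl fun j hj => ?_
  rw [Finset.mem_Ico] at hj
  rw [omegaDot, if_pos hj]
  ring

/-- The derivative of the mass `m = r (1 - Ψ²) / 2`. -/
theorem hasDerivAt_mass (h : IsExteriorSolution N r Ψ κ S ω U) (hτ : 0 < τ) :
    HasDerivAt (fun t => r t * (1 - Ψ t ^ 2) / 2) (r τ * Ψ τ * (sumSq N (fun j => U j τ)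
      + gaugePotential N (fun j => ω j τ) / (4 * r τ ^ 2))) τ := by
  have hr := (h.r_pos τ hτ).ne'
  refine (((h.r_eq τ hτ).fun_mul (((h.hasDerivAt_Psi hτ hr).fun_pow 2).const_sub 1)).div_const
    2).congr_deriv ?_
  push_cast
  field_simp
  ring

/-- The force terms `F_j ω_j U_j` cancel between the two parts. With `e` this energy the constraint
reads `2Ψκ = 1 + Ψ² + 4e`, so a large `e` makes `κ ≥ 2Ψ` and hence its own derivative nonpositive.
-/
theorem hasDerivAt_energy (h : IsExteriorSolution N r Ψ κ S ω U) (hτ : 0 < τ) :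
    HasDerivAt (fun t => sumSq N (fun j => U j t) / 2
        - gaugePotential N (fun j => ω j t) / (8 * r t ^ 2))
      ((2 * Ψ τ - κ τ) * sumSq N (fun j => U j τ) - 2 * Ψ τ * (sumSq N (fun j => U j τ) / 2
        - gaugePotential N (fun j => ω j τ) / (8 * r τ ^ 2))) τ := by
  have hr := (h.r_pos τ hτ).ne'
  have h1 := ((h.hasDerivAt_sumSq_U hτ).div_const 2).fun_sub ((h.hasDerivAt_gaugePotential hτ).fun_div
    (((h.r_eq τ hτ).fun_pow 2).const_mul 8) (by positivity))
  refine h1.congr_deriv ?_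
  push_cast
  field_simp
  ring

theorem monotoneOn_r (h : IsExteriorSolution N r Ψ κ S ω U) : StrictMonoOn r (Set.Ioi 0) := by
  refine strictMonoOn_of_deriv_pos (convex_Ioi 0)
    (fun t ht => (h.r_eq t ht).continuousAt.continuousWithinAt) fun t ht => ?_
  rw [interior_Ioi] at ht
  rw [(h.r_eq t ht).deriv]
  exact mul_pos (h.r_pos t ht) (h.Psi_pos t ht)

/-- The squared norm of the gauge field is at most of the order of `r` once it is increasing. -/
theorem sumSq_omega_sq_le (h : IsExteriorSolution N r Ψ κ S ω U) (hτ : 0 < τ) {c : ℝ}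
    (hc : 0 < c) (hpot : ∀ t ≥ τ, c * sumSq N (fun j => ω j τ) ^ 2 ≤
      gaugePotential N fun j => ω j t) :
    sumSq N (fun j => ω j τ) ^ 2 ≤ 8 / c * r τ ^ 2 := by
  set ρ₁ := sumSq N (fun j => ω j τ) with hρ₁
  have hr := h.r_pos τ hτ
  obtain ⟨T, hT, hTτ⟩ := ((h.r_tendsto.eventually_ge_atTop (2 * r τ)).and
    (eventually_ge_atTop τ)).exists
  have hcont : ContinuousOn r (Set.Icc τ T) := fun t ht =>
    (h.r_eq t (lt_of_lt_of_le hτ ht.1)).continuousAt.continuousWithinAt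
  obtain ⟨τ₂, hτ₂, hr₂⟩ := intermediate_value_Icc hTτ hcont
    (⟨by linarith, hT⟩ : 2 * r τ ∈ Set.Icc (r τ) (r T))
  have hτ₂pos := lt_of_lt_of_le hτ hτ₂.1
  -- The mass grows at least as fast as `-c ρ₁² / (4r)` while the radius doubles. It is nonnegative
  -- at `τ` and at most half the radius, that is `r τ`, at `τ₂`.
  have key := mul_le_sub_of_le_hasDerivAt (C := 0)
    (f := fun t => r t * (1 - Ψ t ^ 2) / 2 + c * ρ₁ ^ 2 / (4 * r t))
    (f' := fun t => r t * Ψ t * (sumSq N (fun j => U j t)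
      + gaugePotential N (fun j => ω j t) / (4 * r t ^ 2)) -
      c * ρ₁ ^ 2 * (4 * (r t * Ψ t)) / (4 * r t) ^ 2) hτ₂.1 (fun t ht => by
      have ht0 := lt_of_lt_of_le hτ ht.1
      have hrt := (h.r_pos t ht0).ne'
      refine ((h.hasDerivAt_mass ht0).fun_add ((hasDerivAt_const t (c * ρ₁ ^ 2)).fun_div
        ((h.r_eq t ht0).const_mul 4) (by positivity))).congr_deriv ?_
      ring) (fun t ht => by
      have ht0 := lt_trans hτ ht.1
      have hrt := h.r_pos t ht0
      have hΨ := h.Psi_pos t ht0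
      have hp := hpot t ht.1.le
      have hu := sumSq_nonneg N fun j => U j t
      have e : r t * Ψ t * (sumSq N (fun j => U j t)
        + gaugePotential N (fun j => ω j t) / (4 * r t ^ 2)) -
        c * ρ₁ ^ 2 * (4 * (r t * Ψ t)) / (4 * r t) ^ 2 = r t * Ψ t * sumSq N (fun j => U j t) +
        Ψ t * (gaugePotential N (fun j => ω j t) - c * ρ₁ ^ 2) / (4 * r t) := by
        field_simp
        ring
      rw [e]
      have : 0 ≤ gaugePotential N (fun j => ω j t) - c * ρ₁ ^ 2 := by linarith
      positivity)
  simp only [hr₂, zero_mul] at key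
  have hm1 : 0 ≤ r τ * (1 - Ψ τ ^ 2) / 2 := by
    have h1 := h.Psi_pos τ hτ
    have h2 := h.Psi_le_one τ hτ
    have : 0 ≤ 1 - Ψ τ ^ 2 := by nlinarith
    positivity
  have hm2 : 2 * r τ * (1 - Ψ τ₂ ^ 2) / 2 ≤ r τ := by nlinarith [sq_nonneg (Ψ τ₂)]
  have h3 : c * ρ₁ ^ 2 / (4 * r τ) - c * ρ₁ ^ 2 / (4 * (2 * r τ)) = c * ρ₁ ^ 2 / (8 * r τ) := by
    field_simp
    ring
  have h4 : c * ρ₁ ^ 2 / (8 * r τ) ≤ r τ := by linarith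
  rw [div_le_iff₀ (by positivity)] at h4
  rw [div_mul_eq_mul_div, le_div_iff₀ hc]
  nlinarith

/-- The gauge field is bounded at infinity. -/
theorem eventually_sumSq_omega_le (h : IsExteriorSolution N r Ψ κ S ω U) :
    ∃ C, ∀ᶠ t in atTop, sumSq N (fun j => ω j t) ≤ C := by
  by_contra! hunb
  set ρ : ℝ → ℝ := fun t => sumSq N fun j => ω j t with hρ
  set ρ' : ℝ → ℝ := fun t => 2 * ∑ j ∈ Finset.Ico 1 N, ω j t * (r t * U j t) with hρ'
  set Γ := vacuumSum N with hΓ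
  have hΓ0 : 0 ≤ Γ := vacuumSum_nonneg N
  -- Above `2Γ + 1` every critical time of `ρ` is a strict minimum by the virial identity, so `ρ`
  -- keeps increasing. The bound `ρ 1 ≤ R₀` ensures that exceeding `R₀` after `τ = 1` requires a
  -- time with `ρ > R₀` and `ρ' > 0`.
  set R₀ := max (ρ 1) (2 * Γ + 1) with hR₀
  obtain ⟨τ₁, hτ₁, hρ₁, hρ₁'⟩ : ∃ τ₁ ≥ (1 : ℝ), R₀ < ρ τ₁ ∧ 0 < ρ' τ₁ := by
    by_contra! hcon
    obtain ⟨τ₂, hlt, hge⟩ := ((hunb R₀).and_eventually (eventually_ge_atTop 1)).exists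
    have := le_of_hasDerivAt_nonpos_above (f := ρ) (f' := ρ') (t₀ := 1) (M := R₀)
      (fun t ht => h.hasDerivAt_sumSq_omega (by linarith)) (le_max_left _ _) hcon τ₂ hge
    exact absurd hlt (not_lt.2 this)
  have hpos' : ∀ t ≥ τ₁, 0 < t := fun t ht => by linarith
  have hd1 : ∀ t ≥ τ₁, HasDerivAt ρ (ρ' t) t := fun t ht =>
    h.hasDerivAt_sumSq_omega (hpos' t ht)
  have hd2 := fun t (ht : t ≥ τ₁) => h.hasDerivAt_sum_omega_mul (hpos' t ht)
  have hinc : ∀ t ≥ τ₁, 0 < ρ' t := by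
    refine pos_of_hasDerivAt_pos_at_first_zero hd2 hρ₁' fun t ht hs h0 => ?_
    have hmono := mul_le_sub_of_le_hasDerivAt (C := 0) ht.le (fun s hs => hd1 s hs.1)
      (fun s hs' => (hs s ⟨hs'.1.le, hs'.2⟩).le)
    have h0' : 2 * ∑ j ∈ Finset.Ico 1 N, ω j t * (r t * U j t) = 0 := h0
    rw [h0', mul_zero]
    have h1 := gaugePotential_nonneg N fun j => ω j t
    have h2 := sumSq_nonneg N fun j => U j t
    have h3 : 2 * Γ + 1 ≤ R₀ := le_max_right _ _
    have h4 : 0 ≤ 2 * r t ^ 2 * sumSq N (fun j => U j t) := by positivity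
    have h5 : ρ t = sumSq N (fun j => ω j t) := rfl
    linarith
  have hmono : ∀ s ≥ τ₁, ∀ t ≥ s, ρ s ≤ ρ t := by
    intro s hs t ht
    have := mul_le_sub_of_le_hasDerivAt (C := 0) ht (fun x hx => hd1 x (hs.trans hx.1))
      (fun x hx => (hinc x (hs.trans hx.1.le)).le)
    linarith
  have hlim : Tendsto ρ atTop atTop := by
    rw [tendsto_atTop]
    intro C
    obtain ⟨s, hs, hsτ⟩ := ((hunb C).and_eventually (eventually_ge_atTop τ₁)).exists
    filter_upwards [eventually_ge_atTop s] with t ht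
    exact hs.le.trans (hmono s hsτ t ht)
  have hbig : ∀ t ≥ τ₁, 2 * Γ + 1 ≤ ρ t := fun t ht =>
    ((le_max_right _ _).trans hρ₁.le).trans (hmono τ₁ le_rfl t ht)
  have hN : (0 : ℝ) < N := by exact_mod_cast h.one_le_N
  -- From `ρ ≥ 2Γ` one has `(ρ - Γ)² ≥ ρ² / 4`, and `(ρ - Γ)² ≤ N³ P`.
  set c : ℝ := 1 / (4 * (N : ℝ) ^ 3) with hc
  have hcpos : 0 < c := by positivity
  have hpot : ∀ t ≥ τ₁, c * ρ t ^ 2 ≤ gaugePotential N fun j => ω j t := by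
    intro t ht
    have h1 := sq_sumSq_sub_le (N := N) (fun j => ω j t) (h.omega_zero t (hpos' t ht))
    have h2 := hbig t ht
    rw [hc, div_mul_eq_mul_div, div_le_iff₀ (by positivity)]
    change (ρ t - Γ) ^ 2 ≤ _ at h1
    nlinarith
  have hlin : ∀ t ≥ τ₁, ρ t ^ 2 ≤ 8 / c * r t ^ 2 := by
    intro t ht
    refine h.sumSq_omega_sq_le (hpos' t ht) hcpos fun s hs => ?_
    refine le_trans ?_ (hpot s (ht.trans hs))
    have h1 := hmono t ht s hs
    have h2 := hbig t ht
    have h3 : 0 ≤ ρ t := by linarith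
    have h4 : ρ t ^ 2 ≤ ρ s ^ 2 := by gcongr
    exact mul_le_mul_of_nonneg_left h4 hcpos.le
  have hB : ∀ t ≥ τ₁, gaugePotential N (fun j => ω j t) / (4 * r t ^ 2) ≤ 32 / c := by
    intro t ht
    have hr := h.r_pos t (hpos' t ht)
    rw [div_le_iff₀ (by positivity)]
    have h1 := gaugePotential_le h.one_le_N (fun j => ω j t) (h.omega_zero t (hpos' t ht))
      (h.omega_N t (hpos' t ht))
    change _ ≤ 4 * (ρ t + Γ) ^ 2 at h1
    have h2 := hbig t ht
    have h3 : (ρ t + Γ) ^ 2 ≤ 4 * ρ t ^ 2 := by nlinarith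
    have h4 := hlin t ht
    calc _ ≤ 4 * (4 * (8 / c * r t ^ 2)) := by linarith
      _ = 32 / c * (4 * r t ^ 2) := by ring
  set e : ℝ → ℝ := fun t => sumSq N (fun j => U j t) / 2
        - gaugePotential N (fun j => ω j t) / (8 * r t ^ 2) with he
  -- Since `Ψ ≤ 1`, any threshold of at least `1/2` would do: `1 + Ψ² + 4e ≥ 4Ψ²` gives `2Ψ ≤ κ`.
  set M := max (e τ₁) (3 / 4) with hM
  have heM : ∀ t ≥ τ₁, e t ≤ M := by
    refine le_of_hasDerivAt_nonpos_above (fun t ht => h.hasDerivAt_energy (hpos' t ht))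
      (le_max_left _ _) fun t ht hlt => ?_
    have h1 : 3 / 4 < e t := lt_of_le_of_lt (le_max_right _ _) hlt
    have hr := h.r_pos t (hpos' t ht)
    have hΨ := h.Psi_pos t (hpos' t ht)
    have hΨ1 := h.Psi_le_one t (hpos' t ht)
    have hκ := h.two_mul_Psi_mul_kappa (hpos' t ht) hr.ne'
    have hu := sumSq_nonneg N fun j => U j t
    have h2 : 2 * Ψ t * κ t = 1 + Ψ t ^ 2 + 4 * e t := by
      rw [hκ, he]
      field_simp
      ring
    have h3 : 2 * Ψ t - κ t ≤ 0 := by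
      by_contra! hcon
      nlinarith
    have h4 := mul_nonneg hΨ.le (by linarith : 0 ≤ e t)
    have h5 := mul_nonpos_of_nonpos_of_nonneg h3 hu
    change (2 * Ψ t - κ t) * sumSq N (fun j => U j t) - 2 * Ψ t * e t ≤ 0
    linarith
  have hA : ∀ t ≥ τ₁, sumSq N (fun j => U j t) ≤ 2 * M + 32 / c := by
    intro t ht
    have h1 := heM t ht
    have h2 := hB t ht
    have hr := h.r_pos t (hpos' t ht)
    have h3 : gaugePotential N (fun j => ω j t) / (4 * r t ^ 2) =
        2 * (gaugePotential N (fun j => ω j t) / (8 * r t ^ 2)) := by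
      field_simp
      ring
    simp only [he] at h1
    linarith
  -- Riccati bound: `κ' ≤ -κ² + L`, which is nonpositive for `κ > L` because `L ≥ 1`.
  set L := 1 + 2 * (2 * M + 32 / c) with hL
  have hL1 : 1 ≤ L := by
    have : 0 ≤ 2 * M + 32 / c := (sumSq_nonneg N _).trans (hA τ₁ le_rfl)
    linarith
  set K := max (κ τ₁) L with hK
  have hκK : ∀ t ≥ τ₁, κ t ≤ K := by
    refine le_of_hasDerivAt_nonpos_above (fun t ht => h.kappa_eq t (hpos' t ht))
      (le_max_left _ _) fun t ht hlt => ?_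
    have h1 : L < κ t := lt_of_le_of_lt (le_max_right _ _) hlt
    have h2 := hA t ht
    nlinarith
  refine not_tendsto_atTop_of_quadratic_growth (K := K) hcpos hd1 hd2 hinc (fun t ht => ?_) hlim
  have h1 := hpot t ht
  have h2 := hκK t ht
  have h3 := hinc t ht
  have h4 := hbig t ht
  have hΨ := h.Psi_pos t (hpos' t ht)
  have hu : 0 ≤ 2 * r t ^ 2 * sumSq N (fun j => U j t) :=
    mul_nonneg (by positivity) (sumSq_nonneg N _)
  have h5 : 0 ≤ (2 * Ψ t - κ t + K) * ρ' t := mul_nonneg (by linarith) h3.le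
  change -K * ρ' t + c * ρ t ^ 2 ≤ 2 * r t ^ 2 * sumSq N (fun j => U j t)
        + (2 * Ψ t - κ t) * ρ' t + gaugePotential N (fun j => ω j t) + 2 * ρ t - 2 * Γ
  linarith

end IsExteriorSolution

end

/-! ### Scalar oscillator lemmas: bounded velocity, unique continuation, anti-damping -/

noncomputable section

theorem eventually_abs_sub_le_of_hasDerivAt {f f' : ℝ → ℝ} {L : ℝ}
    (h : ∀ᶠ t in atTop, HasDerivAt f (f' t) t ∧ |f' t| ≤ L) :
    ∀ᶠ t in atTop, ∀ s ≥ t, |f s - f t| ≤ L * (s - t) := by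
  obtain ⟨T, hT⟩ := eventually_atTop.1 h
  filter_upwards [eventually_ge_atTop T] with t ht s hs
  rw [abs_le]
  constructor
  · have := mul_le_sub_of_le_hasDerivAt (C := -L) hs (fun x hx => (hT x (ht.trans hx.1)).1)
      (fun x hx => (abs_le.1 (hT x (ht.trans hx.1.le)).2).1)
    linarith
  · exact sub_le_mul_of_hasDerivAt_le (C := L) hs (fun x hx => (hT x (ht.trans hx.1)).1)
      (fun x hx => (abs_le.1 (hT x (ht.trans hx.1.le)).2).2)

/-- Anti-damping is used to advantage: at the level `v = 2C + 1` the term `b v` beats the forcing,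
so a velocity above that level stays above it, and `y` would leave every bounded set. -/
theorem eventually_deriv_le_of_bounded {y v b g : ℝ → ℝ} {C K : ℝ}
    (hy : ∀ᶠ t in atTop, HasDerivAt y (v t) t)
    (hv : ∀ᶠ t in atTop, HasDerivAt v (b t * v t + g t) t) (hb : ∀ᶠ t in atTop, 1 / 2 ≤ b t)
    (hg : ∀ᶠ t in atTop, |g t| ≤ C) (hyK : ∀ᶠ t in atTop, y t ≤ K) :
    ∀ᶠ t in atTop, v t ≤ 2 * C + 1 := by
  obtain ⟨T, hT⟩ := eventually_atTop.1 (hy.and (hv.and (hb.and (hg.and hyK))))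
  filter_upwards [eventually_ge_atTop T] with t₀ ht₀
  by_contra! hlt
  have hC : 0 ≤ C := (abs_nonneg _).trans (hT T le_rfl).2.2.2.1
  have hpos := pos_of_hasDerivAt_pos_at_first_zero (f := fun t => v t - (2 * C + 1))
    (f' := fun t => b t * v t + g t) (t₀ := t₀)
    (fun t ht => (hT t (ht₀.trans ht)).2.1.sub_const _) (by linarith) (fun t ht _ h0 => by
      obtain ⟨-, -, h1, h2, -⟩ := hT t (ht₀.trans ht.le)
      have h3 : v t = 2 * C + 1 := by linarith
      rw [h3]
      have := (abs_le.1 h2).1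
      nlinarith)
  have hK0 := (hT t₀ ht₀).2.2.2.2
  set s := t₀ + (K - y t₀ + 1) with hs
  have hts : t₀ ≤ s := by linarith
  have h1 := mul_le_sub_of_le_hasDerivAt (C := 1) hts (fun x hx => (hT x (ht₀.trans hx.1)).1)
    (fun x hx => by have := hpos x hx.1.le; linarith)
  have h2 := (hT s (ht₀.trans hts)).2.2.2.2
  linarith

theorem eventually_abs_deriv_le_of_bounded {y v b g : ℝ → ℝ} {C K : ℝ}
    (hy : ∀ᶠ t in atTop, HasDerivAt y (v t) t)
    (hv : ∀ᶠ t in atTop, HasDerivAt v (b t * v t + g t) t) (hb : ∀ᶠ t in atTop, 1 / 2 ≤ b t)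
    (hg : ∀ᶠ t in atTop, |g t| ≤ C) (hyK : ∀ᶠ t in atTop, |y t| ≤ K) :
    ∀ᶠ t in atTop, |v t| ≤ 2 * C + 1 := by
  have h1 := eventually_deriv_le_of_bounded hy hv hb hg (hyK.mono fun t ht => (abs_le.1 ht).2)
  have h2 := eventually_deriv_le_of_bounded (y := fun t => -y t) (v := fun t => -v t) (b := b)
    (g := fun t => -g t) (K := K) (C := C) (hy.mono fun t ht => ht.neg)
    (hv.mono fun t ht => ht.neg.congr_deriv (by ring)) hb
    (hg.mono fun t ht => by rwa [abs_neg]) (hyK.mono fun t ht => by linarith [(abs_le.1 ht).1])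
  filter_upwards [h1, h2] with t a1 a2
  exact abs_le.2 ⟨by linarith, a1⟩

theorem abs_gaugeFactor_le {N : ℕ} {w : ℕ → ℝ} {C : ℝ} (hw : ∀ j ≤ N, |w j| ≤ C) {j : ℕ}
    (hj : j < N) : |gaugeFactor w j| ≤ 1 + 2 * C ^ 2 := by
  have h (i : ℕ) (hi : i ≤ N) : w i ^ 2 ≤ C ^ 2 := sq_le_sq' (abs_le.1 (hw i hi)).1 (abs_le.1 (hw i hi)).2
  have h1 := h j hj.le
  have h2 := h (j - 1) (by omega)
  have h3 := h (j + 1) (by omega)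
  have := sq_nonneg (w j)
  have := sq_nonneg (w (j - 1))
  have := sq_nonneg (w (j + 1))
  unfold gaugeFactor
  rw [abs_le]
  constructor <;> nlinarith

/-- The two-dimensional linear system behind the gauge field equations has unique continuation. -/
theorem eq_zero_of_linear_system {y v p q s : ℝ → ℝ} {a b : ℝ} (hab : a ≤ b)
    (hy : ∀ t ∈ Set.Icc a b, HasDerivAt y (p t * v t) t)
    (hv : ∀ t ∈ Set.Icc a b, HasDerivAt v (q t * v t + s t * y t) t)
    (hp : ContinuousOn p (Set.Icc a b)) (hq : ContinuousOn q (Set.Icc a b))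
    (hs : ContinuousOn s (Set.Icc a b)) (hyb : y b = 0) (hvb : v b = 0) : y a = 0 := by
  obtain ⟨P, hP⟩ := isCompact_Icc.exists_bound_of_continuousOn hp
  obtain ⟨Q, hQ⟩ := isCompact_Icc.exists_bound_of_continuousOn hq
  obtain ⟨R, hR⟩ := isCompact_Icc.exists_bound_of_continuousOn hs
  simp only [Real.norm_eq_abs] at hP hQ hR
  set C := P + 2 * Q + R with hC
  -- Gronwall backwards in time: the weight `exp (C t)` makes the squared norm nondecreasing, so
  -- vanishing at `b` forces vanishing at `a`.
  have key := mul_le_sub_of_le_hasDerivAt (C := 0) (f := fun t => (y t ^ 2 + v t ^ 2) * Real.exp (C * t))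
    (f' := fun t => (2 * y t * (p t * v t) + 2 * v t * (q t * v t + s t * y t)) * Real.exp (C * t)
      + (y t ^ 2 + v t ^ 2) * (Real.exp (C * t) * C)) hab (fun t ht => by
        have h1 := ((hy t ht).fun_pow 2).fun_add ((hv t ht).fun_pow 2)
        have h2 : HasDerivAt (fun t => Real.exp (C * t)) (Real.exp (C * t) * C) t := by
          simpa using ((hasDerivAt_id t).const_mul C).exp
        refine (h1.fun_mul h2).congr_deriv ?_
        push_cast
        ring) (fun t ht => by
      have ht' := Set.Ioo_subset_Icc_self ht
      have e1 := abs_le.1 (hP t ht')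
      have e2 := abs_le.1 (hQ t ht')
      have e3 := abs_le.1 (hR t ht')
      have e4 : 0 ≤ (2 * y t * (p t * v t) + 2 * v t * (q t * v t + s t * y t))
          + (y t ^ 2 + v t ^ 2) * C := by
        rw [hC]
        nlinarith [mul_nonneg (by linarith : 0 ≤ P - p t) (sq_nonneg (y t - v t)),
          mul_nonneg (by linarith : 0 ≤ P + p t) (sq_nonneg (y t + v t)),
          mul_nonneg (by linarith : 0 ≤ R - s t) (sq_nonneg (y t - v t)),
          mul_nonneg (by linarith : 0 ≤ R + s t) (sq_nonneg (y t + v t)),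
          mul_nonneg (by linarith : 0 ≤ Q + q t) (sq_nonneg (v t)),
          mul_nonneg (by linarith : 0 ≤ Q - q t) (sq_nonneg (v t)),
          mul_nonneg (by linarith : 0 ≤ Q) (sq_nonneg (y t))]
      have := mul_nonneg e4 (Real.exp_pos (C * t)).le
      linarith)
  simp only [hyb, hvb] at key
  have hexp := Real.exp_pos (C * a)
  have h1 : (y a ^ 2 + v a ^ 2) * Real.exp (C * a) ≤ 0 := by linarith
  have h2 : y a ^ 2 + v a ^ 2 ≤ 0 := by
    by_contra! hcon
    have := mul_pos hcon hexp
    linarith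
  have h3 : y a ^ 2 = 0 := by nlinarith [sq_nonneg (y a), sq_nonneg (v a)]
  exact pow_eq_zero_iff (two_ne_zero) |>.1 h3

/-- An anti-damped oscillator that tends to rest is at rest eventually. -/
theorem eventually_eq_zero_of_tendsto_zero {y v b f : ℝ → ℝ} {f₀ : ℝ} (hf₀ : 1 ≤ f₀)
    (hy : ∀ᶠ t in atTop, HasDerivAt y (v t) t)
    (hv : ∀ᶠ t in atTop, HasDerivAt v (b t * v t - f t * y t) t)
    (hb : Tendsto b atTop (𝓝 1)) (hf : Tendsto f atTop (𝓝 f₀))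
    (hy0 : Tendsto y atTop (𝓝 0)) (hv0 : Tendsto v atTop (𝓝 0)) :
    ∀ᶠ t in atTop, y t = 0 ∧ v t = 0 := by
  have hb1 : ∀ᶠ t in atTop, |b t - 1| < 1 / 20 := by
    have := (hb.sub_const 1).abs
    simp only [sub_self, abs_zero] at this
    exact this.eventually_lt_const (by norm_num)
  have hf1 : ∀ᶠ t in atTop, |f t - f₀| < 1 / 40 := by
    have := (hf.sub_const f₀).abs
    simp only [sub_self, abs_zero] at this
    exact this.eventually_lt_const (by norm_num)
  obtain ⟨T, hT⟩ := eventually_atTop.1 (hy.and (hv.and (hb1.and hf1)))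
  -- To leading order this form is its own derivative: in the limit `b = 1`, `f = f₀` one gets `e' =
  -- v² - y v + f₀ y²`. It is positive definite since `f₀ ≥ 1`, so `e` increases to its limit `0`
  -- and must vanish. The tolerances on `b` and `f` preserve the positivity of `e'`.
  set e : ℝ → ℝ := fun t => v t ^ 2 - y t * v t + f₀ * y t ^ 2 with he
  have hed : ∀ t ≥ T, HasDerivAt e (2 * v t * (b t * v t - f t * y t)
      - (v t * v t + y t * (b t * v t - f t * y t)) + f₀ * (2 * y t * v t)) t := by
    intro t ht
    obtain ⟨h1, h2, -⟩ := hT t ht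
    refine (((h2.fun_pow 2).fun_sub (h1.fun_mul h2)).fun_add ((h1.fun_pow 2).const_mul f₀)).congr_deriv ?_
    push_cast
    ring
  have hmono : MonotoneOn e (Set.Ici T) := by
    intro s hs t ht hst
    have := mul_le_sub_of_le_hasDerivAt (C := 0) hst (fun x hx => hed x (le_trans hs hx.1))
      (fun x hx => by
        obtain ⟨-, -, h3, h4⟩ := hT x (le_trans hs hx.1.le)
        obtain ⟨h31, h32⟩ := abs_lt.1 h3
        obtain ⟨h41, h42⟩ := abs_lt.1 h4
        set β := 2 * (f₀ - f x) - b x with hβ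
        have hβ1 : β ≤ 1 + 1 / 10 := by linarith
        have hβ2 : -(1 + 1 / 10) ≤ β := by linarith
        have e1 : 2 * v x * (b x * v x - f x * y x)
          - (v x * v x + y x * (b x * v x - f x * y x)) + f₀ * (2 * y x * v x) =
          (2 * b x - 1) * v x ^ 2 + β * (y x * v x) + f x * y x ^ 2 := by rw [hβ]; ring
        rw [e1]
        nlinarith [mul_nonneg (by linarith : 0 ≤ (1 + 1 / 10) + β) (sq_nonneg (y x + v x)),
          mul_nonneg (by linarith : 0 ≤ (1 + 1 / 10) - β) (sq_nonneg (y x - v x)),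
          mul_nonneg (by linarith : 0 ≤ 2 * b x - 1 - 9 / 10) (sq_nonneg (v x)),
          mul_nonneg (by linarith : 0 ≤ f x - 9 / 10) (sq_nonneg (y x)),
          sq_nonneg (v x), sq_nonneg (y x)])
    linarith
  have helim : Tendsto e atTop (𝓝 0) := by
    have := ((hv0.pow 2).sub (hy0.mul hv0)).add ((hy0.pow 2).const_mul f₀)
    simpa using this
  filter_upwards [eventually_ge_atTop T] with t ht
  have hle : e t ≤ 0 := by
    refine ge_of_tendsto helim ?_
    filter_upwards [eventually_ge_atTop t] with s hs
    exact hmono ht (le_trans ht hs) hs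
  have h1 : y t ^ 2 + v t ^ 2 ≤ 0 := by
    simp only [he] at hle
    nlinarith [sq_nonneg (y t - v t), sq_nonneg (y t)]
  constructor
  · nlinarith [sq_nonneg (y t), sq_nonneg (v t)]
  · nlinarith [sq_nonneg (y t), sq_nonneg (v t)]

/-! ### Convergence to a flat critical point -/

namespace IsExteriorSolution

variable {N : ℕ} {r Ψ κ S : ℝ → ℝ} {ω U : ℕ → ℝ → ℝ} {τ : ℝ}

theorem eventually_abs_omega_le (h : IsExteriorSolution N r Ψ κ S ω U) :
    ∃ C, ∀ᶠ t in atTop, ∀ j ≤ N, |ω j t| ≤ C := by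
  obtain ⟨C, hC⟩ := h.eventually_sumSq_omega_le
  refine ⟨Real.sqrt C, ?_⟩
  filter_upwards [hC, eventually_gt_atTop 0] with t ht ht0 j hj
  apply Real.abs_le_sqrt
  by_cases hj' : j ∈ Finset.Ico 1 N
  · exact (Finset.single_le_sum (f := fun j => ω j t ^ 2) (fun _ _ => sq_nonneg _) hj').trans ht
  · have : j = 0 ∨ j = N := by
      rw [Finset.mem_Ico] at hj'; omega
    have hC0 : 0 ≤ C := (sumSq_nonneg _ _).trans ht
    rcases this with rfl | rfl
    · simpa [h.omega_zero t ht0] using hC0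
    · simpa [h.omega_N t ht0] using hC0

theorem eventually_gaugePotential_le (h : IsExteriorSolution N r Ψ κ S ω U) :
    ∃ C, ∀ᶠ t in atTop, gaugePotential N (fun j => ω j t) ≤ C := by
  obtain ⟨C, hC⟩ := h.eventually_sumSq_omega_le
  refine ⟨4 * (C + vacuumSum N) ^ 2, ?_⟩
  filter_upwards [hC, eventually_gt_atTop 0] with t ht ht0
  refine (gaugePotential_le h.one_le_N _ (h.omega_zero t ht0) (h.omega_N t ht0)).trans ?_
  have h1 := vacuumSum_nonneg N
  have h2 := sumSq_nonneg N fun j => ω j t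
  unfold vacuumSum at h1 ⊢
  gcongr

theorem eventually_abs_gaugeFactor_mul_le (h : IsExteriorSolution N r Ψ κ S ω U) :
    ∃ C, ∀ᶠ t in atTop, ∀ j < N, |gaugeFactor (fun i => ω i t) j * ω j t| ≤ C := by
  obtain ⟨C, hC⟩ := h.eventually_abs_omega_le
  refine ⟨(1 + 2 * C ^ 2) * C, ?_⟩
  filter_upwards [hC] with t ht j hj
  rw [abs_mul]
  have := ht j hj.le
  have h2 := abs_gaugeFactor_le ht hj
  gcongr

theorem tendsto_gaugePotential_div (h : IsExteriorSolution N r Ψ κ S ω U) :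
    Tendsto (fun t => gaugePotential N (fun j => ω j t) / (2 * r t ^ 2)) atTop (𝓝 0) := by
  obtain ⟨C, hC⟩ := h.eventually_gaugePotential_le
  have h1 : Tendsto (fun t => C / (2 * r t ^ 2)) atTop (𝓝 0) :=
    Tendsto.div_atTop tendsto_const_nhds
      (((tendsto_pow_atTop two_ne_zero).comp h.r_tendsto).const_mul_atTop two_pos)
  refine tendsto_of_tendsto_of_tendsto_of_le_of_le' tendsto_const_nhds h1 ?_ ?_
  · exact Eventually.of_forall fun t => div_nonneg (gaugePotential_nonneg _ _) (by positivity)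
  · filter_upwards [hC] with t ht
    gcongr

/-- The constraint gives `2Ψ(κ - Ψ) ≥ 2u - P/(2r²)` for `u = ∑ U_j²`. Hence where `u > ε` and the
potential term is below `ε`, `κ - Ψ ≥ u/2`, so the damping contributes `-u²`. The forcing carries a
factor `1/r` and eventually costs at most half of that. -/
theorem tendsto_sumSq_U (h : IsExteriorSolution N r Ψ κ S ω U) :
    Tendsto (fun t => sumSq N fun j => U j t) atTop (𝓝 0) := by
  suffices ∀ ε > 0, ∀ᶠ t in atTop, sumSq N (fun j => U j t) ≤ ε by
    rw [tendsto_order]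
    refine ⟨fun a ha => Eventually.of_forall fun t => ha.trans_le (sumSq_nonneg _ _),
      fun a ha => ?_⟩
    filter_upwards [this (a / 2) (by linarith)] with t ht
    linarith
  intro ε hε
  obtain ⟨C, hC⟩ := h.eventually_abs_gaugeFactor_mul_le
  have hC' : ∀ᶠ t in atTop, 2 / r t * (N * C) * (1 / ε ^ 2 + 1 / ε) ≤ 1 / 2 := by
    have h1 : Tendsto (fun t => 2 / r t * (N * C) * (1 / ε ^ 2 + 1 / ε)) atTop (𝓝 (0 * (N * C) *
        (1 / ε ^ 2 + 1 / ε))) :=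
      ((Tendsto.div_atTop tendsto_const_nhds h.r_tendsto).mul_const _).mul_const _
    simp only [zero_mul] at h1
    exact h1.eventually_le_const (by norm_num)
  refine eventually_le_of_hasDerivAt (δ := ε ^ 2 / 2) (by positivity)
    (f' := fun τ => -2 * (κ τ - Ψ τ) * sumSq N (fun j => U j τ)
        - 2 / r τ * ∑ j ∈ Finset.Ico 1 N, gaugeFactor (fun i => ω i τ) j * ω j τ * U j τ) ?_
  filter_upwards [hC, hC', eventually_gt_atTop 0,
    h.tendsto_gaugePotential_div.eventually_le_const hε] with t hF hr ht hB
  refine ⟨h.hasDerivAt_sumSq_U ht, fun hlt => ?_⟩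
  set u := sumSq N (fun j => U j t) with hu
  have hrt := h.r_pos t ht
  have hΨ := h.Psi_pos t ht
  have hΨ1 := h.Psi_le_one t ht
  have hκ := h.two_mul_Psi_mul_kappa ht hrt.ne'
  have hu0 : 0 < u := by linarith
  have h1 : u / 2 ≤ κ t - Ψ t := by
    have e1 : u ≤ 2 * Ψ t * (κ t - Ψ t) := by
      rw [← hu] at hκ
      nlinarith
    by_contra! hcon
    nlinarith
  have h2 : |∑ j ∈ Finset.Ico 1 N, gaugeFactor (fun i => ω i t) j * ω j t * U j t| ≤
      N * C * (1 + u) := by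
    have hC0 : 0 ≤ C := (abs_nonneg _).trans (hF 0 (by have := h.one_le_N; omega))
    calc _ ≤ ∑ j ∈ Finset.Ico 1 N, |gaugeFactor (fun i => ω i t) j * ω j t * U j t| :=
          Finset.abs_sum_le_sum_abs _ _
      _ ≤ ∑ j ∈ Finset.Ico 1 N, C * (1 + u) := by
          refine Finset.sum_le_sum fun j hj => ?_
          rw [abs_mul]
          have e1 := hF j (Finset.mem_Ico.1 hj).2
          have e2 : U j t ^ 2 ≤ u :=
            Finset.single_le_sum (f := fun j => U j t ^ 2) (fun _ _ => sq_nonneg _) hj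
          have e3 : |U j t| ≤ 1 + u := by
            rw [abs_le]
            constructor <;> nlinarith [sq_nonneg (U j t - 1), sq_nonneg (U j t + 1)]
          gcongr
      _ = ((N - 1 : ℕ) : ℝ) * (C * (1 + u)) := by simp
      _ ≤ N * (C * (1 + u)) := by
          have : ((N - 1 : ℕ) : ℝ) ≤ N := by exact_mod_cast Nat.sub_le N 1
          gcongr
      _ = _ := by ring
  have h3 : 1 + u ≤ (1 / ε ^ 2 + 1 / ε) * u ^ 2 := by
    have e1 : 1 ≤ 1 / ε ^ 2 * u ^ 2 := by
      rw [div_mul_eq_mul_div, le_div_iff₀ (by positivity)]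
      nlinarith
    have e2 : u ≤ 1 / ε * u ^ 2 := by
      rw [div_mul_eq_mul_div, le_div_iff₀ hε]
      nlinarith
    linarith
  have hNC : 0 ≤ (N : ℝ) * C := by
    have hC0 : 0 ≤ C := (abs_nonneg _).trans (hF 0 (by have := h.one_le_N; omega))
    positivity
  have h4 : -(2 / r t * ∑ j ∈ Finset.Ico 1 N, gaugeFactor (fun i => ω i t) j * ω j t * U j t) ≤
      1 / 2 * u ^ 2 := by
    calc _ = 2 / r t * -(∑ j ∈ Finset.Ico 1 N, gaugeFactor (fun i => ω i t) j * ω j t * U j t) := by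
          ring
      _ ≤ 2 / r t * (N * C * (1 + u)) := by
          have := neg_le_of_abs_le h2
          have e : 0 ≤ 2 / r t := by positivity
          apply mul_le_mul_of_nonneg_left _ e
          linarith
      _ ≤ 2 / r t * (N * C * ((1 / ε ^ 2 + 1 / ε) * u ^ 2)) := by
          gcongr
      _ = 2 / r t * (N * C) * (1 / ε ^ 2 + 1 / ε) * u ^ 2 := by ring
      _ ≤ 1 / 2 * u ^ 2 := by gcongr
  have h5 : u ^ 2 ≤ 2 * (κ t - Ψ t) * u := by nlinarith
  have h6 : ε ^ 2 ≤ u ^ 2 := by gcongr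
  linarith

theorem tendsto_Psi (h : IsExteriorSolution N r Ψ κ S ω U) : Tendsto Ψ atTop (𝓝 1) := by
  suffices ∀ ε > 0, ∀ᶠ t in atTop, 1 - ε ≤ Ψ t by
    rw [tendsto_order]
    refine ⟨fun a ha => ?_, fun a ha => ?_⟩
    · filter_upwards [this ((1 - a) / 2) (by linarith)] with t ht
      linarith
    · filter_upwards [eventually_gt_atTop 0] with t ht
      linarith [h.Psi_le_one t ht]
  intro ε hε
  have hlim := (h.tendsto_sumSq_U.const_mul 2).add h.tendsto_gaugePotential_div
  simp only [mul_zero, add_zero] at hlim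
  refine eventually_ge_of_hasDerivAt (δ := ε / 4) (by positivity)
    (f' := fun τ => 1 / 2 * (1 - Ψ τ ^ 2 - 2 * sumSq N (fun j => U j τ)
      - gaugePotential N (fun j => ω j τ) / (2 * r τ ^ 2))) ?_
  filter_upwards [eventually_gt_atTop 0, hlim.eventually_le_const (half_pos hε)] with t ht hle
  refine ⟨h.hasDerivAt_Psi ht (h.r_pos t ht).ne', fun hlt => ?_⟩
  have hΨ := h.Psi_pos t ht
  nlinarith [h.Psi_le_one t ht]

theorem tendsto_kappa (h : IsExteriorSolution N r Ψ κ S ω U) : Tendsto κ atTop (𝓝 1) := by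
  have h1 : Tendsto (fun t => (1 + Ψ t ^ 2 + 2 * sumSq N (fun j => U j t)
      - gaugePotential N (fun j => ω j t) / (2 * r t ^ 2)) / (2 * Ψ t)) atTop
      (𝓝 ((1 + 1 ^ 2 + 2 * 0 - 0) / (2 * 1))) :=
    ((((h.tendsto_Psi.pow 2).const_add 1).add (h.tendsto_sumSq_U.const_mul 2)).sub
      h.tendsto_gaugePotential_div).div (h.tendsto_Psi.const_mul 2) (by norm_num)
  norm_num at h1
  refine h1.congr' ?_
  filter_upwards [eventually_gt_atTop 0] with t ht
  have hΨ := h.Psi_pos t ht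
  rw [← h.two_mul_Psi_mul_kappa ht (h.r_pos t ht).ne']
  field_simp

theorem tendsto_two_mul_Psi_sub_kappa (h : IsExteriorSolution N r Ψ κ S ω U) :
    Tendsto (fun t => 2 * Ψ t - κ t) atTop (𝓝 1) := by
  have := (h.tendsto_Psi.const_mul 2).sub h.tendsto_kappa
  norm_num at this
  exact this

theorem eventually_abs_r_mul_U_le (h : IsExteriorSolution N r Ψ κ S ω U) :
    ∃ C, ∀ᶠ t in atTop, ∀ j, 1 ≤ j → j < N → |r t * U j t| ≤ C := by
  obtain ⟨C, hC⟩ := h.eventually_abs_gaugeFactor_mul_le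
  obtain ⟨K, hK⟩ := h.eventually_abs_omega_le
  have hj : ∀ j, 1 ≤ j ∧ j < N → ∀ᶠ t in atTop, |r t * U j t| ≤ 2 * C + 1 := by
    intro j hj
    refine eventually_abs_deriv_le_of_bounded (y := ω j) (b := fun t => 2 * Ψ t - κ t)
      (g := fun t => -(gaugeFactor (fun i => ω i t) j * ω j t)) (K := K) ?_ ?_ ?_ ?_ ?_
    · filter_upwards [eventually_gt_atTop 0] with t ht using h.omega_eq j hj.1 hj.2 t ht
    · filter_upwards [eventually_gt_atTop 0] with t ht
      exact (h.hasDerivAt_r_mul_U ht hj.1 hj.2).congr_deriv (by ring)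
    · exact h.tendsto_two_mul_Psi_sub_kappa.eventually_const_le (by norm_num)
    · filter_upwards [hC] with t ht
      rw [abs_neg]
      exact ht j hj.2
    · filter_upwards [hK] with t ht using ht j hj.2.le
  refine ⟨2 * C + 1, ?_⟩
  have := (Filter.eventually_all_finset (Finset.Ico 1 N) (l := atTop)
    (p := fun j t => |r t * U j t| ≤ 2 * C + 1)).2 fun j hj' => hj j (Finset.mem_Ico.1 hj')
  filter_upwards [this] with t ht j h1 h2 using ht j (Finset.mem_Ico.2 ⟨h1, h2⟩)

theorem hasDerivAt_sumSq_r_mul_U (h : IsExteriorSolution N r Ψ κ S ω U) (hτ : 0 < τ) :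
    HasDerivAt (fun t => sumSq N (fun j => r t * U j t))
      (∑ j ∈ Finset.Ico 1 N, 2 * (r τ * U j τ) * ((2 * Ψ τ - κ τ) * (r τ * U j τ)
        - gaugeFactor (fun i => ω i τ) j * ω j τ)) τ := by
  unfold sumSq
  refine HasDerivAt.fun_sum fun j hj => ?_
  rw [Finset.mem_Ico] at hj
  refine ((h.hasDerivAt_r_mul_U hτ hj.1 hj.2).fun_pow 2).congr_deriv ?_
  push_cast
  ring

/-- Energy of the limiting flat system in the velocities `ω̇_j = r U_j`. As `2Ψ - κ → 1`, it is
eventually nondecreasing, and its dissipation rate controls all velocities. -/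
theorem hasDerivAt_flatEnergy (h : IsExteriorSolution N r Ψ κ S ω U) (hτ : 0 < τ) :
    HasDerivAt (fun t => sumSq N (fun j => r t * U j t) / 2
        - gaugePotential N (fun j => ω j t) / 8)
      ((2 * Ψ τ - κ τ) * sumSq N (fun j => r τ * U j τ)) τ := by
  refine (((h.hasDerivAt_sumSq_r_mul_U hτ).div_const 2).fun_sub ((h.hasDerivAt_gaugePotential hτ).div_const 8)).congr_deriv ?_
  rw [Finset.sum_div, Finset.mul_sum, Finset.sum_div, ← Finset.sum_sub_distrib, sumSq,
    Finset.mul_sum]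
  exact Finset.sum_congr rfl fun _ _ => by ring

theorem sumSq_le_of_abs_le {v : ℕ → ℝ} {C : ℝ} (hv : ∀ j, 1 ≤ j → j < N → |v j| ≤ C) :
    sumSq N v ≤ N * C ^ 2 := by
  calc sumSq N v ≤ ∑ j ∈ Finset.Ico 1 N, C ^ 2 := by
        refine Finset.sum_le_sum fun j hj => ?_
        rw [Finset.mem_Ico] at hj
        have := abs_le.1 (hv j hj.1 hj.2)
        exact sq_le_sq' this.1 this.2
    _ = ((N - 1 : ℕ) : ℝ) * C ^ 2 := by simp
    _ ≤ N * C ^ 2 := by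
        have : ((N - 1 : ℕ) : ℝ) ≤ N := by exact_mod_cast Nat.sub_le N 1
        gcongr

theorem eventually_flatEnergy_mono (h : IsExteriorSolution N r Ψ κ S ω U) :
    ∃ T, MonotoneOn (fun t => sumSq N (fun j => r t * U j t) / 2
        - gaugePotential N (fun j => ω j t) / 8) (Set.Ici T) := by
  obtain ⟨T, hT⟩ := eventually_atTop.1
    ((h.tendsto_two_mul_Psi_sub_kappa.eventually_const_le (by norm_num : (0 : ℝ) < 1)).and
    (eventually_gt_atTop 0))
  refine ⟨T, fun s hs t ht hst => ?_⟩
  have := mul_le_sub_of_le_hasDerivAt (C := 0) hst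
    (fun x hx => h.hasDerivAt_flatEnergy (hT x (le_trans hs hx.1)).2)
    (fun x hx => mul_nonneg (hT x (le_trans hs hx.1.le)).1 (sumSq_nonneg _ _))
  linarith

/-- The flat energy is monotone and bounded above, hence converges; its derivative differs from the
kinetic term by a factor tending to `1`, so Barbalat's lemma applies. -/
theorem tendsto_sumSq_r_mul_U (h : IsExteriorSolution N r Ψ κ S ω U) :
    Tendsto (fun t => sumSq N fun j => r t * U j t) atTop (𝓝 0) := by
  obtain ⟨C, hC⟩ := h.eventually_abs_r_mul_U_le
  obtain ⟨K, hK⟩ := h.eventually_abs_gaugeFactor_mul_le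
  obtain ⟨T₀, hT₀⟩ := h.eventually_flatEnergy_mono
  obtain ⟨T, hT⟩ := eventually_atTop.1 (hC.and (eventually_ge_atTop T₀))
  obtain ⟨ℓ, hℓ⟩ := exists_tendsto_atTop_of_monotoneOn_Ici
    (hT₀.mono (Set.Ici_subset_Ici.2 (hT T le_rfl).2)) (C := N * C ^ 2 / 2) (fun t ht => by
      have h1 := sumSq_le_of_abs_le (hT t ht).1
      have h2 := gaugePotential_nonneg N fun j => ω j t
      linarith)
  have hb := h.tendsto_two_mul_Psi_sub_kappa
  refine tendsto_zero_of_tendsto_of_hasDerivAt_near (L := N * (2 * |C| * (2 * |C| + |K|)) + 1) (by positivity)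
    (H' := fun τ => (2 * Ψ τ - κ τ) * sumSq N (fun j => r τ * U j τ)) ?_ hℓ ?_ ?_
  · filter_upwards [eventually_gt_atTop 0] with t ht using h.hasDerivAt_flatEnergy ht
  · have h1 : Tendsto (fun t => (2 * Ψ t - κ t) - 1) atTop (𝓝 0) := by
      simpa using hb.sub_const 1
    have h2 : ∀ᶠ t in atTop, ‖sumSq N (fun j => r t * U j t)‖ ≤ N * C ^ 2 := by
      filter_upwards [hC] with t ht
      rw [Real.norm_of_nonneg (sumSq_nonneg _ _)]
      exact sumSq_le_of_abs_le ht
    refine (h1.zero_mul_isBoundedUnder_le ⟨_, eventually_map.2 h2⟩).congr fun t => ?_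
    ring
  · refine eventually_abs_sub_le_of_hasDerivAt
      (f' := fun τ => ∑ j ∈ Finset.Ico 1 N, 2 * (r τ * U j τ) * ((2 * Ψ τ - κ τ) * (r τ * U j τ)
        - gaugeFactor (fun i => ω i τ) j * ω j τ)) ?_
    filter_upwards [hC, hK, eventually_gt_atTop 0, hb.eventually_le_const (by norm_num : (1:ℝ) < 2),
      hb.eventually_const_le (by norm_num : (0:ℝ) < 1)] with t h1 h2 ht hb2 hb0
    refine ⟨h.hasDerivAt_sumSq_r_mul_U ht, ?_⟩
    calc _ ≤ ∑ j ∈ Finset.Ico 1 N, |2 * (r t * U j t) * ((2 * Ψ t - κ t) * (r t * U j t)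
        - gaugeFactor (fun i => ω i t) j * ω j t)| := Finset.abs_sum_le_sum_abs _ _
      _ ≤ ∑ j ∈ Finset.Ico 1 N, 2 * |C| * (2 * |C| + |K|) := by
        refine Finset.sum_le_sum fun j hj => ?_
        rw [Finset.mem_Ico] at hj
        have e1 := (h1 j hj.1 hj.2).trans (le_abs_self C)
        have e2 := (h2 j hj.2).trans (le_abs_self K)
        rw [abs_mul, abs_mul, abs_two]
        have e3 : |(2 * Ψ t - κ t) * (r t * U j t) - gaugeFactor (fun i => ω i t) j * ω j t| ≤
            2 * |C| + |K| := by
          refine (abs_sub _ _).trans ?_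
          rw [abs_mul, abs_of_nonneg hb0]
          gcongr
        gcongr
      _ = ((N - 1 : ℕ) : ℝ) * (2 * |C| * (2 * |C| + |K|)) := by simp
      _ ≤ N * (2 * |C| * (2 * |C| + |K|)) := by
        have : ((N - 1 : ℕ) : ℝ) ≤ N := by exact_mod_cast Nat.sub_le N 1
        gcongr
      _ ≤ _ := by linarith

theorem tendsto_r_mul_U (h : IsExteriorSolution N r Ψ κ S ω U) {j : ℕ} (h1 : 1 ≤ j)
    (hj : j < N) : Tendsto (fun t => r t * U j t) atTop (𝓝 0) := by
  have h2 : Tendsto (fun t => Real.sqrt (sumSq N fun j => r t * U j t)) atTop (𝓝 0) := by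
    have := (Real.continuous_sqrt.tendsto 0).comp h.tendsto_sumSq_r_mul_U
    rwa [Real.sqrt_zero] at this
  refine squeeze_zero_norm (fun t => ?_) h2
  rw [Real.norm_eq_abs]
  apply Real.abs_le_sqrt
  exact Finset.single_le_sum (f := fun j => (r t * U j t) ^ 2) (fun _ _ => sq_nonneg _)
    (Finset.mem_Ico.2 ⟨h1, hj⟩)

theorem hasDerivAt_gaugeFactor (h : IsExteriorSolution N r Ψ κ S ω U) (hτ : 0 < τ) {j : ℕ}
    (hj : j < N) : HasDerivAt (fun t => gaugeFactor (fun i => ω i t) j)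
      (-(2 * ω j τ * omegaDot N r U j τ) + (ω (j - 1) τ * omegaDot N r U (j - 1) τ
        + ω (j + 1) τ * omegaDot N r U (j + 1) τ)) τ := by
  unfold gaugeFactor
  have a1 := (h.hasDerivAt_omega hτ hj.le).fun_pow 2
  have a2 := (h.hasDerivAt_omega hτ (show j - 1 ≤ N by omega)).fun_pow 2
  have a3 := (h.hasDerivAt_omega hτ (show j + 1 ≤ N by omega)).fun_pow 2
  refine ((a1.const_sub 1).fun_add ((a2.fun_add a3).const_mul (1 / 2))).congr_deriv ?_
  push_cast
  ring

/-- A second use of Barbalat: `r U_j` converges to `0`, and its derivative is `-F_j ω_j` up to a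
vanishing term. -/
theorem tendsto_gaugeFactor_mul_omega (h : IsExteriorSolution N r Ψ κ S ω U) {j : ℕ}
    (h1 : 1 ≤ j) (hj : j < N) :
    Tendsto (fun t => gaugeFactor (fun i => ω i t) j * ω j t) atTop (𝓝 0) := by
  obtain ⟨C, hC⟩ := h.eventually_abs_r_mul_U_le
  obtain ⟨K, hK⟩ := h.eventually_abs_omega_le
  have hb := h.tendsto_two_mul_Psi_sub_kappa
  have key : Tendsto (fun t => -(gaugeFactor (fun i => ω i t) j * ω j t)) atTop (𝓝 0) := by
    refine tendsto_zero_of_tendsto_of_hasDerivAt_near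
      (L := (4 * |K| * |C|) * |K| + (1 + 2 * |K| ^ 2) * |C| + 1) (by positivity)
      (H := fun t => r t * U j t) (H' := fun τ => (2 * Ψ τ - κ τ) * (r τ * U j τ)
        - gaugeFactor (fun i => ω i τ) j * ω j τ) ?_ (h.tendsto_r_mul_U h1 hj) ?_ ?_
    · filter_upwards [eventually_gt_atTop 0] with t ht using h.hasDerivAt_r_mul_U ht h1 hj
    · have := hb.mul (h.tendsto_r_mul_U h1 hj)
      rw [mul_zero] at this
      exact this.congr fun t => by ring
    · refine eventually_abs_sub_le_of_hasDerivAt (f' := fun τ =>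
        -((-(2 * ω j τ * omegaDot N r U j τ) + (ω (j - 1) τ * omegaDot N r U (j - 1) τ
        + ω (j + 1) τ * omegaDot N r U (j + 1) τ)) * ω j τ
        + gaugeFactor (fun i => ω i τ) j * omegaDot N r U j τ)) ?_
      filter_upwards [hC, hK, eventually_gt_atTop 0] with t hC hK ht
      refine ⟨((h.hasDerivAt_gaugeFactor ht hj).fun_mul (h.hasDerivAt_omega ht hj.le)).fun_neg, ?_⟩
      have hK' : ∀ i ≤ N, |ω i t| ≤ |K| := fun i hi => (hK i hi).trans (le_abs_self K)
      have hC' : ∀ i, |omegaDot N r U i t| ≤ |C| := by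
        intro i
        unfold omegaDot
        split_ifs with hi
        · exact (hC i hi.1 hi.2).trans (le_abs_self C)
        · simp
      have e1 := abs_gaugeFactor_le hK' hj
      have e2 : |-(2 * ω j t * omegaDot N r U j t) + (ω (j - 1) t * omegaDot N r U (j - 1) t
        + ω (j + 1) t * omegaDot N r U (j + 1) t)| ≤ 4 * |K| * |C| := by
        have a1 := mul_le_mul (hK' j hj.le) (hC' j) (abs_nonneg _) (abs_nonneg _)
        have a2 := mul_le_mul (hK' (j - 1) (by omega)) (hC' (j - 1)) (abs_nonneg _) (abs_nonneg _)
        have a3 := mul_le_mul (hK' (j + 1) (by omega)) (hC' (j + 1)) (abs_nonneg _) (abs_nonneg _)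
        rw [← abs_mul] at a1 a2 a3
        rw [abs_le] at a1 a2 a3 ⊢
        constructor <;> linarith
      rw [abs_neg]
      refine (abs_add_le _ _).trans ?_
      rw [abs_mul, abs_mul]
      have a1 := mul_le_mul e2 (hK' j hj.le) (abs_nonneg _) (by positivity)
      have a2 := mul_le_mul e1 (hC' j) (abs_nonneg _) (by positivity)
      linarith
  simpa using key.neg

theorem tendsto_gaugeFactor {l : Filter ℝ} {a : ℕ → ℝ} {j : ℕ} (hj : j < N)
    (hω : ∀ i ≤ N, Tendsto (ω i) l (𝓝 (a i))) :
    Tendsto (fun t => gaugeFactor (fun i => ω i t) j) l (𝓝 (gaugeFactor a j)) := by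
  unfold gaugeFactor
  exact (((hω j hj.le).pow 2).const_sub 1).add ((((hω (j - 1) (by omega)).pow 2).add
    ((hω (j + 1) (by omega)).pow 2)).const_mul (1 / 2))

theorem isFlatCriticalPoint_of_tendsto (h : IsExteriorSolution N r Ψ κ S ω U) {l : Filter ℝ}
    [l.NeBot] (hl : l ≤ atTop) {a : ℕ → ℝ} (hω : ∀ i ≤ N, Tendsto (ω i) l (𝓝 (a i))) :
    IsFlatCriticalPoint N a := by
  have hpos : ∀ᶠ t in l, 0 < t := hl (eventually_gt_atTop 0)
  refine ⟨?_, ?_, fun j h1 hj => ?_⟩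
  · refine tendsto_nhds_unique (hω 0 (Nat.zero_le _)) ?_
    exact tendsto_const_nhds.congr' (hpos.mono fun t ht => (h.omega_zero t ht).symm)
  · refine tendsto_nhds_unique (hω N le_rfl) ?_
    exact tendsto_const_nhds.congr' (hpos.mono fun t ht => (h.omega_N t ht).symm)
  · exact tendsto_nhds_unique ((tendsto_gaugeFactor hj hω).mul (hω j hj.le))
      ((h.tendsto_gaugeFactor_mul_omega h1 hj).mono_left hl)

/-- If `ω_j` crossed an interval infinitely often, it would take every intermediate value `c` at
arbitrarily late times. By compactness each `c` would be the `j`-th coordinate of a critical point,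
but only finitely many such values exist. -/
theorem exists_tendsto_omega (h : IsExteriorSolution N r Ψ κ S ω U) {j : ℕ} (hj : j ≤ N) :
    ∃ a, Tendsto (ω j) atTop (𝓝 a) := by
  obtain ⟨K, hK⟩ := h.eventually_abs_omega_le
  refine tendsto_of_no_upcrossings dense_univ ?_
    ⟨K, eventually_map.2 (hK.mono fun t ht => (abs_le.1 (ht j hj)).2)⟩
    ⟨-K, eventually_map.2 (hK.mono fun t ht => (abs_le.1 (ht j hj)).1)⟩
  rintro a - b - hab ⟨hfa, hfb⟩
  obtain ⟨c, hc, hcn⟩ := ((Set.Ioo_infinite hab).sdiff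
    (finite_flatCriticalPoint_values h.one_le_N hj)).nonempty
  have hfreq : ∃ᶠ t in atTop, ω j t = c := by
    rw [frequently_atTop]
    intro T
    obtain ⟨t₁, h1, ht₁⟩ := (hfa.and_eventually (eventually_ge_atTop (max T 1))).exists
    obtain ⟨t₂, h2, ht₂⟩ := (hfb.and_eventually (eventually_ge_atTop t₁)).exists
    have ht1 : 1 ≤ t₁ := (le_max_right _ _).trans ht₁
    have hcont : ContinuousOn (ω j) (Set.Icc t₁ t₂) := fun t ht =>
      (h.hasDerivAt_omega (by linarith [ht.1]) hj).continuousAt.continuousWithinAt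
    obtain ⟨t, ht, htc⟩ := intermediate_value_Icc ht₂ hcont
      (⟨h1.le.trans hc.1.le, hc.2.le.trans h2.le⟩ : c ∈ Set.Icc (ω j t₁) (ω j t₂))
    exact ⟨t, ((le_max_left _ _).trans ht₁).trans ht.1, htc⟩
  have : (atTop ⊓ 𝓟 {t | ω j t = c}).NeBot := frequently_mem_iff_neBot.1 hfreq
  -- Along an ultrafilter of late times with `ω j t = c` all the bounded functions `ω i` converge at
  -- once, without extracting successive subsequences.
  set 𝒰 := Ultrafilter.of (atTop ⊓ 𝓟 {t | ω j t = c}) with h𝒰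
  have hle := Ultrafilter.of_le (atTop ⊓ 𝓟 {t | ω j t = c})
  have hle1 : (𝒰 : Filter ℝ) ≤ atTop := hle.trans inf_le_left
  have hlim : ∀ i, ∃ x, i ≤ N → Tendsto (ω i) 𝒰 (𝓝 x) := by
    intro i
    by_cases hi : i ≤ N
    · have hmem : ((𝒰.map (ω i) : Ultrafilter ℝ) : Filter ℝ) ≤ 𝓟 (Set.Icc (-K) K) := by
        rw [le_principal_iff]
        have hK' : ∀ᶠ t in (𝒰 : Filter ℝ), ∀ j ≤ N, |ω j t| ≤ K := hle1 hK
        exact hK'.mono fun t ht => abs_le.1 (ht i hi)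
      obtain ⟨x, -, hx⟩ := isCompact_Icc.ultrafilter_le_nhds _ hmem
      exact ⟨x, fun _ => hx⟩
    · exact ⟨0, fun hi' => absurd hi' hi⟩
  choose x hx using hlim
  have hcrit := h.isFlatCriticalPoint_of_tendsto hle1 hx
  refine hcn ⟨x, hcrit, ?_⟩
  refine tendsto_nhds_unique (hx j hj) (tendsto_const_nhds.congr' ?_)
  have : ∀ᶠ t in (𝒰 : Filter ℝ), ω j t = c := hle (mem_inf_of_right (mem_principal_self _))
  exact this.mono fun t ht => ht.symm

/-- With `a_j = 0` the factor `F_j` tends to a limit of at least `1`, so the anti-damped oscillator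
can rest at the origin only by being there already. The equation is linear in `(ω_j, r U_j)` with
continuous coefficients, so the zero propagates back to every `τ > 0`. -/
theorem omega_eq_zero_of_tendsto_zero (h : IsExteriorSolution N r Ψ κ S ω U) {a : ℕ → ℝ}
    (hω : ∀ i ≤ N, Tendsto (ω i) atTop (𝓝 (a i))) {j : ℕ} (h1 : 1 ≤ j) (hj : j < N)
    (ha : a j = 0) : ∀ τ > 0, ω j τ = 0 := by
  have hF := tendsto_gaugeFactor hj hω
  have hF1 : 1 ≤ gaugeFactor a j := by
    rw [gaugeFactor, ha]
    nlinarith [sq_nonneg (a (j - 1)), sq_nonneg (a (j + 1))]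
  have hev := eventually_eq_zero_of_tendsto_zero hF1
    ((eventually_gt_atTop 0).mono fun t ht => h.omega_eq j h1 hj t ht)
    ((eventually_gt_atTop 0).mono fun t ht => h.hasDerivAt_r_mul_U ht h1 hj)
    h.tendsto_two_mul_Psi_sub_kappa hF (ha ▸ hω j hj.le) (h.tendsto_r_mul_U h1 hj)
  intro τ hτ
  obtain ⟨T, ⟨hT1, hT2⟩, hT⟩ := (hev.and (eventually_ge_atTop τ)).exists
  have hpos : ∀ t ∈ Set.Icc τ T, 0 < t := fun t ht => lt_of_lt_of_le hτ ht.1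
  refine eq_zero_of_linear_system hT (p := fun _ => 1) (q := fun t => 2 * Ψ t - κ t)
    (s := fun t => -gaugeFactor (fun i => ω i t) j) (v := fun t => r t * U j t)
    (fun t ht => (h.omega_eq j h1 hj t (hpos t ht)).congr_deriv (by ring))
    (fun t ht => (h.hasDerivAt_r_mul_U (hpos t ht) h1 hj).congr_deriv (by ring))
    continuousOn_const (fun t ht => ?_) (fun t ht => ?_) hT1 hT2
  · have a1 := (h.hasDerivAt_Psi (hpos t ht) (h.r_pos t (hpos t ht)).ne').continuousAt
    have a2 := (h.kappa_eq t (hpos t ht)).continuousAt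
    exact ((a1.const_mul 2).sub a2).continuousWithinAt
  · exact (h.hasDerivAt_gaugeFactor (hpos t ht) hj).continuousAt.neg.continuousWithinAt

end IsExteriorSolution

end

/-! ### Passage to the radial variable and asymptotic flatness -/

noncomputable section

/-- A solution outside of a horizon at `rh` which extends to infinity is an exterior solution. -/
theorem IsTauSolution.isExteriorSolution {N : ℕ} (hN : 1 ≤ N) {rh : ℝ} {r Ψ κ S : ℝ → ℝ}
    {ω U : ℕ → ℝ → ℝ} (hsol : IsTauSolution N r Ψ κ S ω U) (hrh : 0 < rh)
    (hr0 : Tendsto r (𝓝[>] 0) (𝓝 rh)) (hμ0 : Tendsto (fun τ => Ψ τ ^ 2) (𝓝[>] 0) (𝓝 0))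
    (hΨ : ∀ τ > 0, 0 < Ψ τ) (hr : Tendsto r atTop atTop) :
    IsExteriorSolution N r Ψ κ S ω U := by
  have hne : ∀ τ > 0, r τ ≠ 0 := by
    intro τ hτ h0
    have h1 : ∀ᶠ s in 𝓝[>] (0 : ℝ), rh / 2 < r s := hr0.eventually_const_lt (by linarith)
    obtain ⟨s, hs, hs0, hsτ⟩ := (h1.and (Ioo_mem_nhdsGT hτ)).exists
    -- Working with `r²` avoids presupposing a sign: its derivative `2 r² Ψ` is nonnegative whatever
    -- the sign of `r`.
    have := mul_le_sub_of_le_hasDerivAt (C := 0) (f := fun t => r t ^ 2)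
      (f' := fun t => 2 * r t ^ 2 * Ψ t) hsτ.le
      (fun t ht => ((hsol.r_eq t (lt_of_lt_of_le hs0 ht.1)).fun_pow 2).congr_deriv
        (by push_cast; ring))
      (fun t ht => mul_nonneg (by positivity) (hΨ t (lt_trans hs0 ht.1)).le)
    simp only [h0] at this
    nlinarith
  have hrpos : ∀ τ > 0, 0 < r τ := by
    intro τ hτ
    by_contra! hle
    obtain ⟨T, hT, hτT⟩ := ((hr.eventually_gt_atTop 0).and (eventually_ge_atTop τ)).exists
    have hcont : ContinuousOn r (Set.Icc τ T) := fun t ht =>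
      (hsol.r_eq t (lt_of_lt_of_le hτ ht.1)).continuousAt.continuousWithinAt
    obtain ⟨t, ht, h0⟩ := intermediate_value_Icc hτT hcont ⟨hle, hT.le⟩
    exact hne t (lt_of_lt_of_le hτ ht.1) h0
  refine { hsol with one_le_N := hN, r_pos := hrpos, Psi_pos := hΨ, Psi_le_one := ?_, r_tendsto := hr }
  intro τ hτ
  have h1 : ∀ᶠ s in 𝓝[>] (0 : ℝ), Ψ s ^ 2 < 1 := hμ0.eventually_lt_const (by norm_num)
  obtain ⟨s, hs, hs0, hsτ⟩ := (h1.and (Ioo_mem_nhdsGT hτ)).exists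
  have hs1 : Ψ s ≤ 1 := by
    have := hΨ s hs0
    nlinarith
  -- By the constraint, `2Ψ' ≤ 1 - Ψ²`, so `1` is a barrier which `Ψ` starts below because `μ → 0`
  -- at the horizon.
  refine le_of_hasDerivAt_nonpos_above (t₀ := s)
    (fun t ht => hsol.hasDerivAt_Psi (lt_of_lt_of_le hs0 ht) (hne t (lt_of_lt_of_le hs0 ht)))
    hs1 (fun t ht hlt => ?_) τ hsτ.le
  have h2 := sumSq_nonneg N fun j => U j t
  have h3 : 0 ≤ gaugePotential N (fun j => ω j t) / (2 * r t ^ 2) :=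
    div_nonneg (gaugePotential_nonneg _ _) (by positivity)
  nlinarith

/-- `T` expresses `τ` as a function of the radius `r > rh`. -/
structure IsRadialInverse (rh : ℝ) (r Ψ T : ℝ → ℝ) : Prop where
  pos : ∀ x > rh, 0 < T x
  r_T : ∀ x > rh, r (T x) = x
  T_r : ∀ τ > 0, T (r τ) = τ
  hasDerivAt : ∀ x > rh, HasDerivAt T (x * Ψ (T x))⁻¹ x
  tendsto_atTop : Tendsto T atTop atTop
  tendsto_horizon : Tendsto T (𝓝[>] rh) (𝓝[>] 0)

namespace IsExteriorSolution

variable {N : ℕ} {r Ψ κ S : ℝ → ℝ} {ω U : ℕ → ℝ → ℝ} {τ : ℝ}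

/-- Since `r' = r Ψ > 0`, the radius is an increasing bijection from `(0, ∞)` onto `(rh, ∞)`, and
the inverse function theorem gives `dT/dx = 1 / (x Ψ)`. -/
theorem exists_isRadialInverse (h : IsExteriorSolution N r Ψ κ S ω U) {rh : ℝ}
    (hr0 : Tendsto r (𝓝[>] 0) (𝓝 rh)) : ∃ T, IsRadialInverse rh r Ψ T := by
  have hmono := h.monotoneOn_r
  have hlt : ∀ τ > 0, rh < r τ := by
    intro τ hτ
    have h1 : rh ≤ r (τ / 2) := by
      refine le_of_tendsto hr0 ?_
      filter_upwards [Ioo_mem_nhdsGT (half_pos hτ)] with s hs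
      exact (hmono hs.1 (half_pos hτ) hs.2).le
    exact h1.trans_lt (hmono (half_pos hτ) hτ (by linarith))
  have hex : ∀ x, ∃ τ, rh < x → 0 < τ ∧ r τ = x := by
    intro x
    by_cases hx : rh < x
    · obtain ⟨s, hs, hs0⟩ := ((hr0.eventually_lt_const hx).and self_mem_nhdsWithin).exists
      have hs0 : 0 < s := hs0
      obtain ⟨b, hb, hsb⟩ := ((h.r_tendsto.eventually_ge_atTop x).and
        (eventually_ge_atTop s)).exists
      have hcont : ContinuousOn r (Set.Icc s b) := fun t ht =>
        (h.r_eq t (lt_of_lt_of_le hs0 ht.1)).continuousAt.continuousWithinAt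
      obtain ⟨t, ht, htx⟩ := intermediate_value_Icc hsb hcont ⟨hs.le, hb⟩
      exact ⟨t, fun _ => ⟨lt_of_lt_of_le hs0 ht.1, htx⟩⟩
    · exact ⟨0, fun h => absurd h hx⟩
  choose T hT using hex
  have hTpos : ∀ x > rh, 0 < T x := fun x hx => (hT x hx).1
  have hrT : ∀ x > rh, r (T x) = x := fun x hx => (hT x hx).2
  have hTr : ∀ τ > 0, T (r τ) = τ := fun τ hτ =>
    hmono.injOn (hTpos _ (hlt τ hτ)) hτ (hrT _ (hlt τ hτ))
  have hTlt : ∀ x > rh, ∀ τ > 0, x < r τ ↔ T x < τ := fun x hx τ hτ => by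
    conv_lhs => rw [← hrT x hx]
    exact hmono.lt_iff_lt (hTpos x hx) hτ
  have hTmono : StrictMonoOn T (Set.Ioi rh) := fun x hx y hy hxy => by
    rw [← hTlt x hx _ (hTpos y hy), hrT y hy]
    exact hxy
  refine ⟨T, hTpos, hrT, hTr, fun x hx => ?_, ?_, ?_⟩
  · have hcont : ContinuousAt T x := by
      refine hTmono.continuousAt_of_image_mem_nhds (Ioi_mem_nhds hx) ?_
      filter_upwards [Ioi_mem_nhds (hTpos x hx)] with τ hτ
      exact ⟨r τ, hlt τ hτ, hTr τ hτ⟩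
    have := h.r_eq (T x) (hTpos x hx)
    rw [hrT x hx] at this
    refine HasDerivAt.of_local_left_inverse hcont this ?_ ?_
    · have h1 := h.r_pos _ (hTpos x hx)
      rw [hrT x hx] at h1
      exact (mul_pos h1 (h.Psi_pos _ (hTpos x hx))).ne'
    · filter_upwards [Ioi_mem_nhds hx] with y hy using hrT y hy
  · rw [tendsto_atTop]
    intro C
    have hC : 0 < max C 1 := lt_max_of_lt_right one_pos
    filter_upwards [eventually_ge_atTop (r (max C 1))] with x hx
    by_contra! hcon
    have h1 : rh < x := lt_of_lt_of_le (hlt _ hC) hx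
    have := (hTlt x h1 _ hC).2 (hcon.trans_le (le_max_left _ _))
    linarith
  · rw [tendsto_nhdsWithin_iff]
    constructor
    · rw [tendsto_order]
      constructor
      · intro a ha
        filter_upwards [self_mem_nhdsWithin] with x hx using ha.trans (hTpos x hx)
      · intro a ha
        filter_upwards [Ioo_mem_nhdsGT (hlt a ha)] with x hx
        exact (hTlt x hx.1 a ha).1 hx.2
    · filter_upwards [self_mem_nhdsWithin] with x hx using hTpos x hx

/-- A function whose `τ`-derivative is between `0` and a multiple of `Ψ / r` converges. -/
theorem exists_tendsto_of_hasDerivAt_le (h : IsExteriorSolution N r Ψ κ S ω U) {f f' : ℝ → ℝ}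
    {C : ℝ} (hf : ∀ᶠ t in atTop, HasDerivAt f (f' t) t)
    (hf' : ∀ᶠ t in atTop, 0 ≤ f' t ∧ f' t ≤ C * Ψ t / r t) : ∃ ℓ, Tendsto f atTop (𝓝 ℓ) := by
  obtain ⟨T, hT⟩ := eventually_atTop.1 (hf.and (hf'.and (eventually_gt_atTop 0)))
  refine exists_tendsto_atTop_of_monotoneOn_Ici (T := T) (C := f T + |C| / r T)
    (fun s hs t ht hst => ?_) fun t ht => ?_
  · have := mul_le_sub_of_le_hasDerivAt (C := 0) hst (fun x hx => (hT x (le_trans hs hx.1)).1)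
      fun x hx => (hT x (le_trans hs hx.1.le)).2.1.1
    linarith
  -- The derivative of `1 / r` is `-Ψ / r`, so adding `|C| / r` makes the function nonincreasing and
  -- bounds `f`.
  · have := sub_le_mul_of_hasDerivAt_le (C := 0) (f := fun t => f t + |C| / r t)
      (f' := fun t => f' t - |C| * Ψ t / r t) ht (fun x hx => by
        obtain ⟨h1, -, h0⟩ := hT x hx.1
        have hr := (h.r_pos x h0).ne'
        refine (h1.fun_add ((hasDerivAt_const x |C|).fun_div (h.r_eq x h0) hr)).congr_deriv ?_
        field_simp
        ring) fun x hx => by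
        obtain ⟨-, ⟨-, h2⟩, h0⟩ := hT x hx.1.le
        have hr := h.r_pos x h0
        have hΨ := h.Psi_pos x h0
        have : C * Ψ x / r x ≤ |C| * Ψ x / r x := by
          gcongr
          exact le_abs_self C
        linarith
    have hr := h.r_pos t (hT t ht).2.2
    have h3 : 0 ≤ |C| / r t := by positivity
    linarith

theorem exists_tendsto_mass (h : IsExteriorSolution N r Ψ κ S ω U) :
    ∃ M, Tendsto (fun t => r t * (1 - Ψ t ^ 2) / 2) atTop (𝓝 M) := by
  obtain ⟨C, hC⟩ := h.eventually_gaugePotential_le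
  refine h.exists_tendsto_of_hasDerivAt_le (C := 1 + C / 4)
    ((eventually_gt_atTop 0).mono fun t ht => h.hasDerivAt_mass ht) ?_
  filter_upwards [hC, eventually_gt_atTop 0,
    h.tendsto_sumSq_r_mul_U.eventually_le_const one_pos] with t hP ht hU
  have hr := h.r_pos t ht
  have hΨ := h.Psi_pos t ht
  have hP0 := gaugePotential_nonneg N fun j => ω j t
  have hU0 := sumSq_nonneg N fun j => U j t
  have e : sumSq N (fun j => r t * U j t) = r t ^ 2 * sumSq N (fun j => U j t) := by
    rw [sumSq, sumSq, Finset.mul_sum]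
    exact Finset.sum_congr rfl fun _ _ => by ring
  refine ⟨by positivity, ?_⟩
  have e2 : r t * Ψ t * (sumSq N (fun j => U j t)
      + gaugePotential N (fun j => ω j t) / (4 * r t ^ 2)) =
      (sumSq N (fun j => r t * U j t) + gaugePotential N (fun j => ω j t) / 4) * Ψ t / r t := by
    rw [e]
    field_simp
    
  rw [e2]
  gcongr

theorem hasDerivAt_S (h : IsExteriorSolution N r Ψ κ S ω U) (hτ : 0 < τ) :
    HasDerivAt S (2 * sumSq N (fun j => U j τ) / Ψ τ * S τ) τ := by
  have hΨ := (h.Psi_pos τ hτ).ne'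
  have h1 := (h.S_eq τ hτ).fun_div (h.Psi_eq τ hτ) hΨ
  have h2 : S =ᶠ[𝓝 τ] fun t => S t * Ψ t / Ψ t := by
    filter_upwards [Ioi_mem_nhds hτ] with t ht
    field_simp [(h.Psi_pos t ht).ne']
  refine (h1.congr_of_eventuallyEq h2).congr_deriv ?_
  field_simp
  ring

theorem exists_tendsto_S (h : IsExteriorSolution N r Ψ κ S ω U) :
    ∃ Sinf : ℝ, Sinf ≠ 0 ∧ Tendsto S atTop (𝓝 Sinf) := by
  -- `Real.log` of a negative number is the logarithm of its absolute value, so both signs of `S`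
  -- are treated together; the sign is restored below by the intermediate value theorem. The
  -- constant `8` absorbs `2 / Ψ²` once `Ψ ≥ 1/2`.
  obtain ⟨ℓ, hℓ⟩ := h.exists_tendsto_of_hasDerivAt_le (C := 8) (f := fun t => Real.log (S t))
    (f' := fun t => 2 * sumSq N (fun j => U j t) / Ψ t)
    ((eventually_gt_atTop 0).mono fun t ht =>
      ((h.hasDerivAt_S ht).log (h.S_ne t ht)).congr_deriv (by field_simp [h.S_ne t ht]))
    (by
      filter_upwards [eventually_gt_atTop 0, h.tendsto_sumSq_r_mul_U.eventually_le_const one_pos,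
        h.tendsto_Psi.eventually_const_le (by norm_num : (1 / 2 : ℝ) < 1),
        h.r_tendsto.eventually_ge_atTop 1] with t ht hU hΨ2 hr1
      have hr := h.r_pos t ht
      have hΨ := h.Psi_pos t ht
      have hU0 := sumSq_nonneg N fun j => U j t
      have e : sumSq N (fun j => r t * U j t) = r t ^ 2 * sumSq N (fun j => U j t) := by
        rw [sumSq, sumSq, Finset.mul_sum]
        exact Finset.sum_congr rfl fun _ _ => by ring
      refine ⟨by positivity, ?_⟩
      rw [div_le_div_iff₀ hΨ hr]
      rw [e] at hU
      have h1 : r t * sumSq N (fun j => U j t) ≤ 1 := by nlinarith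
      nlinarith)
  have hcont : ∀ T, ContinuousOn S (Set.Icc 1 T) := fun T t ht =>
    (h.hasDerivAt_S (by linarith [ht.1])).continuousAt.continuousWithinAt
  have hexp : Tendsto (fun t => Real.exp (Real.log (S t))) atTop (𝓝 (Real.exp ℓ)) :=
    (Real.continuous_exp.tendsto ℓ).comp hℓ
  rcases lt_or_gt_of_ne (h.S_ne 1 one_pos) with h1 | h1
  · refine ⟨-Real.exp ℓ, neg_ne_zero.2 (Real.exp_pos ℓ).ne', hexp.neg.congr' ?_⟩
    filter_upwards [eventually_ge_atTop 1] with t ht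
    have hneg : S t < 0 := by
      by_contra! hcon
      obtain ⟨s, hs, hs0⟩ := intermediate_value_Icc ht (hcont t) ⟨h1.le, hcon⟩
      exact h.S_ne s (by linarith [hs.1]) hs0
    rw [Real.exp_log_of_neg hneg, neg_neg]
  · refine ⟨Real.exp ℓ, (Real.exp_pos ℓ).ne', hexp.congr' ?_⟩
    filter_upwards [eventually_ge_atTop 1] with t ht
    have hpos : 0 < S t := by
      by_contra! hcon
      obtain ⟨s, hs, hs0⟩ := intermediate_value_Icc' ht (hcont t) ⟨hcon, h1.le⟩
      exact h.S_ne s (by linarith [hs.1]) hs0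
    rw [Real.exp_log hpos]

section Radial

variable {rh : ℝ} {T : ℝ → ℝ}

theorem metricMu_comp (Ψ T : ℝ → ℝ) {x : ℝ} (hx0 : x ≠ 0) :
    metricMu (fun x => x * (1 - Ψ (T x) ^ 2) / 2) x = Ψ (T x) ^ 2 := by
  unfold metricMu
  field_simp
  ring

theorem hasDerivAt_omega_comp (h : IsExteriorSolution N r Ψ κ S ω U)
    (hT : IsRadialInverse rh r Ψ T) {x : ℝ} (hx : rh < x) {j : ℕ} (h1 : 1 ≤ j) (hj : j < N) :
    HasDerivAt (fun x => ω j (T x)) (U j (T x) / Ψ (T x)) x := by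
  have hτ := hT.pos x hx
  refine ((h.omega_eq j h1 hj _ hτ).comp x (hT.hasDerivAt x hx)).congr_deriv ?_
  have h2 := h.r_pos _ hτ
  have h3 := h.Psi_pos _ hτ
  rw [hT.r_T x hx] at h2 ⊢
  field_simp

theorem hasDerivAt_deriv_omega_comp (h : IsExteriorSolution N r Ψ κ S ω U)
    (hT : IsRadialInverse rh r Ψ T) {x : ℝ} (hx : rh < x) {j : ℕ} (h1 : 1 ≤ j) (hj : j < N) :
    HasDerivAt (deriv fun x => ω j (T x))
      (((-(κ (T x) - Ψ (T x)) * U j (T x)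
        - 1 / x * gaugeFactor (fun i => ω i (T x)) j * ω j (T x)) * Ψ (T x)
        - U j (T x) * ((κ (T x) - Ψ (T x)) * Ψ (T x) - 2 * sumSq N (fun j => U j (T x))))
        / Ψ (T x) ^ 2 * (x * Ψ (T x))⁻¹) x := by
  have hτ := hT.pos x hx
  have h2 := ((h.U_eq j h1 hj _ hτ).fun_div (h.Psi_eq _ hτ) (h.Psi_pos _ hτ).ne').comp x
    (hT.hasDerivAt x hx)
  rw [hT.r_T x hx] at h2
  refine h2.congr_of_eventuallyEq ?_
  filter_upwards [Ioi_mem_nhds hx] with y hy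
  exact (h.hasDerivAt_omega_comp hT hy h1 hj).deriv

theorem radialG_comp (h : IsExteriorSolution N r Ψ κ S ω U)
    (hT : IsRadialInverse rh r Ψ T) {x : ℝ} (hx : rh < x) :
    radialG N (fun j x => ω j (T x)) x = sumSq N (fun j => U j (T x)) / Ψ (T x) ^ 2 := by
  rw [radialG, sumSq, sumSq, Finset.sum_div]
  refine Finset.sum_congr rfl fun j hj => ?_
  rw [Finset.mem_Ico] at hj
  rw [(h.hasDerivAt_omega_comp hT hx hj.1 hj.2).deriv, div_pow]

/-- The chain rule together with the constraint, which is used to eliminate `p_θ` in favour of `κ`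
in the gauge equation. -/
theorem solvesRadial (h : IsExteriorSolution N r Ψ κ S ω U) (hT : IsRadialInverse rh r Ψ T) :
    SolvesRadial N (Set.Ioi rh) (fun x => x * (1 - Ψ (T x) ^ 2) / 2) (fun x => S (T x))
      (fun j x => ω j (T x)) where
  omega_zero x hx := h.omega_zero _ (hT.pos x hx)
  omega_N x hx := h.omega_N _ (hT.pos x hx)
  S_ne x hx := h.S_ne _ (hT.pos x hx)
  diff j h1 hj x hx := (h.hasDerivAt_omega_comp hT hx h1 hj).differentiableAt
  diff_deriv j h1 hj x hx := (h.hasDerivAt_deriv_omega_comp hT hx h1 hj).differentiableAt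
  gauge_eq j h1 hj x hx := by
    have hτ := hT.pos x hx
    have hx0 := h.r_pos _ hτ
    have hΨ := (h.Psi_pos _ hτ).ne'
    have hκ := h.two_mul_Psi_mul_kappa hτ hx0.ne'
    rw [hT.r_T x hx] at hx0 hκ
    rw [metricMu_comp Ψ T hx0.ne', (h.hasDerivAt_omega_comp hT hx h1 hj).deriv,
      (h.hasDerivAt_deriv_omega_comp hT hx h1 hj).deriv, pTheta_eq_gaugePotential]
    have hP : gaugePotential N (fun j => ω j (T x)) = (1 + Ψ (T x) ^ 2
      + 2 * sumSq N (fun j => U j (T x)) - 2 * Ψ (T x) * κ (T x)) * (2 * x ^ 2) := by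
      rw [hκ]
      field_simp
      ring
    rw [hP]
    field_simp
    ring
  m_eq x hx := by
    have hτ := hT.pos x hx
    have hx0 := h.r_pos _ hτ
    rw [hT.r_T x hx] at hx0
    have hΨ := (h.Psi_pos _ hτ).ne'
    rw [metricMu_comp Ψ T hx0.ne', h.radialG_comp hT hx, pTheta_eq_gaugePotential]
    have h2 := (h.hasDerivAt_mass hτ).comp x (hT.hasDerivAt x hx)
    rw [hT.r_T x hx] at h2
    refine (h2.congr_of_eventuallyEq ?_).congr_deriv ?_
    · filter_upwards [Ioi_mem_nhds hx] with y hy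
      simp only [Function.comp_apply, hT.r_T y hy]
    · field_simp
  S_eq x hx := by
    have hτ := hT.pos x hx
    have hx0 := h.r_pos _ hτ
    rw [hT.r_T x hx] at hx0
    have hΨ := (h.Psi_pos _ hτ).ne'
    rw [h.radialG_comp hT hx]
    refine ((h.hasDerivAt_S hτ).comp x (hT.hasDerivAt x hx)).congr_deriv ?_
    field_simp

theorem isRegularBlackHole (h : IsExteriorSolution N r Ψ κ S ω U) (hT : IsRadialInverse rh r Ψ T)
    (hhor : RegularHorizonAlong N (𝓝[>] (0 : ℝ)) rh r (fun τ => Ψ τ ^ 2) ω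
      (fun j τ => U j τ / Ψ τ)) :
    IsRegularBlackHole N rh (fun x => x * (1 - Ψ (T x) ^ 2) / 2) (fun x => S (T x))
      (fun j x => ω j (T x)) where
  solves := h.solvesRadial hT
  horizon := by
    have hrh := hhor.rh_pos
    have hμ : (fun x => Ψ (T x) ^ 2) =ᶠ[𝓝[>] rh]
        metricMu fun x => x * (1 - Ψ (T x) ^ 2) / 2 := by
      filter_upwards [self_mem_nhdsWithin] with x hx
      exact (metricMu_comp Ψ T (hrh.trans hx).ne').symm
    refine ⟨hrh, nhdsWithin_le_nhds, (hhor.mu_lim.comp hT.tendsto_horizon).congr' hμ, ?_, ?_, ?_⟩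
    · obtain ⟨a, ha, hlim⟩ := hhor.dmu_lim
      refine ⟨a, ha, (hlim.comp hT.tendsto_horizon).congr' ?_⟩
      filter_upwards [hμ, self_mem_nhdsWithin] with x hx hx'
      simp only [Function.comp_apply, id, hT.r_T x hx', ← hx]
    · intro j h1 hj
      obtain ⟨a, ha⟩ := hhor.omega_lim j h1 hj
      exact ⟨a, ha.comp hT.tendsto_horizon⟩
    · intro j h1 hj
      obtain ⟨a, ha⟩ := hhor.domega_lim j h1 hj
      refine ⟨a, (ha.comp hT.tendsto_horizon).congr' ?_⟩
      filter_upwards [self_mem_nhdsWithin] with x hx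
      exact (h.hasDerivAt_omega_comp hT hx h1 hj).deriv.symm
  mu_pos x hx := by
    rw [metricMu_comp Ψ T (hhor.rh_pos.trans hx).ne']
    exact pow_pos (h.Psi_pos _ (hT.pos x hx)) 2
  mu_flat := by
    have h1 := (h.tendsto_Psi.comp hT.tendsto_atTop).pow 2
    rw [one_pow] at h1
    refine h1.congr' ?_
    filter_upwards [eventually_gt_atTop rh] with x hx
    exact (metricMu_comp Ψ T (hhor.rh_pos.trans hx).ne').symm
  S_flat := by
    obtain ⟨s, hs, hlim⟩ := h.exists_tendsto_S
    exact ⟨s, hs, hlim.comp hT.tendsto_atTop⟩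
  m_flat := by
    obtain ⟨M, hM⟩ := h.exists_tendsto_mass
    refine ⟨M, (hM.comp hT.tendsto_atTop).congr' ?_⟩
    filter_upwards [eventually_gt_atTop rh] with x hx
    simp only [Function.comp_apply, hT.r_T x hx]

end Radial

end IsExteriorSolution

end

/-! ### Analyticity at the singular point of a Fuchsian system -/

noncomputable section

theorem ofReal_mul_mem_ball {ρ : ℝ} {z : ℂ} (hz : z ∈ Metric.ball (0 : ℂ) ρ) {s : ℝ}
    (hs : s ∈ Set.Icc (0 : ℝ) 1) : (s : ℂ) * z ∈ Metric.ball (0 : ℂ) ρ := by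
  rw [mem_ball_zero_iff] at hz ⊢
  rw [norm_mul, Complex.norm_real, Real.norm_of_nonneg hs.1]
  nlinarith [norm_nonneg z, hs.2]

/-- Holomorphy of the Picard operator: differentiation under the integral sign, with a uniform bound
for `deriv g` on a slightly smaller closed disc. -/
theorem differentiableOn_integral_pow_mul {ρ : ℝ} {g : ℂ → ℂ}
    (hg : DifferentiableOn ℂ g (Metric.ball 0 ρ)) (n : ℕ) :
    DifferentiableOn ℂ (fun z => ∫ s in (0 : ℝ)..1, (s : ℂ) ^ n * g (s * z))
      (Metric.ball 0 ρ) := by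
  intro z₀ hz₀
  rw [mem_ball_zero_iff] at hz₀
  obtain ⟨R, hzR, hRρ⟩ := exists_between hz₀
  have hsub : Metric.closedBall (0 : ℂ) R ⊆ Metric.ball 0 ρ := Metric.closedBall_subset_ball hRρ
  have hg' : ContinuousOn (deriv g) (Metric.ball 0 ρ) :=
    (hg.deriv Metric.isOpen_ball).continuousOn
  obtain ⟨C, hC⟩ := (isCompact_closedBall (0 : ℂ) R).exists_bound_of_continuousOn (hg'.mono hsub)
  have hline : ∀ z ∈ Metric.ball (0 : ℂ) ρ, ∀ φ : ℂ → ℂ, ContinuousOn φ (Metric.ball 0 ρ) →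
      ContinuousOn (fun s : ℝ => φ (s * z)) (Set.uIcc 0 1) := by
    intro z hz φ hφ
    refine hφ.comp (by fun_prop) fun s hs => ?_
    rw [Set.uIcc_of_le zero_le_one] at hs
    exact ofReal_mul_mem_ball hz hs
  have hz₀' : z₀ ∈ Metric.ball (0 : ℂ) ρ := by rwa [mem_ball_zero_iff]
  have hcont : ∀ z ∈ Metric.ball (0 : ℂ) ρ,
      ContinuousOn (fun s : ℝ => (s : ℂ) ^ n * g (s * z)) (Set.uIcc 0 1) := fun z hz =>
    ContinuousOn.mul (by fun_prop) (hline z hz g hg.continuousOn)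
  have key := intervalIntegral.hasDerivAt_integral_of_dominated_loc_of_deriv_le
    (𝕜 := ℂ) (μ := MeasureTheory.volume) (a := 0) (b := 1)
    (F := fun z (s : ℝ) => (s : ℂ) ^ n * g (s * z))
    (F' := fun z (s : ℝ) => (s : ℂ) ^ n * (deriv g (s * z) * s)) (x₀ := z₀)
    (s := Metric.ball 0 R) (bound := fun _ => C)
    (Metric.isOpen_ball.mem_nhds (by rwa [mem_ball_zero_iff])) ?_ ?_ ?_ ?_ ?_ ?_
  · exact key.2.differentiableAt.differentiableWithinAt
  · filter_upwards [Metric.isOpen_ball.mem_nhds hz₀'] with z hz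
    exact ((hcont z hz).mono Set.uIoc_subset_uIcc).aestronglyMeasurable measurableSet_uIoc
  · exact (hcont z₀ hz₀').intervalIntegrable
  · refine ContinuousOn.aestronglyMeasurable (ContinuousOn.mono ?_ Set.uIoc_subset_uIcc)
      measurableSet_uIoc
    exact ContinuousOn.mul (by fun_prop) ((hline z₀ hz₀' _ hg').mul (by fun_prop))
  · refine Eventually.of_forall fun s hs z hz => ?_
    rw [Set.uIoc_of_le zero_le_one] at hs
    have h1 := ofReal_mul_mem_ball hz ⟨hs.1.le, hs.2⟩
    have h2 := hC _ (Metric.ball_subset_closedBall h1)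
    have h3 : ‖(s : ℂ)‖ ≤ 1 := by
      rw [Complex.norm_real, Real.norm_of_nonneg hs.1.le]
      exact hs.2
    have h4 : ‖(s : ℂ)‖ ^ n ≤ 1 := pow_le_one₀ (norm_nonneg _) h3
    rw [norm_mul, norm_mul, norm_pow]
    have hC0 := (norm_nonneg _).trans h2
    calc _ ≤ 1 * (C * 1) := by gcongr
      _ = C := by ring
  · exact intervalIntegrable_const
  · refine Eventually.of_forall fun s hs z hz => ?_
    rw [Set.uIoc_of_le zero_le_one] at hs
    have h1 := hsub (Metric.ball_subset_closedBall (ofReal_mul_mem_ball hz ⟨hs.1.le, hs.2⟩))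
    have h2 := (hg.differentiableAt (Metric.isOpen_ball.mem_nhds h1)).hasDerivAt
    have h3 : HasDerivAt (fun z : ℂ => (s : ℂ) * z) s z := by
      simpa using (hasDerivAt_id z).const_mul (s : ℂ)
    exact (h2.comp z h3).const_mul _

section Fuchsian

variable {ι : Type*}

/-- The integral operator of the singular initial value problem
`x Y' = -λ (Y - Y₀) + x f(x, Y)`, `Y(0) = Y₀`, along the segment from `0` to `z`. -/
def fuchsStep (lam : ι → ℕ) (Y₀ : ι → ℂ) (f : ℂ × (ι → ℂ) → ι → ℂ) (z : ℂ) (p : ℝ → ι → ℂ) :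
    ι → ℂ :=
  fun i => Y₀ i + z * ∫ s in (0 : ℝ)..1, (s : ℂ) ^ lam i * f (s * z, p s) i

variable {lam : ι → ℕ} {Y₀ : ι → ℂ} {f : ℂ × (ι → ℂ) → ι → ℂ} {ρ R K M : ℝ}

/-- Picard iterates of the singular initial value problem. -/
def fuchsIter (lam : ι → ℕ) (Y₀ : ι → ℂ) (f : ℂ × (ι → ℂ) → ι → ℂ) : ℕ → ℂ → ι → ℂ
  | 0 => fun _ => Y₀
  | n + 1 => fun z => fuchsStep lam Y₀ f z fun s => fuchsIter lam Y₀ f n (s * z)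

theorem fuchsIter_zero_right (n : ℕ) : fuchsIter lam Y₀ f n 0 = Y₀ := by
  cases n with
  | zero => rfl
  | succ n => funext i; simp [fuchsIter, fuchsStep]

variable [Fintype ι]

theorem continuousOn_fuchsIntegrand {z : ℂ} {p : ℝ → ι → ℂ}
    (hf : ContinuousOn f (Metric.ball 0 ρ ×ˢ Metric.closedBall Y₀ R))
    (hz : z ∈ Metric.ball (0 : ℂ) ρ) (hp : ContinuousOn p (Set.Icc 0 1))
    (hpR : ∀ s ∈ Set.Icc (0 : ℝ) 1, p s ∈ Metric.closedBall Y₀ R) (i : ι) (n : ℕ) :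
    ContinuousOn (fun s : ℝ => (s : ℂ) ^ n * f (s * z, p s) i) (Set.Icc 0 1) := by
  have h1 : ContinuousOn (fun s : ℝ => f (s * z, p s)) (Set.Icc 0 1) :=
    hf.comp (ContinuousOn.prodMk (by fun_prop) hp)
      fun s hs => ⟨ofReal_mul_mem_ball hz hs, hpR s hs⟩
  exact ContinuousOn.mul (by fun_prop) (continuousOn_pi.1 h1 i)

theorem norm_ofReal_pow_mul_le {s : ℝ} (hs : s ∈ Set.Icc (0 : ℝ) 1) (n : ℕ) (w : ℂ) :
    ‖(s : ℂ) ^ n * w‖ ≤ ‖w‖ := by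
  rw [norm_mul, norm_pow, Complex.norm_real, Real.norm_of_nonneg hs.1]
  have : s ^ n ≤ 1 := pow_le_one₀ hs.1 hs.2
  nlinarith [norm_nonneg w]

theorem fuchsStep_mem_closedBall {z : ℂ} {p : ℝ → ι → ℂ} (hR : 0 ≤ R) (hρM : ρ * M ≤ R)
    (hM : ∀ z ∈ Metric.ball (0 : ℂ) ρ, ∀ y ∈ Metric.closedBall Y₀ R, ‖f (z, y)‖ ≤ M)
    (hz : z ∈ Metric.ball (0 : ℂ) ρ)
    (hpR : ∀ s ∈ Set.Icc (0 : ℝ) 1, p s ∈ Metric.closedBall Y₀ R) :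
    fuchsStep lam Y₀ f z p ∈ Metric.closedBall Y₀ R := by
  rw [mem_closedBall_iff_norm, pi_norm_le_iff_of_nonneg hR]
  intro i
  have h1 : ‖∫ s in (0 : ℝ)..1, (s : ℂ) ^ lam i * f (s * z, p s) i‖ ≤ M * |(1 : ℝ) - 0| := by
    refine intervalIntegral.norm_integral_le_of_norm_le_const fun s hs => ?_
    rw [Set.uIoc_of_le zero_le_one] at hs
    have hs' : s ∈ Set.Icc (0 : ℝ) 1 := ⟨hs.1.le, hs.2⟩
    exact ((norm_ofReal_pow_mul_le hs' _ _).trans (norm_le_pi_norm _ i)).trans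
      (hM _ (ofReal_mul_mem_ball hz hs') _ (hpR s hs'))
  simp only [fuchsStep, Pi.sub_apply, add_sub_cancel_left, norm_mul]
  rw [sub_zero, abs_one, mul_one] at h1
  rw [mem_ball_zero_iff] at hz
  have hM0 := (norm_nonneg _).trans h1
  have hρ0 : 0 ≤ ρ := (norm_nonneg z).trans hz.le
  calc _ ≤ ρ * M := by gcongr
    _ ≤ R := hρM

/-- The kernel `s ^ λ` is at most `1` on `[0, 1]` because the exponents are nonnegative, so the
contraction factor is the Lipschitz constant times the radius of the disc. -/
theorem norm_fuchsStep_sub_le {z : ℂ} {p q : ℝ → ι → ℂ} {δ : ℝ} (hK0 : 0 ≤ K) (hρK : ρ * K ≤ 1 / 2)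
    (hf : ContinuousOn f (Metric.ball 0 ρ ×ˢ Metric.closedBall Y₀ R))
    (hK : ∀ z ∈ Metric.ball (0 : ℂ) ρ, ∀ y ∈ Metric.closedBall Y₀ R,
      ∀ y' ∈ Metric.closedBall Y₀ R, ‖f (z, y) - f (z, y')‖ ≤ K * ‖y - y'‖)
    (hz : z ∈ Metric.ball (0 : ℂ) ρ)
    (hp : ContinuousOn p (Set.Icc 0 1)) (hq : ContinuousOn q (Set.Icc 0 1))
    (hpR : ∀ s ∈ Set.Icc (0 : ℝ) 1, p s ∈ Metric.closedBall Y₀ R)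
    (hqR : ∀ s ∈ Set.Icc (0 : ℝ) 1, q s ∈ Metric.closedBall Y₀ R)
    (hδ : ∀ s ∈ Set.Icc (0 : ℝ) 1, ‖p s - q s‖ ≤ δ) :
    ‖fuchsStep lam Y₀ f z p - fuchsStep lam Y₀ f z q‖ ≤ δ / 2 := by
  have hδ0 : 0 ≤ δ := (norm_nonneg _).trans (hδ 0 (by simp))
  rw [pi_norm_le_iff_of_nonneg (by positivity)]
  intro i
  have hi1 : IntervalIntegrable (fun s : ℝ => (s : ℂ) ^ lam i * f (s * z, p s) i)
      MeasureTheory.volume 0 1 := by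
    refine ContinuousOn.intervalIntegrable ?_
    rw [Set.uIcc_of_le zero_le_one]
    exact continuousOn_fuchsIntegrand hf hz hp hpR i _
  have hi2 : IntervalIntegrable (fun s : ℝ => (s : ℂ) ^ lam i * f (s * z, q s) i)
      MeasureTheory.volume 0 1 := by
    refine ContinuousOn.intervalIntegrable ?_
    rw [Set.uIcc_of_le zero_le_one]
    exact continuousOn_fuchsIntegrand hf hz hq hqR i _
  have e : (fuchsStep lam Y₀ f z p - fuchsStep lam Y₀ f z q) i =
      z * ∫ s in (0 : ℝ)..1, (s : ℂ) ^ lam i * (f (s * z, p s) - f (s * z, q s)) i := by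
    simp only [fuchsStep, Pi.sub_apply, mul_sub]
    rw [intervalIntegral.integral_sub hi1 hi2]
    ring
  have h1 : ‖∫ s in (0 : ℝ)..1, (s : ℂ) ^ lam i * (f (s * z, p s) - f (s * z, q s)) i‖ ≤
      K * δ * |(1 : ℝ) - 0| := by
    refine intervalIntegral.norm_integral_le_of_norm_le_const fun s hs => ?_
    rw [Set.uIoc_of_le zero_le_one] at hs
    have hs' : s ∈ Set.Icc (0 : ℝ) 1 := ⟨hs.1.le, hs.2⟩
    refine ((norm_ofReal_pow_mul_le hs' _ _).trans (norm_le_pi_norm _ i)).trans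
      ((hK _ (ofReal_mul_mem_ball hz hs') _ (hpR s hs') _ (hqR s hs')).trans ?_)
    exact mul_le_mul_of_nonneg_left (hδ s hs') hK0
  rw [sub_zero, abs_one, mul_one] at h1
  rw [mem_ball_zero_iff] at hz
  rw [e, norm_mul]
  have hρ0 : 0 ≤ ρ := (norm_nonneg z).trans hz.le
  calc _ ≤ ρ * (K * δ) := by gcongr
    _ = ρ * K * δ := by ring
    _ ≤ 1 / 2 * δ := by gcongr
    _ = δ / 2 := by ring

/-- A solution of the singular initial value problem is a fixed point of the integral operator. -/
theorem eq_fuchsStep {Y : ℝ → ι → ℂ} {x : ℝ} (hx : 0 < x) (hxρ : x < ρ)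
    (hf : ContinuousOn f (Metric.ball 0 ρ ×ˢ Metric.closedBall Y₀ R))
    (hY0 : Y 0 = Y₀) (hYc : ContinuousOn Y (Set.Icc 0 x))
    (hYR : ∀ t ∈ Set.Icc 0 x, Y t ∈ Metric.closedBall Y₀ R)
    (hY : ∀ t ∈ Set.Ioo 0 x, ∀ i, HasDerivAt (fun t => Y t i)
      (-(lam i : ℂ) * (Y t i - Y₀ i) / t + f (t, Y t) i) t) :
    Y x = fuchsStep lam Y₀ f x fun s => Y (s * x) := by
  have hz : (x : ℂ) ∈ Metric.ball (0 : ℂ) ρ := by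
    rw [mem_ball_zero_iff, Complex.norm_real, Real.norm_of_nonneg hx.le]
    exact hxρ
  have hmem : ∀ s ∈ Set.Icc (0 : ℝ) 1, s * x ∈ Set.Icc 0 x := fun s hs =>
    ⟨mul_nonneg hs.1 hx.le, by nlinarith [hs.2]⟩
  have hp : ContinuousOn (fun s : ℝ => Y (s * x)) (Set.Icc 0 1) :=
    hYc.comp (by fun_prop) hmem
  funext i
  -- The integrating factor `s ^ λ` removes the singular term. The boundary term at `s = 0` vanishes
  -- even for `λ = 0`, thanks to `Y 0 = Y₀`.
  have key := intervalIntegral.integral_eq_sub_of_hasDerivAt_of_le (a := 0) (b := 1) zero_le_one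
    (f := fun s : ℝ => (s : ℂ) ^ lam i * (Y (s * x) i - Y₀ i))
    (f' := fun s : ℝ => x * ((s : ℂ) ^ lam i * f (s * x, Y (s * x)) i)) ?_ ?_ ?_
  · rw [intervalIntegral.integral_const_mul] at key
    simp only [fuchsStep]
    rw [key]
    simp [hY0]
  · exact ContinuousOn.mul (by fun_prop) ((continuousOn_pi.1 hp i).sub continuousOn_const)
  · intro s hs
    have hsx : s * x ∈ Set.Ioo 0 x := ⟨mul_pos hs.1 hx, by nlinarith [hs.2]⟩
    have h1 := (hY _ hsx i).scomp s ((hasDerivAt_id s).mul_const x)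
    have h2 : HasDerivAt (fun s : ℝ => (s : ℂ) ^ lam i) ((lam i : ℂ) * (s : ℂ) ^ (lam i - 1)) s :=
      (hasDerivAt_pow (lam i) (s : ℂ)).comp_ofReal
    refine (h2.fun_mul (h1.sub_const (Y₀ i))).congr_deriv ?_
    have hs0 : (s : ℂ) ≠ 0 := by exact_mod_cast hs.1.ne'
    have hx0 : (x : ℂ) ≠ 0 := by exact_mod_cast hx.ne'
    simp only [Function.comp_apply, id, one_mul, Complex.real_smul, Complex.ofReal_mul]
    rcases Nat.eq_zero_or_pos (lam i) with h0 | h0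
    · simp [h0]
    · obtain ⟨n, hn⟩ : ∃ n, lam i = n + 1 := ⟨lam i - 1, by omega⟩
      rw [hn]
      simp only [Nat.add_sub_cancel]
      push_cast
      field_simp
      ring
  · refine ContinuousOn.intervalIntegrable ?_
    rw [Set.uIcc_of_le zero_le_one]
    exact continuousOn_const.mul (continuousOn_fuchsIntegrand hf hz hp
      (fun s hs => hYR _ (hmem s hs)) i _)

/-- A continuous solution of a Fuchsian system `x Y' = -λ (Y - Y₀) + x f(x, Y)` with `λ ≥ 0` and
analytic right-hand side is analytic up to the singular point. -/
theorem exists_analyticAt_of_fuchsian {Y : ℝ → ι → ℂ} (hf : AnalyticAt ℂ f (0, Y₀))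
    (hlim : Tendsto Y (𝓝[>] 0) (𝓝 Y₀))
    (hY : ∀ᶠ t in 𝓝[>] (0 : ℝ), ∀ i, HasDerivAt (fun t => Y t i)
      (-(lam i : ℂ) * (Y t i - Y₀ i) / t + f (t, Y t) i) t) :
    ∃ H : ℂ → ι → ℂ, AnalyticAt ℂ H 0 ∧ H 0 = Y₀ ∧ ∀ᶠ t in 𝓝[>] (0 : ℝ), Y t = H t := by
  classical
  obtain ⟨K', t, ht, hLip⟩ := (hf.contDiffAt (n := 1)).exists_lipschitzOnWith
  have hcont : ∀ᶠ y in 𝓝 ((0 : ℂ), Y₀), ‖f y‖ ≤ ‖f (0, Y₀)‖ + 1 :=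
    hf.continuousAt.norm.eventually_le_const (by linarith)
  obtain ⟨ε, hε, hball⟩ := Metric.eventually_nhds_iff_ball.1
    ((hf.eventually_analyticAt.and hcont).and ht)
  set K : ℝ := NNReal.toReal K' with hKdef
  set M : ℝ := ‖f (0, Y₀)‖ + 1 with hMdef
  have hK0 : 0 ≤ K := K'.2
  have hM0 : 0 < M := by positivity
  set R := ε / 2 with hRdef
  have hR : 0 < R := by positivity
  -- `ρ M ≤ R` keeps the iterates in the ball around `Y₀`, and `ρ K ≤ 1/2` makes the Picard operator
  -- contract by one half.
  obtain ⟨ρ, hρ, hρε, hρM, hρK⟩ : ∃ ρ > 0, ρ < ε ∧ ρ * M ≤ R ∧ ρ * K ≤ 1 / 2 := by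
    refine ⟨min (ε / 2) (min (R / M) (1 / (2 * (K + 1)))), by positivity, ?_, ?_, ?_⟩
    · exact (min_le_left _ _).trans_lt (by linarith)
    · have : min (ε / 2) (min (R / M) (1 / (2 * (K + 1)))) ≤ R / M :=
        (min_le_right _ _).trans (min_le_left _ _)
      calc _ ≤ R / M * M := by gcongr
        _ = R := by field_simp
    · have : min (ε / 2) (min (R / M) (1 / (2 * (K + 1)))) ≤ 1 / (2 * (K + 1)) :=
        (min_le_right _ _).trans (min_le_right _ _)
      calc _ ≤ 1 / (2 * (K + 1)) * K := by gcongr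
        _ ≤ 1 / 2 := by
          rw [div_mul_eq_mul_div, div_le_div_iff₀ (by positivity) (by norm_num)]
          linarith
  have hmem : ∀ z ∈ Metric.ball (0 : ℂ) ρ, ∀ y ∈ Metric.closedBall Y₀ R,
      (z, y) ∈ Metric.ball ((0 : ℂ), Y₀) ε := by
    intro z hz y hy
    rw [Metric.mem_ball, Prod.dist_eq, max_lt_iff]
    rw [Metric.mem_ball] at hz
    rw [Metric.mem_closedBall] at hy
    exact ⟨hz.trans hρε, by dsimp only; linarith⟩
  have hfd : ∀ z ∈ Metric.ball (0 : ℂ) ρ, ∀ y ∈ Metric.closedBall Y₀ R,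
      DifferentiableAt ℂ f (z, y) := fun z hz y hy =>
    (hball _ (hmem z hz y hy)).1.1.differentiableAt
  have hfc : ContinuousOn f (Metric.ball 0 ρ ×ˢ Metric.closedBall Y₀ R) := fun w hw =>
    (hfd w.1 hw.1 w.2 hw.2).continuousAt.continuousWithinAt
  have hM : ∀ z ∈ Metric.ball (0 : ℂ) ρ, ∀ y ∈ Metric.closedBall Y₀ R, ‖f (z, y)‖ ≤ M :=
    fun z hz y hy => (hball _ (hmem z hz y hy)).1.2
  have hK : ∀ z ∈ Metric.ball (0 : ℂ) ρ, ∀ y ∈ Metric.closedBall Y₀ R,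
      ∀ y' ∈ Metric.closedBall Y₀ R, ‖f (z, y) - f (z, y')‖ ≤ K * ‖y - y'‖ := by
    intro z hz y hy y' hy'
    have := hLip.dist_le_mul _ (hball _ (hmem z hz y hy)).2 _ (hball _ (hmem z hz y' hy')).2
    rw [Prod.dist_eq] at this
    simpa [dist_eq_norm] using this
  have hIter : ∀ n, (∀ z ∈ Metric.ball (0 : ℂ) ρ,
      fuchsIter lam Y₀ f n z ∈ Metric.closedBall Y₀ R) ∧
      DifferentiableOn ℂ (fuchsIter lam Y₀ f n) (Metric.ball 0 ρ) := by
    intro n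
    induction n with
    | zero => exact ⟨fun z _ => Metric.mem_closedBall_self hR.le, differentiableOn_const _⟩
    | succ n ih =>
      refine ⟨fun z hz => fuchsStep_mem_closedBall hR.le hρM hM hz
        fun s hs => ih.1 _ (ofReal_mul_mem_ball hz hs), ?_⟩
      rw [differentiableOn_pi]
      intro i
      have hg : DifferentiableOn ℂ (fun z => f (z, fuchsIter lam Y₀ f n z) i)
          (Metric.ball 0 ρ) := by
        intro z hz
        have h1 := hfd z hz _ (ih.1 z hz)
        have h2 : DifferentiableWithinAt ℂ (fun z => f (z, fuchsIter lam Y₀ f n z))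
            (Metric.ball 0 ρ) z :=
          h1.comp_differentiableWithinAt z (differentiableWithinAt_id.prodMk (ih.2 z hz))
        exact differentiableWithinAt_pi.1 h2 i
      exact (differentiableOn_id.mul (differentiableOn_integral_pow_mul hg (lam i))).const_add _
  have hpath : ∀ n, ∀ z ∈ Metric.ball (0 : ℂ) ρ,
      ContinuousOn (fun s : ℝ => fuchsIter lam Y₀ f n (s * z)) (Set.Icc 0 1) := fun n z hz =>
    (hIter n).2.continuousOn.comp (by fun_prop) fun s hs => ofReal_mul_mem_ball hz hs
  have hdist : ∀ n, ∀ z ∈ Metric.ball (0 : ℂ) ρ,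
      dist (fuchsIter lam Y₀ f n z) (fuchsIter lam Y₀ f (n + 1) z) ≤ R * (1 / 2) ^ n := by
    intro n
    induction n with
    | zero =>
      intro z hz
      rw [dist_comm, pow_zero, mul_one]
      exact (hIter 1).1 z hz
    | succ n ih =>
      intro z hz
      rw [dist_eq_norm]
      refine (norm_fuchsStep_sub_le hK0 hρK hfc hK hz (hpath n z hz) (hpath (n + 1) z hz)
        (fun s hs => (hIter n).1 _ (ofReal_mul_mem_ball hz hs))
        (fun s hs => (hIter (n + 1)).1 _ (ofReal_mul_mem_ball hz hs))
        (δ := R * (1 / 2) ^ n) fun s hs => ?_).trans (le_of_eq (by ring))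
      rw [← dist_eq_norm]
      exact ih _ (ofReal_mul_mem_ball hz hs)
  have hex : ∀ z, ∃ y, z ∈ Metric.ball (0 : ℂ) ρ →
      Tendsto (fun n => fuchsIter lam Y₀ f n z) atTop (𝓝 y) := by
    intro z
    by_cases hz : z ∈ Metric.ball (0 : ℂ) ρ
    · obtain ⟨y, hy⟩ := cauchySeq_tendsto_of_complete
        (cauchySeq_of_le_geometric (1 / 2) R (by norm_num) fun n => hdist n z hz)
      exact ⟨y, fun _ => hy⟩
    · exact ⟨0, fun h => absurd h hz⟩
  choose H hH using hex
  have hunif : TendstoUniformlyOn (fuchsIter lam Y₀ f) H atTop (Metric.ball 0 ρ) := by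
    rw [Metric.tendstoUniformlyOn_iff]
    intro η hη
    have h1 : Tendsto (fun n : ℕ => R * (1 / 2 : ℝ) ^ n / (1 - 1 / 2)) atTop (𝓝 0) := by
      have := ((tendsto_pow_atTop_nhds_zero_of_lt_one (by norm_num : (0 : ℝ) ≤ 1 / 2)
        (by norm_num)).const_mul R).div_const (1 - 1 / 2 : ℝ)
      simpa using this
    filter_upwards [h1.eventually_lt_const hη] with n hn z hz
    rw [dist_comm]
    exact (dist_le_of_le_geometric_of_tendsto (1 / 2) R (by norm_num)
      (fun n => hdist n z hz) (hH z hz) n).trans_lt hn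
  have hdiff : DifferentiableOn ℂ H (Metric.ball 0 ρ) :=
    hunif.tendstoLocallyUniformlyOn.differentiableOn
      (Eventually.of_forall fun n => (hIter n).2) Metric.isOpen_ball
  refine ⟨H, hdiff.analyticAt (Metric.isOpen_ball.mem_nhds (Metric.mem_ball_self hρ)), ?_, ?_⟩
  · refine tendsto_nhds_unique (hH 0 (Metric.mem_ball_self hρ)) ?_
    simp only [fuchsIter_zero_right]
    exact tendsto_const_nhds
  · have hYball : ∀ᶠ t in 𝓝[>] (0 : ℝ), Y t ∈ Metric.closedBall Y₀ R :=
      hlim (Metric.closedBall_mem_nhds Y₀ hR)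
    obtain ⟨x₀, hx₀, hx₀'⟩ := mem_nhdsGT_iff_exists_Ioo_subset.1 (hYball.and hY)
    have hx₀pos : (0 : ℝ) < x₀ := hx₀
    set Z : ℝ → ι → ℂ := Function.update Y 0 Y₀ with hZ
    have hZY : ∀ t, 0 < t → Z t = Y t := fun t ht => Function.update_of_ne ht.ne' _ _
    have hZ0 : Z 0 = Y₀ := Function.update_self _ _ _
    have hZd : ∀ t ∈ Set.Ioo 0 x₀, ∀ i, HasDerivAt (fun t => Z t i)
        (-(lam i : ℂ) * (Z t i - Y₀ i) / t + f (t, Z t) i) t := by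
      intro t ht i
      rw [hZY t ht.1]
      refine ((hx₀' ht).2 i).congr_of_eventuallyEq ?_
      filter_upwards [Ioi_mem_nhds ht.1] with s hs
      rw [hZY s hs]
    have hZR : ∀ t ∈ Set.Ico 0 x₀, Z t ∈ Metric.closedBall Y₀ R := by
      intro t ht
      rcases ht.1.eq_or_lt with h0 | h0
      · rw [← h0, hZ0]
        exact Metric.mem_closedBall_self hR.le
      · rw [hZY t h0]
        exact (hx₀' ⟨h0, ht.2⟩).1
    have hZc : ContinuousOn Z (Set.Ico 0 x₀) := by
      intro t ht
      rcases ht.1.eq_or_lt with h0 | h0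
      · rw [← h0]
        have : ContinuousWithinAt Z (Set.Ioi 0) 0 := by
          rw [ContinuousWithinAt, hZ0]
          refine hlim.congr' ?_
          filter_upwards [self_mem_nhdsWithin] with s hs using (hZY s hs).symm
        exact (continuousWithinAt_Ioi_iff_Ici.1 this).mono fun s hs => hs.1
      · exact (continuousAt_pi.2 fun i => (hZd t ⟨h0, ht.2⟩ i).continuousAt).continuousWithinAt
    -- The given real solution is a fixed point of the operator along the segment `[0, x]`, so each
    -- iteration halves its distance to the complex iterates and identifies it with `H`.
    have hcomp : ∀ n, ∀ x, 0 ≤ x → x < x₀ → x < ρ →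
        ‖Z x - fuchsIter lam Y₀ f n x‖ ≤ R * (1 / 2) ^ n := by
      intro n
      induction n with
      | zero =>
        intro x h0 h1 _
        have := hZR x ⟨h0, h1⟩
        rw [mem_closedBall_iff_norm] at this
        simpa [fuchsIter] using this
      | succ n ih =>
        intro x h0 h1 h2
        rcases h0.eq_or_lt with h0 | h0
        · rw [← h0, hZ0, Complex.ofReal_zero, fuchsIter_zero_right, sub_self, norm_zero]
          positivity
        · have hsub : Set.Icc 0 x ⊆ Set.Ico 0 x₀ := fun t ht => ⟨ht.1, ht.2.trans_lt h1⟩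
          have hz : (x : ℂ) ∈ Metric.ball (0 : ℂ) ρ := by
            rw [mem_ball_zero_iff, Complex.norm_real, Real.norm_of_nonneg h0.le]
            exact h2
          have hmem' : ∀ s ∈ Set.Icc (0 : ℝ) 1, s * x ∈ Set.Icc 0 x := fun s hs =>
            ⟨mul_nonneg hs.1 h0.le, by nlinarith [hs.2]⟩
          rw [eq_fuchsStep h0 h2 hfc hZ0 (hZc.mono hsub) (fun t ht => hZR t (hsub ht))
            (fun t ht => hZd t ⟨ht.1, ht.2.trans h1⟩)]
          refine (norm_fuchsStep_sub_le hK0 hρK hfc hK hz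
            ((hZc.mono hsub).comp (by fun_prop) hmem') (hpath n x hz)
            (fun s hs => hZR _ (hsub (hmem' s hs)))
            (fun s hs => (hIter n).1 _ (ofReal_mul_mem_ball hz hs))
            (δ := R * (1 / 2) ^ n) fun s hs => ?_).trans (le_of_eq (by ring))
          have h3 := hmem' s hs
          have := ih (s * x) h3.1 (h3.2.trans_lt h1) (h3.2.trans_lt h2)
          rwa [Complex.ofReal_mul] at this
    filter_upwards [Ioo_mem_nhdsGT (lt_min hx₀pos hρ)] with x hx
    have hz : (x : ℂ) ∈ Metric.ball (0 : ℂ) ρ := by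
      rw [mem_ball_zero_iff, Complex.norm_real, Real.norm_of_nonneg hx.1.le]
      exact hx.2.trans_le (min_le_right _ _)
    rw [← hZY x hx.1]
    refine tendsto_nhds_unique ?_ (hH x hz)
    rw [tendsto_iff_norm_sub_tendsto_zero]
    have h1 : Tendsto (fun n : ℕ => R * (1 / 2 : ℝ) ^ n) atTop (𝓝 0) := by
      have := (tendsto_pow_atTop_nhds_zero_of_lt_one (by norm_num : (0 : ℝ) ≤ 1 / 2)
        (by norm_num)).const_mul R
      simpa using this
    refine squeeze_zero (fun _ => norm_nonneg _) (fun n => ?_) h1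
    rw [norm_sub_rev]
    exact hcomp n x hx.1.le (hx.2.trans_le (min_le_left _ _)) (hx.2.trans_le (min_le_right _ _))

end Fuchsian

end

/-! ### Power law decay towards the vacuum -/

noncomputable section

/-- If `J` tends to zero with `J' = -Z` and `Z' ≤ b Z - c J` where `b → 1`, then `J` decays
exponentially. -/
theorem exists_deriv_le_neg_mul_of_tendsto_zero {J Z Z' b : ℝ → ℝ} {c : ℝ} (hc : 0 < c)
    (hJ : ∀ᶠ t in atTop, HasDerivAt J (-Z t) t ∧ 0 ≤ J t)
    (hZ : ∀ᶠ t in atTop, HasDerivAt Z (Z' t) t ∧ Z' t ≤ b t * Z t - c * J t)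
    (hb : Tendsto b atTop (𝓝 1)) (hJ0 : Tendsto J atTop (𝓝 0)) (hZ0 : Tendsto Z atTop (𝓝 0)) :
    ∃ δ > 0, ∀ᶠ t in atTop, δ * J t ≤ Z t := by
  set δ := min 1 (c / 3) with hδ
  have hδ0 : 0 < δ := by positivity
  have hδ1 : δ ≤ 1 := min_le_left _ _
  have hδc : 3 * δ ≤ c := by
    have : δ ≤ c / 3 := min_le_right _ _
    linarith
  refine ⟨δ, hδ0, ?_⟩
  obtain ⟨T, hT⟩ := eventually_atTop.1 (hJ.and (hZ.and
    ((hb.eventually_le_const (by norm_num : (1 : ℝ) < 2)).and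
      (hb.eventually_const_le (by norm_num : (0 : ℝ) < 1)))))
  filter_upwards [eventually_ge_atTop T] with t₀ ht₀
  by_contra! hneg
  -- If `Y` were negative at `t₀`, it could not return to the level `Y t₀ / 2`: there `Y' ≤ (b + δ)
  -- Y t₀ / 2 + ((b + δ) δ - c) J < 0`, since `b + δ ≤ 3` and `3 δ ≤ c`. This contradicts `Y → 0`.
  set Y : ℝ → ℝ := fun t => Z t - δ * J t with hY
  have hY0 : Tendsto Y atTop (𝓝 0) := by simpa using hZ0.sub (hJ0.const_mul δ)
  have hYt : Y t₀ < 0 := by simp only [hY]; linarith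
  have hpos := pos_of_hasDerivAt_pos_at_first_zero (f := fun t => Y t₀ / 2 - Y t)
    (f' := fun t => -(Z' t - δ * -Z t)) (t₀ := t₀)
    (fun t ht => by
      obtain ⟨⟨h1, -⟩, ⟨h2, -⟩, -⟩ := hT t (ht₀.trans ht)
      exact (h2.sub (h1.const_mul δ)).const_sub _) (by linarith) (fun t ht _ h0 => by
      obtain ⟨⟨-, hJt⟩, ⟨-, h2⟩, hb2, hb0⟩ := hT t (ht₀.trans ht.le)
      have e1 : Z t = Y t₀ / 2 + δ * J t := by
        have : Z t - δ * J t = Y t := rfl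
        linarith
      have e2 : (b t + δ) * Z t ≤ (b t + δ) * (Y t₀ / 2) + c * J t := by
        rw [e1]
        have e3 : (b t + δ) * δ * J t ≤ 3 * δ * J t := by
          gcongr
          linarith
        have e4 : 3 * δ * J t ≤ c * J t := by gcongr
        linarith
      have e5 : (b t + δ) * (Y t₀ / 2) < 0 := mul_neg_of_pos_of_neg (by linarith) (by linarith)
      linarith)
  have hle : (0 : ℝ) ≤ Y t₀ / 2 := by
    refine le_of_tendsto hY0 ?_
    filter_upwards [eventually_ge_atTop t₀] with t ht
    linarith [hpos t ht]
  linarith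

/-- Split `w (w - a) = (w² - a²)/2 + (w - a)²/2`. The first half pairs the force with the deviation
of the squares and sums by parts to the potential; the second is of higher order near the vacuum. -/
theorem sum_gaugeFactor_mul_dev {N : ℕ} (hN : 1 ≤ N) {w a : ℕ → ℝ} (h0 : w 0 = 0)
    (hw : w N = 0) (ha : ∀ j ≤ N, a j ^ 2 = vacuumSq N j) :
    ∑ j ∈ Finset.Ico 1 N, gaugeFactor w j * w j * (w j - a j) =
      -(1 / 4) * gaugePotential N w
        + 1 / 2 * ∑ j ∈ Finset.Ico 1 N, gaugeFactor w j * (w j - a j) ^ 2 := by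
  have e1 := sum_mul_second_diff hN (vacuumDev N w) (vacuumDev N w) (vacuumDev_zero h0)
    (vacuumDev_self hw)
  have e2 : gaugePotential N w = ∑ j ∈ Finset.Icc 1 N,
      (vacuumDev N w j - vacuumDev N w (j - 1)) * (vacuumDev N w j - vacuumDev N w (j - 1)) := by
    rw [gaugePotential_eq_vacuumDev]
    exact Finset.sum_congr rfl fun _ _ => by ring
  rw [e2, ← e1, Finset.mul_sum, Finset.mul_sum, ← Finset.sum_add_distrib]
  refine Finset.sum_congr rfl fun j hj => ?_
  rw [Finset.mem_Ico] at hj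
  have e3 : vacuumDev N w j = w j ^ 2 - a j ^ 2 := by rw [ha j hj.2.le, vacuumDev]
  have e4 : 2 * vacuumDev N w j - vacuumDev N w (j - 1) - vacuumDev N w (j + 1) =
      -2 * gaugeFactor w j := by
    rw [gaugeFactor_eq_vacuumDev N w hj.1]
    ring
  rw [e4, e3]
  ring

namespace IsExteriorSolution

variable {N : ℕ} {r Ψ κ S : ℝ → ℝ} {ω U : ℕ → ℝ → ℝ} {τ : ℝ} {a : ℕ → ℝ}

/-- The vacuum is a nondegenerate minimum of the potential: eventually `(ω_j + a_j)² ≥ 1`, so the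
Poincaré inequality bounds `P` below by `N⁻² ∑ (ω_j - a_j)²`. As `F_j → 0`, the remainder takes away
at most half of the resulting gain. -/
theorem eventually_sum_gaugeFactor_mul_dev_le (h : IsExteriorSolution N r Ψ κ S ω U)
    (hω : ∀ i ≤ N, Tendsto (ω i) atTop (𝓝 (a i))) (ha : ∀ j ≤ N, a j ^ 2 = vacuumSq N j) :
    ∀ᶠ t in atTop, ∑ j ∈ Finset.Ico 1 N, gaugeFactor (fun i => ω i t) j * ω j t * (ω j t - a j) ≤
      -(1 / (8 * (N : ℝ) ^ 2)) * ∑ j ∈ Finset.Ico 1 N, (ω j t - a j) ^ 2 := by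
  have hN : (0 : ℝ) < N := by exact_mod_cast h.one_le_N
  have hsum : ∀ᶠ t in atTop, ∀ j ∈ Finset.Ico 1 N, 1 ≤ (ω j t + a j) ^ 2 := by
    rw [Filter.eventually_all_finset]
    intro j hj
    rw [Finset.mem_Ico] at hj
    have h1 := ((hω j hj.2.le).add_const (a j)).pow 2
    refine h1.eventually_const_le ?_
    have := one_le_vacuumSq hj.1 hj.2
    rw [← ha j hj.2.le] at this
    nlinarith
  have hF : ∀ᶠ t in atTop, ∀ j ∈ Finset.Ico 1 N,
      gaugeFactor (fun i => ω i t) j ≤ 1 / (4 * (N : ℝ) ^ 2) := by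
    rw [Filter.eventually_all_finset]
    intro j hj
    rw [Finset.mem_Ico] at hj
    refine (tendsto_gaugeFactor hj.2 hω).eventually_le_const ?_
    have e : gaugeFactor a j = 0 := by
      rw [gaugeFactor_eq_vacuumDev N a hj.1]
      simp only [vacuumDev]
      rw [ha j hj.2.le, ha (j - 1) (by omega), ha (j + 1) (by omega)]
      ring
    rw [e]
    positivity
  filter_upwards [hsum, hF, eventually_gt_atTop 0] with t h1 h2 ht
  rw [sum_gaugeFactor_mul_dev h.one_le_N (h.omega_zero t ht) (h.omega_N t ht) ha]
  have h3 := sum_sq_le_mul_sum_sq_diff (N := N) (vacuumDev N fun j => ω j t)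
    (vacuumDev_zero (h.omega_zero t ht))
  rw [← gaugePotential_eq_vacuumDev] at h3
  have h4 : ∑ j ∈ Finset.Ico 1 N, (ω j t - a j) ^ 2 ≤
      ∑ j ∈ Finset.Ico 1 N, vacuumDev N (fun j => ω j t) j ^ 2 := by
    refine Finset.sum_le_sum fun j hj => ?_
    have e : vacuumDev N (fun j => ω j t) j = (ω j t - a j) * (ω j t + a j) := by
      rw [vacuumDev, ← ha j (Finset.mem_Ico.1 hj).2.le]
      ring
    rw [e, mul_pow]
    nlinarith [h1 j hj, sq_nonneg (ω j t - a j)]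
  have h5 : ∑ j ∈ Finset.Ico 1 N, gaugeFactor (fun i => ω i t) j * (ω j t - a j) ^ 2 ≤
      1 / (4 * (N : ℝ) ^ 2) * ∑ j ∈ Finset.Ico 1 N, (ω j t - a j) ^ 2 := by
    rw [Finset.mul_sum]
    exact Finset.sum_le_sum fun j hj => mul_le_mul_of_nonneg_right (h2 j hj) (sq_nonneg _)
  have h6 : 1 / (4 * (N : ℝ) ^ 2) * ∑ j ∈ Finset.Ico 1 N, (ω j t - a j) ^ 2 ≤
      1 / 4 * gaugePotential N (fun j => ω j t) := by
    rw [div_mul_eq_mul_div, div_le_iff₀ (by positivity)]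
    linarith [h4.trans h3]
  have e : 1 / (8 * (N : ℝ) ^ 2) = 1 / (4 * (N : ℝ) ^ 2) - 1 / 2 * (1 / (4 * (N : ℝ) ^ 2)) := by
    field_simp
    norm_num
  rw [e]
  linarith

/-- Power law decay of the deviation from the vacuum values. -/
theorem exists_sum_dev_le (h : IsExteriorSolution N r Ψ κ S ω U)
    (hω : ∀ i ≤ N, Tendsto (ω i) atTop (𝓝 (a i))) (ha : ∀ j ≤ N, a j ^ 2 = vacuumSq N j) :
    ∃ δ > (0 : ℝ), ∃ C : ℝ, ∀ᶠ t in atTop,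
      ∑ j ∈ Finset.Ico 1 N, (ω j t - a j) ^ 2 ≤ C * r t ^ (-δ) := by
  have hN : (0 : ℝ) < N := by exact_mod_cast h.one_le_N
  set J : ℝ → ℝ := fun t => 1 / 2 * ∑ j ∈ Finset.Ico 1 N, (ω j t - a j) ^ 2 with hJdef
  set Z : ℝ → ℝ := fun t => -∑ j ∈ Finset.Ico 1 N, (ω j t - a j) * (r t * U j t) with hZdef
  have hη : ∀ j ∈ Finset.Ico 1 N, Tendsto (fun t => ω j t - a j) atTop (𝓝 0) := by
    intro j hj
    simpa using (hω j (Finset.mem_Ico.1 hj).2.le).sub_const (a j)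
  have hJd : ∀ t > 0, HasDerivAt J (-Z t) t := by
    intro t ht
    have h1 : HasDerivAt J (1 / 2 * ∑ j ∈ Finset.Ico 1 N, 2 * (ω j t - a j) * (r t * U j t)) t := by
      refine HasDerivAt.const_mul _ (HasDerivAt.fun_sum fun j hj => ?_)
      rw [Finset.mem_Ico] at hj
      refine (((h.omega_eq j hj.1 hj.2 t ht).sub_const (a j)).fun_pow 2).congr_deriv ?_
      push_cast
      ring
    refine h1.congr_deriv ?_
    rw [hZdef, neg_neg, Finset.mul_sum]
    exact Finset.sum_congr rfl fun _ _ => by ring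
  obtain ⟨δ, hδ, hev⟩ := exists_deriv_le_neg_mul_of_tendsto_zero (J := J) (Z := Z)
    (Z' := fun t => -∑ j ∈ Finset.Ico 1 N, (r t * U j t * (r t * U j t) + (ω j t - a j) *
      ((2 * Ψ t - κ t) * (r t * U j t) - gaugeFactor (fun i => ω i t) j * ω j t)))
    (b := fun t => 2 * Ψ t - κ t) (c := 1 / (4 * (N : ℝ) ^ 2)) (by positivity)
    ((eventually_gt_atTop 0).mono fun t ht => ⟨hJd t ht, mul_nonneg (by norm_num)
      (Finset.sum_nonneg fun _ _ => sq_nonneg _)⟩) (by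
      filter_upwards [eventually_gt_atTop 0, h.eventually_sum_gaugeFactor_mul_dev_le hω ha]
        with t ht hle
      constructor
      · refine (HasDerivAt.fun_sum fun j hj => ?_).fun_neg
        rw [Finset.mem_Ico] at hj
        exact ((h.omega_eq j hj.1 hj.2 t ht).sub_const (a j)).fun_mul
          (h.hasDerivAt_r_mul_U ht hj.1 hj.2)
      · have e : -∑ j ∈ Finset.Ico 1 N, (r t * U j t * (r t * U j t) + (ω j t - a j) *
            ((2 * Ψ t - κ t) * (r t * U j t) - gaugeFactor (fun i => ω i t) j * ω j t)) =
            -sumSq N (fun j => r t * U j t) + (2 * Ψ t - κ t) * Z t +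
            ∑ j ∈ Finset.Ico 1 N, gaugeFactor (fun i => ω i t) j * ω j t * (ω j t - a j) := by
          rw [hZdef, sumSq]
          simp only [mul_neg, Finset.mul_sum]
          rw [← Finset.sum_neg_distrib, ← Finset.sum_neg_distrib, ← Finset.sum_neg_distrib,
            ← Finset.sum_add_distrib, ← Finset.sum_add_distrib]
          exact Finset.sum_congr rfl fun _ _ => by ring
        rw [e]
        have := sumSq_nonneg N fun j => r t * U j t
        have e2 : 1 / (4 * (N : ℝ) ^ 2) * J t =
            1 / (8 * (N : ℝ) ^ 2) * ∑ j ∈ Finset.Ico 1 N, (ω j t - a j) ^ 2 := by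
          rw [hJdef]
          field_simp
          ring
        rw [e2]
        linarith)
    h.tendsto_two_mul_Psi_sub_kappa (by
      have := (tendsto_finsetSum (Finset.Ico 1 N) fun j hj => (hη j hj).pow 2).const_mul (1 / 2)
      rwa [zero_pow two_ne_zero, Finset.sum_const_zero, mul_zero] at this) (by
      have := (tendsto_finsetSum (Finset.Ico 1 N) fun j hj => (hη j hj).mul
        (h.tendsto_r_mul_U (Finset.mem_Ico.1 hj).1 (Finset.mem_Ico.1 hj).2)).neg
      rwa [mul_zero, Finset.sum_const_zero, neg_zero] at this)
  obtain ⟨T, hT⟩ := eventually_atTop.1 (hev.and (eventually_gt_atTop 0))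
  refine ⟨δ, hδ, 2 * (J T * r T ^ δ), ?_⟩
  filter_upwards [eventually_ge_atTop T] with t ht
  -- The exponential decay `J' ≤ -δ J` in `τ` becomes a power law in `r`, because `r' / r = Ψ ≤ 1`.
  have hmono := sub_le_mul_of_hasDerivAt_le (C := 0) (f := fun t => J t * r t ^ δ)
    (f' := fun t => -Z t * r t ^ δ + J t * (r t * Ψ t * δ * r t ^ (δ - 1))) ht
    (fun x hx => by
      have hx0 := (hT x hx.1).2
      exact (hJd x hx0).fun_mul ((h.r_eq x hx0).rpow_const (Or.inl (h.r_pos x hx0).ne')))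
    fun x hx => by
      obtain ⟨h1, hx0⟩ := hT x hx.1.le
      have hr := h.r_pos x hx0
      have hp : 0 < r x ^ δ := Real.rpow_pos_of_pos hr δ
      have e : r x * r x ^ (δ - 1) = r x ^ δ := by
        rw [Real.rpow_sub_one hr.ne']
        field_simp
      have hJ0 : 0 ≤ J x := mul_nonneg (by norm_num) (Finset.sum_nonneg fun _ _ => sq_nonneg _)
      have h2 : δ * J x * Ψ x ≤ δ * J x := mul_le_of_le_one_right (by positivity) (h.Psi_le_one x hx0)
      calc _ = (-Z x + δ * J x * Ψ x) * r x ^ δ := by rw [← e]; ring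
        _ ≤ 0 := mul_nonpos_of_nonpos_of_nonneg (by linarith) hp.le
  have hr := h.r_pos t (hT t ht).2
  have hp : 0 < r t ^ δ := Real.rpow_pos_of_pos hr δ
  rw [Real.rpow_neg hr.le, ← div_eq_mul_inv, le_div_iff₀ hp]
  have e : ∑ j ∈ Finset.Ico 1 N, (ω j t - a j) ^ 2 = 2 * J t := by rw [hJdef]; ring
  rw [e]
  linarith

/-- The flat energy increases to `0`, hence is nonpositive at late times, and the kinetic part is
bounded by the potential, which is quadratic in the deviation from the vacuum. -/
theorem eventually_sumSq_r_mul_U_le (h : IsExteriorSolution N r Ψ κ S ω U)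
    (hω : ∀ i ≤ N, Tendsto (ω i) atTop (𝓝 (a i))) (ha : ∀ j ≤ N, a j ^ 2 = vacuumSq N j) :
    ∃ C, ∀ᶠ t in atTop, sumSq N (fun j => r t * U j t) ≤
      C * ∑ j ∈ Finset.Ico 1 N, (ω j t - a j) ^ 2 := by
  have hN := h.one_le_N
  obtain ⟨K, hK⟩ := h.eventually_abs_omega_le
  obtain ⟨T, hT⟩ := h.eventually_flatEnergy_mono
  have hP0 : gaugePotential N a = 0 := by
    rw [gaugePotential_eq_vacuumDev]
    refine Finset.sum_eq_zero fun j hj => ?_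
    rw [Finset.mem_Icc] at hj
    simp only [vacuumDev]
    rw [ha j hj.2, ha (j - 1) (by omega)]
    ring
  have hPlim : Tendsto (fun t => gaugePotential N fun j => ω j t) atTop (𝓝 0) := by
    rw [← hP0]
    unfold gaugePotential
    refine tendsto_finsetSum _ fun j hj => ?_
    rw [Finset.mem_Icc] at hj
    exact ((((((hω j hj.2).pow 2).sub ((hω (j - 1) (by omega)).pow 2)).sub_const _).sub_const
      _).add_const _).pow 2
  have hElim := (h.tendsto_sumSq_r_mul_U.div_const 2).sub (hPlim.div_const 8)
  simp only [zero_div, sub_zero] at hElim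
  set A := ∑ j ∈ Finset.Icc 0 N, |a j| with hA
  have hAj : ∀ j ≤ N, |a j| ≤ A := fun j hj =>
    Finset.single_le_sum (f := fun j => |a j|) (fun _ _ => abs_nonneg _)
      (Finset.mem_Icc.2 ⟨Nat.zero_le _, hj⟩)
  refine ⟨N * (K + A) ^ 2, ?_⟩
  filter_upwards [hK, eventually_ge_atTop T, eventually_gt_atTop 0] with t hKt htT ht
  set Q := ∑ j ∈ Finset.Ico 1 N, (ω j t - a j) ^ 2 with hQ
  have hE : sumSq N (fun j => r t * U j t) / 2 - gaugePotential N (fun j => ω j t) / 8 ≤ 0 := by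
    refine ge_of_tendsto hElim ?_
    filter_upwards [eventually_ge_atTop t] with s hs
    exact hT htT (le_trans htT hs) hs
  have hQ0 : 0 ≤ Q := Finset.sum_nonneg fun _ _ => sq_nonneg _
  have hdev : ∀ j ≤ N, vacuumDev N (fun j => ω j t) j ^ 2 ≤ Q * (K + A) ^ 2 := by
    intro j hj
    have e : vacuumDev N (fun j => ω j t) j = (ω j t - a j) * (ω j t + a j) := by
      rw [vacuumDev, ← ha j hj]
      ring
    by_cases hj' : j ∈ Finset.Ico 1 N
    · rw [e, mul_pow]
      have h1 : (ω j t - a j) ^ 2 ≤ Q :=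
        Finset.single_le_sum (f := fun j => (ω j t - a j) ^ 2) (fun _ _ => sq_nonneg _) hj'
      have h2 : |ω j t + a j| ≤ K + A := (abs_add_le _ _).trans (add_le_add (hKt j hj) (hAj j hj))
      have h3 : (ω j t + a j) ^ 2 ≤ (K + A) ^ 2 := sq_le_sq' (abs_le.1 h2).1 (abs_le.1 h2).2
      gcongr
    · have : j = 0 ∨ j = N := by
        rw [Finset.mem_Ico] at hj'; omega
      have h0 : vacuumDev N (fun j => ω j t) j = 0 := by
        rcases this with rfl | rfl
        · exact vacuumDev_zero (h.omega_zero t ht)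
        · exact vacuumDev_self (h.omega_N t ht)
      rw [h0, zero_pow two_ne_zero]
      positivity
  have hP : gaugePotential N (fun j => ω j t) ≤ N * (4 * (Q * (K + A) ^ 2)) := by
    rw [gaugePotential_eq_vacuumDev]
    calc _ ≤ ∑ j ∈ Finset.Icc 1 N, 4 * (Q * (K + A) ^ 2) := by
          refine Finset.sum_le_sum fun j hj => ?_
          rw [Finset.mem_Icc] at hj
          have h1 := hdev j hj.2
          have h2 := hdev (j - 1) (by omega)
          nlinarith [sq_nonneg (vacuumDev N (fun j => ω j t) j
            + vacuumDev N (fun j => ω j t) (j - 1))]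
      _ = _ := by simp
  linarith

theorem exists_abs_dev_le (h : IsExteriorSolution N r Ψ κ S ω U)
    (hω : ∀ i ≤ N, Tendsto (ω i) atTop (𝓝 (a i))) (ha : ∀ j ≤ N, a j ^ 2 = vacuumSq N j) :
    ∃ δ > (0 : ℝ), ∃ C : ℝ, ∀ᶠ t in atTop, ∀ j, 1 ≤ j → j < N →
      |ω j t - a j| ≤ C * r t ^ (-δ) ∧ |r t * U j t| ≤ C * r t ^ (-δ) := by
  obtain ⟨δ, hδ, C, hC⟩ := h.exists_sum_dev_le hω ha
  obtain ⟨C', hC'⟩ := h.eventually_sumSq_r_mul_U_le hω ha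
  refine ⟨δ / 2, half_pos hδ, Real.sqrt (max C (|C'| * C)), ?_⟩
  filter_upwards [hC, hC', eventually_gt_atTop 0] with t h1 h2 ht j hj1 hj2
  have hr := h.r_pos t ht
  have hj : j ∈ Finset.Ico 1 N := Finset.mem_Ico.2 ⟨hj1, hj2⟩
  have hp : 0 < r t ^ (-δ) := Real.rpow_pos_of_pos hr _
  have e : r t ^ (-(δ / 2)) = Real.sqrt (r t ^ (-δ)) := by
    rw [Real.sqrt_eq_rpow, ← Real.rpow_mul hr.le]
    congr 1
    ring
  have hQ0 : 0 ≤ ∑ j ∈ Finset.Ico 1 N, (ω j t - a j) ^ 2 := Finset.sum_nonneg fun _ _ => sq_nonneg _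
  rw [e, ← Real.sqrt_mul' _ hp.le]
  constructor
  · apply Real.abs_le_sqrt
    calc _ ≤ _ := Finset.single_le_sum (f := fun j => (ω j t - a j) ^ 2) (fun _ _ => sq_nonneg _) hj
      _ ≤ _ := h1
      _ ≤ _ := by
        gcongr
        exact le_max_left _ _
  · apply Real.abs_le_sqrt
    calc _ ≤ sumSq N (fun j => r t * U j t) :=
          Finset.single_le_sum (f := fun j => (r t * U j t) ^ 2) (fun _ _ => sq_nonneg _) hj
      _ ≤ _ := h2
      _ ≤ |C'| * (C * r t ^ (-δ)) := by
        have := le_abs_self C'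
        gcongr
      _ = |C'| * C * r t ^ (-δ) := by ring
      _ ≤ _ := by
        gcongr
        exact le_max_right _ _

end IsExteriorSolution

end

/-! ### Binomial basis: diagonal part and products of modes -/

noncomputable section

section NewtonCoefficients

variable {R : Type*} [CommRing R]

/-- The coefficient of `Nat.choose · l` in the Newton expansion of a function on `ℕ`. -/
def newtonCoeff (l : ℕ) : (ℕ → R) →ₗ[R] R :=
  ∑ k ∈ Finset.range (l + 1), ((-1) ^ (l - k) * (l.choose k : R)) • LinearMap.proj k

theorem newtonCoeff_apply (l : ℕ) (v : ℕ → R) :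
    newtonCoeff l v = ∑ k ∈ Finset.range (l + 1), (-1) ^ (l - k) * (l.choose k : R) * v k := by
  simp [newtonCoeff]

theorem newtonCoeff_eq_fwdDiff_iter (l : ℕ) (v : ℕ → R) :
    newtonCoeff l v = (fwdDiff 1)^[l] v 0 := by
  rw [newtonCoeff_apply, fwdDiff_iter_eq_sum_shift]
  exact Finset.sum_congr rfl fun k _ => by simp

theorem newtonCoeff_congr {l : ℕ} {u v : ℕ → R} (h : ∀ i ≤ l, u i = v i) :
    newtonCoeff l u = newtonCoeff l v := by
  rw [newtonCoeff_apply, newtonCoeff_apply]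
  exact Finset.sum_congr rfl fun k hk => by rw [h k (Finset.mem_range_succ_iff.1 hk)]

theorem newtonCoeff_intCast (l : ℕ) (f : ℕ → ℤ) :
    newtonCoeff l (fun i => (f i : R)) = ((newtonCoeff l f : ℤ) : R) := by
  simp [newtonCoeff_apply]

theorem newtonCoeff_choose (l m : ℕ) :
    newtonCoeff l (fun i => (i.choose m : R)) = if l = m then 1 else 0 := by
  have h := newtonCoeff_intCast (R := R) l fun i => (i.choose m : ℤ)
  rw [newtonCoeff_eq_fwdDiff_iter l fun i => (i.choose m : ℤ), fwdDiff_iter_choose_zero] at h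
  simpa using h

/-- The Newton expansion. -/
theorem eq_sum_choose_mul_newtonCoeff {n i : ℕ} (hi : i < n) (v : ℕ → R) :
    v i = ∑ a ∈ Finset.range n, newtonCoeff a v * (i.choose a : R) := by
  have h := shift_eq_sum_fwdDiff_iter (h := 1) v i 0
  simp only [smul_eq_mul, mul_one, zero_add, nsmul_eq_mul] at h
  rw [h, ← Finset.sum_subset (Finset.range_subset_range.2 (show i + 1 ≤ n from hi))]
  · exact Finset.sum_congr rfl fun a _ => by rw [newtonCoeff_eq_fwdDiff_iter, mul_comm]
  · intro a _ ha
    rw [Nat.choose_eq_zero_of_lt (by simpa using ha)]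
    simp

/-- The structure constants of the product in the Newton basis. -/
def newtonMul (a b l : ℕ) : ℤ := newtonCoeff l fun i => (i.choose a * i.choose b : ℤ)

/-- A product of polynomials of degrees `a` and `b` is killed by more than `a + b` differences. The
induction uses the discrete Leibniz rule, whose three terms each have lower total degree. -/
theorem fwdDiff_iter_choose_mul_choose {l a b : ℕ} (h : a + b < l) :
    (fwdDiff 1)^[l] (fun i : ℕ => (i.choose a * i.choose b : ℤ)) = 0 := by
  induction l generalizing a b with
  | zero => omega
  | succ l ih =>
    have hadd : ∀ f g : ℕ → ℤ, (fwdDiff 1)^[l] f = 0 → (fwdDiff 1)^[l] g = 0 →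
        (fwdDiff 1)^[l] (f + g) = 0 := fun f g hf hg => by
      rw [fwdDiff_iter_add, hf, hg, add_zero]
    have hzero : (fwdDiff 1)^[l] (0 : ℕ → ℤ) = 0 := by
      simpa using fwdDiff_iter_const_smul (h := 1) (0 : ℤ) (0 : ℕ → ℤ) l
    rw [Function.iterate_succ_apply]
    rcases a with _ | a <;> rcases b with _ | b
    · convert! hzero using 2
      ext i
      simp [fwdDiff]
    · convert! ih (a := 0) (b := b) (by omega) using 2
      ext i
      simp [fwdDiff, Nat.choose_succ_succ']
    · convert! ih (a := a) (b := 0) (by omega) using 2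
      ext i
      simp [fwdDiff, Nat.choose_succ_succ']
    · convert! hadd _ _ (hadd _ _ (ih (a := a) (b := b + 1) (by omega))
        (ih (a := a + 1) (b := b) (by omega))) (ih (a := a) (b := b) (by omega)) using 2
      ext i
      simp only [fwdDiff, Nat.choose_succ_succ', Pi.add_apply]
      push_cast
      ring

theorem newtonMul_eq_zero {l a b : ℕ} (h : a + b < l) : newtonMul a b l = 0 := by
  rw [newtonMul, newtonCoeff_eq_fwdDiff_iter, fwdDiff_iter_choose_mul_choose h]
  rfl

theorem newtonCoeff_mul (l : ℕ) (u v : ℕ → R) :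
    newtonCoeff l (fun i => u i * v i) =
      ∑ a ∈ Finset.range (l + 1), ∑ b ∈ Finset.range (l + 1),
        (newtonMul a b l : R) * (newtonCoeff a u * newtonCoeff b v) := by
  have h : newtonCoeff l (fun i => u i * v i) = newtonCoeff l
      (∑ a ∈ Finset.range (l + 1), ∑ b ∈ Finset.range (l + 1),
        (newtonCoeff a u * newtonCoeff b v) •
          fun i : ℕ => ((i.choose a * i.choose b : ℤ) : R)) := by
    refine newtonCoeff_congr fun i hi => ?_
    rw [eq_sum_choose_mul_newtonCoeff (Nat.lt_succ_of_le hi) u,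
      eq_sum_choose_mul_newtonCoeff (Nat.lt_succ_of_le hi) v, Finset.sum_mul_sum]
    simp only [Finset.sum_apply, Pi.smul_apply, smul_eq_mul]
    refine Finset.sum_congr rfl fun a _ => Finset.sum_congr rfl fun b _ => ?_
    push_cast
    ring
  rw [h, map_sum]
  refine Finset.sum_congr rfl fun a _ => ?_
  rw [map_sum]
  refine Finset.sum_congr rfl fun b _ => ?_
  rw [map_smul, newtonCoeff_intCast, smul_eq_mul, mul_comm]
  rfl

/-- The linearization of the gauge field equations about the vacuum values, as a Jacobi type
difference operator. -/
def vacuumOp (N : ℕ) : (ℕ → R) →ₗ[R] (ℕ → R) where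
  toFun u i := ((i : R) + 2) * ((N : R) - (i + 2)) * u (i + 1)
    - 2 * (((i : R) + 1) * ((N : R) - (i + 1))) * u i + (i : R) * ((N : R) - i) * u (i - 1)
  map_add' u v := by
    ext i
    simp only [Pi.add_apply]
    ring
  map_smul' c u := by
    ext i
    simp only [Pi.smul_apply, smul_eq_mul, RingHom.id_apply]
    ring

theorem vacuumOp_apply (N : ℕ) (u : ℕ → R) (i : ℕ) : vacuumOp N u i =
    ((i : R) + 2) * ((N : R) - (i + 2)) * u (i + 1)
    - 2 * (((i : R) + 1) * ((N : R) - (i + 1))) * u i + (i : R) * ((N : R) - i) * u (i - 1) := rfl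

theorem vacuumOp_choose_zero (N i : ℕ) :
    vacuumOp N (fun i => (i.choose 0 : R)) i = -2 * (i.choose 0 : R) := by
  rw [vacuumOp_apply]
  simp
  ring

theorem vacuumOp_choose_succ (N m i : ℕ) :
    vacuumOp N (fun i => (i.choose (m + 1) : R)) i =
      -((m + 2) * (m + 3)) * (i.choose (m + 1) : R)
        + (m + 2) * ((N : R) - (m + 2)) * (i.choose m : R) := by
  have h1 : (i : R) * ((i - 1).choose (m + 1) : R) = ((i : R) - (m + 1)) * i.choose (m + 1) := by
    rcases i with _ | i
    · simp
    · have h2' : ((i : R) + 1) * (i.choose m : R) = (i + 1).choose (m + 1) * (m + 1) := by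
        have := congrArg (Nat.cast : ℕ → R) (Nat.add_one_mul_choose_eq i m)
        push_cast at this
        exact this
      have h3' : ((i + 1).choose (m + 1) : R) = i.choose m + i.choose (m + 1) := by
        rw [Nat.choose_succ_succ', Nat.cast_add]
      simp only [Nat.add_sub_cancel]
      push_cast
      linear_combination (-(i : R) - 1) * h3' - h2'
  have h2 : ((m : R) + 1) * i.choose (m + 1) = ((i : R) - m) * i.choose m := by
    have h := Nat.choose_succ_right_eq i m
    rcases le_or_gt m i with hm | hm
    · have : (i.choose (m + 1) : R) * (m + 1) = i.choose m * ((i - m : ℕ) : R) := by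
        have := congrArg (Nat.cast : ℕ → R) h
        push_cast at this
        exact this
      rw [Nat.cast_sub hm] at this
      linear_combination this
    · simp [Nat.choose_eq_zero_of_lt hm, Nat.choose_eq_zero_of_lt (Nat.lt_succ_of_lt hm)]
  have h3 : ((i + 1).choose (m + 1) : R) = i.choose m + i.choose (m + 1) := by
    rw [Nat.choose_succ_succ', Nat.cast_add]
  rw [vacuumOp_apply, h3]
  linear_combination ((N : R) - i) * h1 + ((m : R) + 4 - N + i) * h2

/-- In the binomial basis the linearized operator is bidiagonal, with eigenvalues `-(l + 1)(l + 2)`.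
The coupling to mode `l + 1` vanishes for `l + 2 = N`, so the modes `l < N - 1` form a closed
system. -/
theorem newtonCoeff_vacuumOp (N l : ℕ) (u : ℕ → R) :
    newtonCoeff l (vacuumOp N u) = -((l + 1) * (l + 2)) * newtonCoeff l u
      + (l + 2) * ((N : R) - (l + 2)) * newtonCoeff (l + 1) u := by
  set B : ℕ → ℕ → R := fun a i => (i.choose a : R) with hB
  have hBl : ∀ m, newtonCoeff l (vacuumOp N (B m)) = -((l + 1) * (l + 2)) * newtonCoeff l (B m)
      + (l + 2) * ((N : R) - (l + 2)) * newtonCoeff (l + 1) (B m) := by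
    intro m
    rcases m with _ | m
    · have e : vacuumOp N (B 0) = (-2 : R) • B 0 := by
        ext i
        exact vacuumOp_choose_zero N i
      rw [e, map_smul, hB, newtonCoeff_choose, newtonCoeff_choose, smul_eq_mul,
        if_neg (Nat.succ_ne_zero l)]
      split_ifs with h
      · subst h
        push_cast
        ring
      · ring
    · have e : vacuumOp N (B (m + 1)) = (-((m + 2) * (m + 3)) : R) • B (m + 1)
          + ((m + 2) * ((N : R) - (m + 2))) • B m := by
        ext i
        exact vacuumOp_choose_succ N m i
      rw [e, map_add, map_smul, map_smul, hB, newtonCoeff_choose, newtonCoeff_choose,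
        newtonCoeff_choose, smul_eq_mul, smul_eq_mul]
      simp only [Nat.add_right_cancel_iff]
      by_cases h1 : l = m + 1
      · subst h1
        simp
        ring
      · by_cases h2 : l = m
        · subst h2
          simp
        · simp [h1, h2]
  -- Both sides involve `u i` only for `i ≤ l + 1`, so `u` may be replaced by its Newton polynomial
  -- of that degree.
  have hexp : ∀ i < l + 2, u i = (∑ a ∈ Finset.range (l + 2), newtonCoeff a u • B a) i := by
    intro i hi
    rw [eq_sum_choose_mul_newtonCoeff hi u]
    simp [hB]
  set v := ∑ a ∈ Finset.range (l + 2), newtonCoeff a u • B a with hv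
  have e1 : newtonCoeff l (vacuumOp N u) = newtonCoeff l (vacuumOp N v) :=
    newtonCoeff_congr fun i hi => by
      rw [vacuumOp_apply, vacuumOp_apply, hexp _ (by omega), hexp _ (by omega), hexp _ (by omega)]
  have e2 : newtonCoeff l u = newtonCoeff l v := newtonCoeff_congr fun i hi => hexp i (by omega)
  have e3 : newtonCoeff (l + 1) u = newtonCoeff (l + 1) v :=
    newtonCoeff_congr fun i hi => hexp i (by omega)
  rw [e1, e2, e3, hv]
  simp only [map_sum, map_smul, smul_eq_mul, hBl]
  rw [Finset.mul_sum, Finset.mul_sum, ← Finset.sum_add_distrib]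
  exact Finset.sum_congr rfl fun a _ => by ring

end NewtonCoefficients

end

/-! ### Scaled modes: the force beyond the diagonal gains one power -/

noncomputable section

section ScaledCoefficients

variable {R : Type*} [CommRing R] {N n : ℕ} {s : R}

/-- The Newton coefficients of `v` are `s ^ (l + e) * y l` for `l < n`. -/
def IsScaled (n : ℕ) (s : R) (e : ℕ) (v y : ℕ → R) : Prop :=
  ∀ l < n, newtonCoeff l v = s ^ (l + e) * y l

/-- The product in terms of scaled Newton coefficients. -/
def mulScaled (s : R) (y y' : ℕ → R) (l : ℕ) : R :=
  ∑ a ∈ Finset.range (l + 1), ∑ b ∈ Finset.range (l + 1),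
    (newtonMul a b l : R) * s ^ (a + b - l) * (y a * y' b)

/-- The operator `vacuumOp` in terms of scaled Newton coefficients. -/
def opScaled (N : ℕ) (s : R) (y : ℕ → R) (l : ℕ) : R :=
  -((l + 1) * (l + 2)) * y l + (l + 2) * ((N : R) - (l + 2)) * (s * y (l + 1))

/-- Sources with `a + b < l` are absent, so the power `s ^ (a + b - l)` left after factoring out `s
^ (l + e + e')` involves a genuine subtraction. For `e = e' = 1` the product is one order smaller
than the scale of mode `l`. -/
theorem IsScaled.mul {u v y y' : ℕ → R} {e e' : ℕ} (hu : IsScaled n s e u y)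
    (hv : IsScaled n s e' v y') :
    IsScaled n s (e + e') (fun i => u i * v i) (mulScaled s y y') := by
  intro l hl
  rw [newtonCoeff_mul, mulScaled, Finset.mul_sum]
  refine Finset.sum_congr rfl fun a ha => ?_
  rw [Finset.mul_sum]
  refine Finset.sum_congr rfl fun b hb => ?_
  rw [Finset.mem_range] at ha hb
  rw [hu a (by omega), hv b (by omega)]
  rcases lt_or_ge (a + b) l with h | h
  · simp [newtonMul_eq_zero h]
  · have e1 : s ^ (a + e) * s ^ (b + e') = s ^ (l + (e + e')) * s ^ (a + b - l) := by
      rw [← pow_add, ← pow_add]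
      congr 1
      omega
    linear_combination (newtonMul a b l : R) * (y a * y' b) * e1

theorem IsScaled.vacuumOp {u y : ℕ → R} {e : ℕ} (hu : IsScaled (N - 1) s e u y) :
    IsScaled (N - 1) s e (vacuumOp N u) (opScaled N s y) := by
  intro l hl
  rw [newtonCoeff_vacuumOp, hu l hl, opScaled]
  rcases Nat.lt_or_ge (l + 1) (N - 1) with h | h
  · rw [hu (l + 1) h]
    ring
  · have : (N : R) - (l + 2) = 0 := by
      obtain rfl : N = l + 2 := by omega
      push_cast
      ring
    rw [this]
    ring

theorem IsScaled.add {u v y y' : ℕ → R} {e k : ℕ} (hu : IsScaled n s e u y)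
    (hv : IsScaled n s (e + k) v y') :
    IsScaled n s e (fun i => u i + v i) (fun l => y l + s ^ k * y' l) := by
  intro l hl
  have : (fun i => u i + v i) = u + v := rfl
  rw [this, map_add, hu l hl, hv l hl]
  ring

/-- The function with prescribed scaled Newton coefficients. -/
def ofScaled (n : ℕ) (s : R) (y : ℕ → R) (i : ℕ) : R :=
  ∑ l ∈ Finset.range n, s ^ (l + 1) * y l * (i.choose l : R)

theorem IsScaled.eq_ofScaled {u y : ℕ → R} (hu : IsScaled n s 1 u y) {i : ℕ} (hi : i < n) :
    u i = ofScaled n s y i := by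
  rw [eq_sum_choose_mul_newtonCoeff hi u, ofScaled]
  exact Finset.sum_congr rfl fun l hl => by rw [hu l (Finset.mem_range.1 hl)]

/-- One sixteenth of the gauge potential, for `ω_{i+1} = a_{i+1} (1 + 2 u_i)`. -/
def scaledPotential (N : ℕ) (u : ℕ → R) : R :=
  ∑ j ∈ Finset.Icc 1 N, ((j : R) * ((N : R) - j) * (u (j - 1) + u (j - 1) ^ 2)
    - ((j - 1 : ℕ) : R) * ((N : R) - (j - 1 : ℕ)) * (u (j - 1 - 1) + u (j - 1 - 1) ^ 2)) ^ 2

/-- The entries outside `0, …, N - 2`, and the truncated `0 - 1`, come with the weight `k (N - k) =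
0`. -/
theorem scaledPotential_congr {u v : ℕ → R} (h : ∀ i < N - 1, u i = v i) :
    scaledPotential N u = scaledPotential N v := by
  refine Finset.sum_congr rfl fun j hj => ?_
  rw [Finset.mem_Icc] at hj
  have key : ∀ k ≤ N, (k : R) * ((N : R) - k) * (u (k - 1) + u (k - 1) ^ 2) =
      (k : R) * ((N : R) - k) * (v (k - 1) + v (k - 1) ^ 2) := by
    intro k hk
    rcases Nat.eq_zero_or_pos k with rfl | h0
    · simp
    · rcases eq_or_lt_of_le hk with rfl | hk'
      · simp
      · rw [h (k - 1) (by omega)]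
  rw [key j hj.2, key (j - 1) (by omega)]

/-- One quarter of the kinetic term, for `θ ω_{i+1} = 2 a_{i+1} g_i`. -/
def scaledKinetic (N : ℕ) (g : ℕ → R) : R :=
  ∑ i ∈ Finset.range (N - 1), ((i : R) + 1) * ((N : R) - (i + 1)) * g i ^ 2

/-- The right hand side of the gauge field equations in the variable `z = 1 / r`. -/
def gaugeForce (N : ℕ) (z ν m : R) (u g : ℕ → R) (i : ℕ) : R :=
  ν * (z * (2 * m - 8 * z * scaledPotential N u) * g i
    - vacuumOp N (fun i => u i + u i * u i) i * (1 + 2 * u i))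

/-- The nonlinear part of `gaugeForce` in terms of scaled Newton coefficients, for `z = s * ζ`. -/
def scaledForce (N : ℕ) (s ζ ν m : R) (y h : ℕ → R) (l : ℕ) : R :=
  ν * ζ * (2 * m - 8 * (s * ζ) * scaledPotential N (ofScaled (N - 1) s y)) * h l
    - 2 * ζ * m * ν * (opScaled N s (fun l => y l + s ^ 1 * mulScaled s y y l) l
      + 2 * s * mulScaled s y (opScaled N s fun l => y l + s ^ 1 * mulScaled s y y l) l)
    - opScaled N s (mulScaled s y y) l
    - 2 * mulScaled s y (opScaled N s fun l => y l + s ^ 1 * mulScaled s y y l) l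
    - (l + 2) * ((N : R) - (l + 2)) * y (l + 1)

theorem newtonCoeff_gaugeForce {ζ ν m : R} {u g y h : ℕ → R} (hu : IsScaled (N - 1) s 1 u y)
    (hg : IsScaled (N - 1) s 1 g h) (hν : ν * (1 - 2 * (s * ζ) * m) = 1) {l : ℕ} (hl : l < N - 1) :
    newtonCoeff l (gaugeForce N (s * ζ) ν m u g) =
      (l + 1) * (l + 2) * (s ^ (l + 1) * y l) + s ^ (l + 2) * scaledForce N s ζ ν m y h l := by
  have hQ : scaledPotential N u = scaledPotential N (ofScaled (N - 1) s y) :=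
    scaledPotential_congr fun i hi => hu.eq_ofScaled hi
  have huu := hu.mul hu
  have hA := (hu.add (k := 1) huu).vacuumOp
  have huA := hu.mul hA
  set A := vacuumOp N fun i => u i + u i * u i with hAdef
  set Q := scaledPotential N u
  have hAsplit : A = vacuumOp N u + vacuumOp N fun i => u i * u i := by
    rw [hAdef, ← map_add]
    rfl
  -- Substituting `ν = 1 + 2 s ζ m ν` isolates the linear force. Of all the terms only its diagonal
  -- part has the size `s ^ (l + 1)`; the others carry another factor `s`, including the linear
  -- coupling to mode `l + 1`.
  have e : gaugeForce N (s * ζ) ν m u g =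
      (ν * (s * ζ) * (2 * m - 8 * (s * ζ) * Q)) • g
      - (2 * (s * ζ) * m * ν) • (A + (2 : R) • fun i => u i * A i)
      - (vacuumOp N u + vacuumOp N fun i => u i * u i) - (2 : R) • fun i => u i * A i := by
    rw [← hAsplit]
    ext i
    simp only [gaugeForce, Pi.sub_apply, Pi.add_apply, Pi.smul_apply, smul_eq_mul]
    linear_combination (-A i * (1 + 2 * u i)) * hν
  have hlast : (l + 2) * ((N : R) - (l + 2)) * newtonCoeff (l + 1) u =
      s ^ (l + 2) * ((l + 2) * ((N : R) - (l + 2)) * y (l + 1)) := by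
    rcases Nat.lt_or_ge (l + 1) (N - 1) with h | h
    · rw [hu (l + 1) h]
      ring
    · have : (N : R) - (l + 2) = 0 := by
        obtain rfl : N = l + 2 := by omega
        push_cast
        ring
      rw [this]
      ring
  rw [e]
  simp only [map_sub, map_add, map_smul, smul_eq_mul]
  rw [newtonCoeff_vacuumOp N l u, hlast, hu l hl, hg l hl, hA l hl, huA l hl, huu.vacuumOp l hl,
    scaledForce, ← hQ]
  ring

variable {R' : Type*} [CommRing R'] (f : R →+* R')

theorem map_mulScaled (s : R) (y y' : ℕ → R) (l : ℕ) : f (mulScaled s y y' l) =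
    mulScaled (f s) (fun l => f (y l)) (fun l => f (y' l)) l := by
  simp [mulScaled]

theorem map_opScaled (N : ℕ) (s : R) (y : ℕ → R) (l : ℕ) : f (opScaled N s y l) =
    opScaled N (f s) (fun l => f (y l)) l := by
  simp [opScaled, map_ofNat f 2]

theorem map_ofScaled (n : ℕ) (s : R) (y : ℕ → R) (i : ℕ) : f (ofScaled n s y i) =
    ofScaled n (f s) (fun l => f (y l)) i := by
  simp [ofScaled]

theorem map_scaledPotential (N : ℕ) (u : ℕ → R) : f (scaledPotential N u) =
    scaledPotential N (fun i => f (u i)) := by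
  simp [scaledPotential]

theorem map_scaledKinetic (N : ℕ) (g : ℕ → R) : f (scaledKinetic N g) =
    scaledKinetic N (fun i => f (g i)) := by
  simp [scaledKinetic]

/-- The force is a polynomial in its arguments, with `ν` standing for the reciprocal of `μ`. It can
therefore be evaluated in a ring of bounded or of analytic functions, and this lemma identifies its
pointwise values. -/
theorem map_scaledForce (N : ℕ) (s ζ ν m : R) (y h : ℕ → R) (l : ℕ) :
    f (scaledForce N s ζ ν m y h l) =
      scaledForce N (f s) (f ζ) (f ν) (f m) (fun l => f (y l)) (fun l => f (h l)) l := by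
  simp [scaledForce, map_mulScaled, map_opScaled, map_ofScaled, map_scaledPotential,
    map_ofNat f 2, map_ofNat f 8]

end ScaledCoefficients

end

/-! ### The field equations in the variable `z = 1 / r` -/

noncomputable section

/-- The functions `u_i` with `ω_{i+1} = a_{i+1} (1 + 2 u_i)`, in the variable `z = 1 / r`. -/
def relDev (a : ℕ → ℝ) (w : ℕ → ℝ → ℝ) (i : ℕ) (z : ℝ) : ℝ := (w (i + 1) z⁻¹ / a (i + 1) - 1) / 2

/-- The functions `z u_i'`, for `u_i` as in `relDev`. -/
def relVel (a : ℕ → ℝ) (w : ℕ → ℝ → ℝ) (i : ℕ) (z : ℝ) : ℝ :=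
  -z⁻¹ * deriv (w (i + 1)) z⁻¹ / (2 * a (i + 1))

namespace SolvesRadial

variable {N : ℕ} {rh : ℝ} {m S : ℝ → ℝ} {w : ℕ → ℝ → ℝ} {a : ℕ → ℝ} {z : ℝ}

theorem vacuumDev_eq (h : SolvesRadial N (Set.Ioi rh) m S w)
    (ha : ∀ j, 1 ≤ j → j < N → a j ^ 2 = vacuumSq N j) (hz : rh < z⁻¹) {j : ℕ} (hj : j ≤ N) :
    vacuumDev N (fun i => w i z⁻¹) j = 4 * ((j : ℝ) * ((N : ℝ) - j) *
      (relDev a w (j - 1) z + relDev a w (j - 1) z ^ 2)) := by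
  rcases Nat.eq_zero_or_pos j with rfl | h0
  · rw [vacuumDev_zero (h.omega_zero _ hz)]
    simp
  · rcases eq_or_lt_of_le hj with rfl | hj'
    · rw [vacuumDev_self (h.omega_N _ hz)]
      simp
    · have h1 := one_le_vacuumSq h0 hj'
      have h2 := ha j h0 hj'
      have h3 : a j ≠ 0 := by
        intro h3
        rw [h3] at h2
        linarith
      rw [vacuumDev, relDev, Nat.sub_add_cancel h0, ← h2, ← vacuumSq, ← h2]
      field_simp
      ring

theorem gaugePotential_eq (h : SolvesRadial N (Set.Ioi rh) m S w)
    (ha : ∀ j, 1 ≤ j → j < N → a j ^ 2 = vacuumSq N j) (hz : rh < z⁻¹) :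
    gaugePotential N (fun i => w i z⁻¹) = 16 * scaledPotential N fun i => relDev a w i z := by
  rw [gaugePotential_eq_vacuumDev, scaledPotential, Finset.mul_sum]
  refine Finset.sum_congr rfl fun j hj => ?_
  rw [Finset.mem_Icc] at hj
  rw [h.vacuumDev_eq ha hz hj.2, h.vacuumDev_eq ha hz (by omega : j - 1 ≤ N)]
  ring

theorem gaugeFactor_eq (h : SolvesRadial N (Set.Ioi rh) m S w)
    (ha : ∀ j, 1 ≤ j → j < N → a j ^ 2 = vacuumSq N j) (hz : rh < z⁻¹) {i : ℕ} (hi : i + 1 < N) :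
    gaugeFactor (fun i => w i z⁻¹) (i + 1) =
      2 * vacuumOp N (fun i => relDev a w i z + relDev a w i z * relDev a w i z) i := by
  rw [gaugeFactor_eq_vacuumDev N _ (by omega : 1 ≤ i + 1), h.vacuumDev_eq ha hz hi.le,
    h.vacuumDev_eq ha hz (by omega : i + 1 - 1 ≤ N), h.vacuumDev_eq ha hz hi, vacuumOp_apply]
  simp only [Nat.add_sub_cancel]
  push_cast
  ring

theorem hasDerivAt_relDev (h : SolvesRadial N (Set.Ioi rh) m S w) (hz0 : 0 < z) (hz : rh < z⁻¹)
    {i : ℕ} (hi : i + 1 < N) (ha : a (i + 1) ≠ 0) :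
    HasDerivAt (relDev a w i) (relVel a w i z / z) z := by
  have h1 := (h.diff (i + 1) (by omega) hi z⁻¹ hz).hasDerivAt.comp z (hasDerivAt_inv hz0.ne')
  refine (((h1.div_const (a (i + 1))).sub_const 1).div_const 2).congr_deriv ?_
  rw [relVel]
  field_simp

theorem hasDerivAt_relVel (h : SolvesRadial N (Set.Ioi rh) m S w)
    (ha : ∀ j, 1 ≤ j → j < N → a j ^ 2 = vacuumSq N j) (hz0 : 0 < z) (hz : rh < z⁻¹)
    (hμ : 1 - 2 * z * m z⁻¹ ≠ 0) {i : ℕ} (hi : i + 1 < N) (hai : a (i + 1) ≠ 0) :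
    HasDerivAt (relVel a w i) ((-relVel a w i z + gaugeForce N z (1 - 2 * z * m z⁻¹)⁻¹ (m z⁻¹)
      (fun i => relDev a w i z) (fun i => relVel a w i z) i) / z) z := by
  have h1 := (h.diff_deriv (i + 1) (by omega) hi z⁻¹ hz).hasDerivAt.comp z
    (hasDerivAt_inv hz0.ne')
  have hw : w (i + 1) z⁻¹ = a (i + 1) * (1 + 2 * relDev a w i z) := by
    rw [relDev]
    field_simp
    ring
  have hE := h.gauge_eq (i + 1) (by omega) hi z⁻¹ hz
  rw [pTheta_eq_gaugePotential, h.gaugePotential_eq ha hz, h.gaugeFactor_eq ha hz hi, hw] at hE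
  refine (((hasDerivAt_inv hz0.ne').fun_neg.fun_mul h1).div_const (2 * a (i + 1))).congr_deriv ?_
  simp only [gaugeForce]
  set A := vacuumOp N (fun i => relDev a w i z + relDev a w i z * relDev a w i z) i
  set Q := scaledPotential N fun i => relDev a w i z
  set W' := deriv (deriv (w (i + 1))) z⁻¹ with hW'
  have hv : relVel a w i z = -z⁻¹ * deriv (w (i + 1)) z⁻¹ / (2 * a (i + 1)) := rfl
  set W := deriv (w (i + 1)) z⁻¹ with hW
  set u := relDev a w i z
  have hm : metricMu m z⁻¹ = 1 - 2 * z * m z⁻¹ := by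
    rw [metricMu]
    field_simp
  rw [hm] at hE
  set M := m z⁻¹
  rw [hv]
  simp only [Function.comp_apply, ← hW]
  have key : W' * (1 - 2 * z * M) =
      -z ^ 2 * ((2 * M - 8 * z * Q) * W + 2 * A * (a (i + 1) * (1 + 2 * u))) := by
    have : z⁻¹ ^ 2 * (1 - 2 * z * M) * W' + (2 * M - 8 * z * Q) * W
        + 2 * A * (a (i + 1) * (1 + 2 * u)) = 0 := by
      rw [← hE]
      field_simp
      ring
    have h2 : z⁻¹ ^ 2 * (1 - 2 * z * M) * W' = -((2 * M - 8 * z * Q) * W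
        + 2 * A * (a (i + 1) * (1 + 2 * u))) := by linarith
    rw [neg_mul, ← mul_neg, ← h2]
    field_simp
  have hW'' : W' = -z ^ 2 * ((2 * M - 8 * z * Q) * W + 2 * A * (a (i + 1) * (1 + 2 * u))) *
      (1 - 2 * z * M)⁻¹ := by
    rw [← key, mul_inv_cancel_right₀ hμ]
  rw [hW'']
  set ν := (1 - 2 * z * M)⁻¹
  field_simp
  ring

theorem hasDerivAt_mass (h : SolvesRadial N (Set.Ioi rh) m S w)
    (ha : ∀ j, 1 ≤ j → j < N → a j ^ 2 = vacuumSq N j) (hz0 : 0 < z) (hz : rh < z⁻¹) :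
    HasDerivAt (fun z => m z⁻¹) (-(4 * (1 - 2 * z * m z⁻¹) *
      scaledKinetic N (fun i => relVel a w i z) +
      4 * scaledPotential N (fun i => relDev a w i z))) z := by
  refine ((h.m_eq z⁻¹ hz).comp z (hasDerivAt_inv hz0.ne')).congr_deriv ?_
  have hG : radialG N w z⁻¹ = 4 * z ^ 2 * scaledKinetic N (fun i => relVel a w i z) := by
    rw [radialG, sumSq, scaledKinetic, Finset.sum_Ico_eq_sum_range, Finset.mul_sum]
    refine Finset.sum_congr rfl fun i hi => ?_
    rw [Finset.mem_range] at hi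
    have h1 := one_le_vacuumSq (show 1 ≤ i + 1 by omega) (show i + 1 < N by omega)
    have h2 := ha (i + 1) (by omega) (by omega)
    have h3 : a (i + 1) ≠ 0 := by
      intro h3
      rw [h3] at h2
      linarith
    have h4 : ((i : ℝ) + 1) * ((N : ℝ) - (i + 1)) = a (i + 1) ^ 2 := by
      rw [h2, vacuumSq]
      push_cast
      ring
    rw [h4, relVel, add_comm 1 i]
    field_simp
    ring
  have hm : metricMu m z⁻¹ = 1 - 2 * z * m z⁻¹ := by
    rw [metricMu]
    field_simp
  rw [hG, hm, pTheta_eq_gaugePotential, h.gaugePotential_eq ha hz]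
  field_simp
  ring

end SolvesRadial

namespace IsExteriorSolution

variable {N : ℕ} {r Ψ κ S : ℝ → ℝ} {ω U : ℕ → ℝ → ℝ} {rh : ℝ} {T : ℝ → ℝ} {a : ℕ → ℝ}

/-- Rewrites the power decay in `r` as power decay in `z`. The velocity is `-(r U) / (2 Ψ a)`,
harmless since `Ψ → 1`. -/
theorem isBigO_relDev_relVel (h : IsExteriorSolution N r Ψ κ S ω U) (hT : IsRadialInverse rh r Ψ T)
    (hω : ∀ i ≤ N, Tendsto (ω i) atTop (𝓝 (a i))) (ha : ∀ j ≤ N, a j ^ 2 = vacuumSq N j) :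
    ∃ δ > (0 : ℝ), ∀ i, i + 1 < N →
      (relDev a (fun j x => ω j (T x)) i =O[𝓝[>] 0] fun z => z ^ δ) ∧
      (relVel a (fun j x => ω j (T x)) i =O[𝓝[>] 0] fun z => z ^ δ) := by
  obtain ⟨δ, hδ, C, hC⟩ := h.exists_abs_dev_le hω ha
  refine ⟨δ, hδ, fun i hi => ?_⟩
  have h1 := one_le_vacuumSq (show 1 ≤ i + 1 by omega) hi
  have h2 := ha (i + 1) hi.le
  have h3 : a (i + 1) ≠ 0 := by
    intro h3
    rw [h3] at h2
    linarith
  have hTz : Tendsto (fun z => T z⁻¹) (𝓝[>] 0) atTop := hT.tendsto_atTop.comp tendsto_inv_nhdsGT_zero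
  have hrh : ∀ᶠ z : ℝ in 𝓝[>] 0, rh < z⁻¹ := tendsto_inv_nhdsGT_zero.eventually_gt_atTop rh
  have hpow : ∀ z > (0 : ℝ), z⁻¹ ^ (-δ) = z ^ δ := fun z hz => by
    rw [Real.inv_rpow hz.le, Real.rpow_neg hz.le, inv_inv]
  constructor
  · refine IsBigO.of_bound (C / |a (i + 1)|) ?_
    filter_upwards [hTz.eventually hC, hrh, self_mem_nhdsWithin] with z h4 h5 h6
    have h6 : 0 < z := h6
    have h7 := (h4 (i + 1) (by omega) hi).1
    rw [hT.r_T _ h5, hpow z h6] at h7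
    have e : relDev a (fun j x => ω j (T x)) i z =
        (ω (i + 1) (T z⁻¹) - a (i + 1)) / (2 * a (i + 1)) := by
      rw [relDev]
      field_simp
    rw [e, Real.norm_eq_abs, abs_div, abs_mul, Real.norm_of_nonneg (Real.rpow_nonneg h6.le δ)]
    have h8 : 0 < |a (i + 1)| := abs_pos.2 h3
    rw [div_mul_eq_mul_div, abs_two, div_le_div_iff₀ (by positivity) h8]
    have h9 := (abs_nonneg _).trans h7
    nlinarith
  · refine IsBigO.of_bound (C / |a (i + 1)|) ?_
    filter_upwards [hTz.eventually hC, hrh, self_mem_nhdsWithin,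
      (h.tendsto_Psi.comp hTz).eventually_const_lt (show (1 / 2 : ℝ) < 1 by norm_num)]
      with z h4 h5 h6 h10
    have h6 : 0 < z := h6
    have h7 := (h4 (i + 1) (by omega) hi).2
    rw [hT.r_T _ h5, hpow z h6] at h7
    have hΨ : 1 / 2 < Ψ (T z⁻¹) := h10
    have e : relVel a (fun j x => ω j (T x)) i z =
        -((z⁻¹ * U (i + 1) (T z⁻¹)) / (2 * Ψ (T z⁻¹) * a (i + 1))) := by
      rw [relVel, (h.hasDerivAt_omega_comp hT h5 (by omega : 1 ≤ i + 1) hi).deriv]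
      have : Ψ (T z⁻¹) ≠ 0 := by linarith
      field_simp
    have h8 : 0 < |a (i + 1)| := abs_pos.2 h3
    rw [e, norm_neg, Real.norm_eq_abs, abs_div, abs_mul (2 * Ψ _),
      Real.norm_of_nonneg (Real.rpow_nonneg h6.le δ), abs_of_pos (show 0 < 2 * Ψ (T z⁻¹) by linarith),
      div_mul_eq_mul_div, div_le_div_iff₀ (mul_pos (by linarith) h8) h8]
    have h9 := (abs_nonneg _).trans h7
    calc _ ≤ (C * z ^ δ) * |a (i + 1)| := by gcongr
      _ ≤ (C * z ^ δ) * (2 * Ψ (T z⁻¹) * |a (i + 1)|) := by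
        refine mul_le_mul_of_nonneg_left ?_ h9
        nlinarith

end IsExteriorSolution

end

/-! ### Decay estimates for the scalar equation `z f' = c f + F` -/

noncomputable section

section FuchsianEstimates

/-- Oscillation bound for a function whose derivative is bounded by a power. -/
theorem exists_abs_sub_le_of_hasDerivAt_isBigO_rpow {g g' : ℝ → ℝ} {e : ℝ} (he : e ≠ 0)
    (hg : ∀ᶠ z in 𝓝[>] (0 : ℝ), HasDerivAt g (g' z) z)
    (hO : g' =O[𝓝[>] 0] fun z => z ^ (e - 1)) :
    ∃ C, 0 ≤ C ∧ ∃ z₀ > (0 : ℝ), ∀ x y, 0 < x → x ≤ y → y < z₀ →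
      |g y - g x| ≤ C * |y ^ e - x ^ e| := by
  obtain ⟨K, hK, hO⟩ := hO.exists_pos
  obtain ⟨z₀, hz₀, hev⟩ := mem_nhdsGT_iff_exists_Ioo_subset.1 (hg.and hO.bound)
  have hev : ∀ z, 0 < z → z < z₀ → HasDerivAt g (g' z) z ∧ |g' z| ≤ K * z ^ (e - 1) := by
    intro z h1 h2
    have := hev ⟨h1, h2⟩
    rwa [Set.mem_ofPred_eq, Real.norm_eq_abs, Real.norm_of_nonneg (Real.rpow_nonneg h1.le _)] at this
  refine ⟨K / |e|, by positivity, z₀, hz₀, fun x y hx hxy hy => ?_⟩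
  have hpow : ∀ z > 0, HasDerivAt (fun z : ℝ => K / e * z ^ e) (K * z ^ (e - 1)) z := by
    intro z hz
    refine ((Real.hasDerivAt_rpow_const (Or.inl (ne_of_gt hz))).const_mul (K / e)).congr_deriv ?_
    field_simp
  have hb : |g y - g x| ≤ K / e * (y ^ e - x ^ e) := by
    have h1 := sub_le_mul_of_hasDerivAt_le (C := 0) (f := fun z => g z - K / e * z ^ e)
      (f' := fun z => g' z - K * z ^ (e - 1)) hxy
      (fun t ht => (hev t (hx.trans_le ht.1) (ht.2.trans_lt hy)).1.fun_sub
        (hpow t (hx.trans_le ht.1)))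
      fun t ht => by linarith [(abs_le.1 (hev t (hx.trans ht.1) (ht.2.trans hy)).2).2]
    have h2 := sub_le_mul_of_hasDerivAt_le (C := 0) (f := fun z => -g z - K / e * z ^ e)
      (f' := fun z => -g' z - K * z ^ (e - 1)) hxy
      (fun t ht => (hev t (hx.trans_le ht.1) (ht.2.trans_lt hy)).1.fun_neg.fun_sub
        (hpow t (hx.trans_le ht.1)))
      fun t ht => by linarith [(abs_le.1 (hev t (hx.trans ht.1) (ht.2.trans hy)).2).1]
    rw [abs_le]
    constructor <;> linarith
  calc _ ≤ K / e * (y ^ e - x ^ e) := hb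
    _ ≤ |K / e * (y ^ e - x ^ e)| := le_abs_self _
    _ = _ := by rw [abs_mul, abs_div, abs_of_pos hK]

theorem tendsto_rpow_nhdsGT_zero {e : ℝ} (he : 0 < e) :
    Tendsto (fun z : ℝ => z ^ e) (𝓝[>] 0) (𝓝 0) := by
  have := (Real.continuousAt_rpow_const 0 e (Or.inr he.le)).tendsto
  rw [Real.zero_rpow he.ne'] at this
  exact this.mono_left nhdsWithin_le_nhds

theorem rpow_isBigO_rpow_nhdsGT_zero {p q : ℝ} (h : q ≤ p) :
    (fun z : ℝ => z ^ p) =O[𝓝[>] 0] fun z => z ^ q := by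
  refine IsBigO.of_bound 1 ?_
  filter_upwards [Ioo_mem_nhdsGT (zero_lt_one' ℝ)] with z hz
  rw [Real.norm_of_nonneg (Real.rpow_nonneg hz.1.le _),
    Real.norm_of_nonneg (Real.rpow_nonneg hz.1.le _), one_mul]
  exact Real.rpow_le_rpow_of_exponent_ge hz.1 hz.2.le h

variable {f F : ℝ → ℝ} {c p : ℝ}

/-- Variation of constants: `z ^ (-c)` removes the homogeneous solution `z ^ c`. -/
theorem hasDerivAt_rpow_neg_mul_of_fuchsian {z : ℝ} (hz : 0 < z)
    (h : HasDerivAt f ((c * f z + F z) / z) z) :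
    HasDerivAt (fun z => z ^ (-c) * f z) (z ^ (-c) * F z / z) z := by
  refine ((Real.hasDerivAt_rpow_const (p := -c) (Or.inl hz.ne')).fun_mul h).congr_deriv ?_
  rw [Real.rpow_sub_one hz.ne']
  field_simp
  ring

theorem isBigO_rpow_neg_mul_div (hF : F =O[𝓝[>] 0] fun z => z ^ p) :
    (fun z => z ^ (-c) * F z / z) =O[𝓝[>] 0] fun z => z ^ (p - c - 1) := by
  have h1 := ((isBigO_refl (fun z : ℝ => z ^ (-c)) (𝓝[>] 0)).mul hF).mul
    (isBigO_refl (fun z : ℝ => z⁻¹) (𝓝[>] 0))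
  refine h1.congr' (Eventually.of_forall fun z => (div_eq_mul_inv _ _).symm) ?_
  filter_upwards [self_mem_nhdsWithin] with z hz
  have hz : 0 < z := hz
  rw [← Real.rpow_add hz, Real.rpow_sub_one hz.ne', div_eq_mul_inv]
  congr 2
  ring

theorem exists_osc_bound_of_fuchsian (hf : ∀ᶠ z in 𝓝[>] (0 : ℝ), HasDerivAt f ((c * f z + F z) / z) z)
    (hF : F =O[𝓝[>] 0] fun z => z ^ p) (hpc : p ≠ c) :
    ∃ C, 0 ≤ C ∧ ∃ z₀ > (0 : ℝ), ∀ x y, 0 < x → x ≤ y → y < z₀ →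
      |y ^ (-c) * f y - x ^ (-c) * f x| ≤ C * |y ^ (p - c) - x ^ (p - c)| := by
  refine exists_abs_sub_le_of_hasDerivAt_isBigO_rpow (sub_ne_zero.2 hpc)
    (g := fun z => z ^ (-c) * f z) ?_ (isBigO_rpow_neg_mul_div (c := c) hF)
  filter_upwards [hf, self_mem_nhdsWithin] with z h1 h2
  exact hasDerivAt_rpow_neg_mul_of_fuchsian h2 h1

theorem isBigO_of_isBigO_rpow_neg_mul {q : ℝ}
    (h : (fun z => z ^ (-c) * f z) =O[𝓝[>] 0] fun z => z ^ (q - c)) :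
    f =O[𝓝[>] 0] fun z => z ^ q := by
  refine ((isBigO_refl (fun z : ℝ => z ^ c) (𝓝[>] 0)).mul h).congr' ?_ ?_
  · filter_upwards [self_mem_nhdsWithin] with z hz
    have hz : 0 < z := hz
    rw [← mul_assoc, ← Real.rpow_add hz, add_neg_cancel, Real.rpow_zero, one_mul]
  · filter_upwards [self_mem_nhdsWithin] with z hz
    have hz : 0 < z := hz
    rw [← Real.rpow_add hz]
    congr 1
    ring

/-- A source that decays slower than the homogeneous solution determines the decay. -/
theorem isBigO_rpow_of_fuchsian_of_lt
    (hf : ∀ᶠ z in 𝓝[>] (0 : ℝ), HasDerivAt f ((c * f z + F z) / z) z)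
    (hF : F =O[𝓝[>] 0] fun z => z ^ p) (hpc : p < c) : f =O[𝓝[>] 0] fun z => z ^ p := by
  obtain ⟨C, hC, z₀, hz₀, H⟩ := exists_osc_bound_of_fuchsian hf hF hpc.ne
  apply isBigO_of_isBigO_rpow_neg_mul (c := c)
  set y := min (z₀ / 2) 1 with hy
  have hy0 : 0 < y := lt_min (half_pos hz₀) one_pos
  have hyz : y < z₀ := (min_le_left _ _).trans_lt (half_lt_self hz₀)
  refine IsBigO.of_bound (|y ^ (-c) * f y| + C * (y ^ (p - c) + 1)) ?_
  filter_upwards [Ioo_mem_nhdsGT hy0] with x hx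
  have h1 := H x y hx.1 hx.2.le hyz
  have hx1 : 1 ≤ x ^ (p - c) := Real.one_le_rpow_of_pos_of_le_one_of_nonpos hx.1
    (hx.2.le.trans (min_le_right _ _)) (by linarith)
  have hyp : 0 < y ^ (p - c) := Real.rpow_pos_of_pos hy0 _
  rw [Real.norm_eq_abs, Real.norm_of_nonneg (by linarith)]
  have h2 : |y ^ (p - c) - x ^ (p - c)| ≤ y ^ (p - c) + x ^ (p - c) := by
    rw [abs_le]
    constructor <;> linarith
  have h3 : |x ^ (-c) * f x| ≤ |y ^ (-c) * f y| + C * (y ^ (p - c) + x ^ (p - c)) := by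
    have := abs_sub_abs_le_abs_sub (x ^ (-c) * f x) (y ^ (-c) * f y)
    rw [abs_sub_comm] at this
    have := mul_le_mul_of_nonneg_left h2 hC
    linarith
  refine h3.trans ?_
  rw [add_mul, mul_assoc, add_mul, one_mul]
  gcongr
  · exact le_mul_of_one_le_right (abs_nonneg _) hx1
  · exact le_mul_of_one_le_right hyp.le hx1

/-- A source that decays faster than the homogeneous solution leaves a leading coefficient. -/
theorem exists_tendsto_of_fuchsian_of_lt
    (hf : ∀ᶠ z in 𝓝[>] (0 : ℝ), HasDerivAt f ((c * f z + F z) / z) z)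
    (hF : F =O[𝓝[>] 0] fun z => z ^ p) (hpc : c < p) :
    ∃ L, Tendsto (fun z => z ^ (-c) * f z) (𝓝[>] 0) (𝓝 L) := by
  obtain ⟨C, hC, z₀, hz₀, H⟩ := exists_osc_bound_of_fuchsian hf hF hpc.ne'
  apply cauchy_map_iff_exists_tendsto.1
  rw [Metric.cauchy_iff]
  refine ⟨inferInstance, fun ε hε => ?_⟩
  have hlim := (tendsto_rpow_nhdsGT_zero (sub_pos.2 hpc)).const_mul C
  rw [mul_zero] at hlim
  have hev := (hlim.eventually_lt_const hε).and (Ioo_mem_nhdsGT hz₀)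
  refine ⟨_, image_mem_map hev, ?_⟩
  have key : ∀ x y, 0 < x → x ≤ y → y < z₀ → C * y ^ (p - c) < ε →
      |y ^ (-c) * f y - x ^ (-c) * f x| < ε := by
    intro x y hx hxy hy hyε
    refine (H x y hx hxy hy).trans_lt (lt_of_le_of_lt (mul_le_mul_of_nonneg_left ?_ hC) hyε)
    have h1 := Real.rpow_le_rpow hx.le hxy (sub_pos.2 hpc).le
    have h2 := Real.rpow_nonneg hx.le (p - c)
    rw [abs_of_nonneg (by linarith)]
    linarith
  rintro _ ⟨x, hx, rfl⟩ _ ⟨y, hy, rfl⟩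
  rcases le_total x y with hxy | hxy
  · rw [dist_comm]
    exact key x y hx.2.1 hxy hy.2.2 hy.1
  · exact key y x hy.2.1 hxy hx.2.2 hx.1

/-- When the coefficient of `z ^ c` vanishes, integrating from `0` leaves only the contribution of
the source. -/
theorem isBigO_rpow_of_fuchsian_of_tendsto_zero
    (hf : ∀ᶠ z in 𝓝[>] (0 : ℝ), HasDerivAt f ((c * f z + F z) / z) z)
    (hF : F =O[𝓝[>] 0] fun z => z ^ p) (hpc : c < p)
    (h0 : Tendsto (fun z => z ^ (-c) * f z) (𝓝[>] 0) (𝓝 0)) : f =O[𝓝[>] 0] fun z => z ^ p := by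
  obtain ⟨C, hC, z₀, hz₀, H⟩ := exists_osc_bound_of_fuchsian hf hF hpc.ne'
  apply isBigO_of_isBigO_rpow_neg_mul (c := c)
  refine IsBigO.of_bound C ?_
  filter_upwards [Ioo_mem_nhdsGT hz₀] with y hy
  have h1 : Tendsto (fun x => |y ^ (-c) * f y - x ^ (-c) * f x|) (𝓝[>] 0)
      (𝓝 |y ^ (-c) * f y - 0|) := (h0.const_sub _).abs
  have h2 : Tendsto (fun x => C * |y ^ (p - c) - x ^ (p - c)|) (𝓝[>] 0)
      (𝓝 (C * |y ^ (p - c) - 0|)) :=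
    (((tendsto_rpow_nhdsGT_zero (sub_pos.2 hpc)).const_sub _).abs).const_mul C
  rw [sub_zero] at h1 h2
  refine le_of_tendsto_of_tendsto h1 h2 ?_
  filter_upwards [Ioo_mem_nhdsGT hy.1] with x hx
  exact H x y hx.1 hx.2.le hy.2

end FuchsianEstimates

end

/-! ### Bootstrap to the resonance-free scaling -/

noncomputable section

/-- The ring of functions bounded along a filter. -/
def boundedSubring {X : Type*} (l : Filter X) : Subring (X → ℝ) where
  carrier := {f | f =O[l] fun _ => (1 : ℝ)}
  mul_mem' {f g} hf hg := by
    have := IsBigO.mul (show f =O[l] fun _ => (1 : ℝ) from hf) (show g =O[l] fun _ => (1 : ℝ) from hg)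
    simp only [one_mul] at this
    exact this
  one_mem' := isBigO_refl _ _
  add_mem' {f g} hf hg := IsBigO.add (show f =O[l] fun _ => (1 : ℝ) from hf) hg
  zero_mem' := isBigO_zero _ _
  neg_mem' {f} hf := IsBigO.neg_left (show f =O[l] fun _ => (1 : ℝ) from hf)

theorem mem_boundedSubring {X : Type*} {l : Filter X} {f : X → ℝ} :
    f ∈ boundedSubring l ↔ f =O[l] fun _ => (1 : ℝ) := Iff.rfl

/-- The field equations in the variable `z = 1 / r` near `z = 0`. -/
structure IsAsymptoticSolution (N : ℕ) (u g : ℕ → ℝ → ℝ) (m : ℝ → ℝ) : Prop where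
  hasDerivAt_dev : ∀ᶠ z in 𝓝[>] (0 : ℝ), ∀ i, i + 1 < N → HasDerivAt (u i) (g i z / z) z
  hasDerivAt_vel : ∀ᶠ z in 𝓝[>] (0 : ℝ), ∀ i, i + 1 < N → HasDerivAt (g i)
    ((-g i z + gaugeForce N z (1 - 2 * z * m z)⁻¹ (m z) (fun i => u i z) (fun i => g i z) i) / z) z
  hasDerivAt_mass : ∀ᶠ z in 𝓝[>] (0 : ℝ), HasDerivAt m (-(4 * (1 - 2 * z * m z) *
    scaledKinetic N (fun i => g i z) + 4 * scaledPotential N (fun i => u i z))) z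
  exists_tendsto_mass : ∃ M, Tendsto m (𝓝[>] 0) (𝓝 M)

namespace IsAsymptoticSolution

variable {N : ℕ} {u g : ℕ → ℝ → ℝ} {m : ℝ → ℝ} {α : ℝ} {l : ℕ}

/-- The nonlinear part of the gauge field equations in the Newton basis. -/
def source (N : ℕ) (u g : ℕ → ℝ → ℝ) (m : ℝ → ℝ) (l : ℕ) (z : ℝ) : ℝ :=
  newtonCoeff l (gaugeForce N z (1 - 2 * z * m z)⁻¹ (m z) (fun i => u i z) (fun i => g i z))
    - (l + 1) * (l + 2) * newtonCoeff l (fun i => u i z)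

theorem tendsto_one_sub (h : IsAsymptoticSolution N u g m) :
    Tendsto (fun z => 1 - 2 * z * m z) (𝓝[>] 0) (𝓝 1) := by
  obtain ⟨M, hM⟩ := h.exists_tendsto_mass
  have hz : Tendsto (fun z : ℝ => z) (𝓝[>] 0) (𝓝 0) := nhdsWithin_le_nhds
  have := (((hz.const_mul 2).mul hM).const_sub 1)
  simpa using this

theorem hasDerivAt_newtonCoeff_dev (h : IsAsymptoticSolution N u g m) :
    ∀ᶠ z in 𝓝[>] (0 : ℝ), ∀ l < N - 1, HasDerivAt (fun z => newtonCoeff l fun i => u i z)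
      ((newtonCoeff l fun i => g i z) / z) z := by
  filter_upwards [h.hasDerivAt_dev] with z hz l hl
  simp only [newtonCoeff_apply, Finset.sum_div, mul_div_assoc]
  refine HasDerivAt.fun_sum fun k hk => (hz k ?_).const_mul _
  rw [Finset.mem_range] at hk
  omega

theorem hasDerivAt_newtonCoeff_vel (h : IsAsymptoticSolution N u g m) :
    ∀ᶠ z in 𝓝[>] (0 : ℝ), ∀ l < N - 1, HasDerivAt (fun z => newtonCoeff l fun i => g i z)
      ((-(newtonCoeff l fun i => g i z) + (l + 1) * (l + 2) * (newtonCoeff l fun i => u i z) +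
        source N u g m l z) / z) z := by
  filter_upwards [h.hasDerivAt_vel] with z hz l hl
  have e : -(newtonCoeff l fun i => g i z) + (l + 1) * (l + 2) * (newtonCoeff l fun i => u i z) +
        source N u g m l z = newtonCoeff l fun i => -g i z +
          gaugeForce N z (1 - 2 * z * m z)⁻¹ (m z) (fun i => u i z) (fun i => g i z) i := by
    have : (fun i => -g i z +
        gaugeForce N z (1 - 2 * z * m z)⁻¹ (m z) (fun i => u i z) (fun i => g i z) i) =
        -(fun i => g i z) +
        gaugeForce N z (1 - 2 * z * m z)⁻¹ (m z) (fun i => u i z) (fun i => g i z) := rfl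
    rw [this, map_add, map_neg, source]
    ring
  rw [e]
  simp only [newtonCoeff_apply, Finset.sum_div, mul_div_assoc]
  refine HasDerivAt.fun_sum fun k hk => (hz k ?_).const_mul _
  rw [Finset.mem_range] at hk
  omega

theorem isBigO_inv_one_sub (h : IsAsymptoticSolution N u g m) :
    (fun z => (1 - 2 * z * m z)⁻¹) =O[𝓝[>] 0] fun _ => (1 : ℝ) :=
  (h.tendsto_one_sub.inv₀ one_ne_zero).isBigO_one ℝ

/-- Write `z = s ζ` with `s = z ^ α` and `ζ = z ^ (1 - α)`, both bounded. The source is then `s ^ (l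
+ 2)` times a polynomial in bounded quantities. -/
theorem isBigO_source (h : IsAsymptoticSolution N u g m) (hα0 : 0 ≤ α) (hα1 : α ≤ 1)
    (hu : ∀ l < N - 1, (fun z => newtonCoeff l fun i => u i z) =O[𝓝[>] 0]
      fun z => z ^ (α * (l + 1)))
    (hg : ∀ l < N - 1, (fun z => newtonCoeff l fun i => g i z) =O[𝓝[>] 0]
      fun z => z ^ (α * (l + 1)))
    (hl : l < N - 1) : source N u g m l =O[𝓝[>] 0] fun z => z ^ (α * (l + 2)) := by
  obtain ⟨M, hM⟩ := h.exists_tendsto_mass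
  have hpow : ∀ z > (0 : ℝ), ∀ k : ℕ, z ^ (α * (k : ℝ)) = (z ^ α) ^ k := fun z hz k => by
    rw [Real.rpow_mul hz.le, Real.rpow_natCast]
  have hscale : ∀ v : ℕ → ℝ → ℝ, (∀ l < N - 1, (fun z => newtonCoeff l fun i => v i z)
      =O[𝓝[>] 0] fun z => z ^ (α * (l + 1))) → ∀ l, (fun z => if l < N - 1 then
        (newtonCoeff l fun i => v i z) / (z ^ α) ^ (l + 1) else 0) ∈ boundedSubring (𝓝[>] 0) := by
    intro v hv l
    rw [mem_boundedSubring]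
    split_ifs with hl
    · refine ((hv l hl).mul (isBigO_refl (fun z : ℝ => ((z ^ α) ^ (l + 1))⁻¹) _)).congr'
        (Eventually.of_forall fun z => (div_eq_mul_inv _ _).symm) ?_
      filter_upwards [self_mem_nhdsWithin] with z hz
      have hz : 0 < z := hz
      rw [← hpow z hz, Nat.cast_add, Nat.cast_one]
      exact mul_inv_cancel₀ (Real.rpow_pos_of_pos hz _).ne'
    · exact isBigO_zero _ _
  have hrpow : ∀ e : ℝ, 0 ≤ e → (fun z : ℝ => z ^ e) ∈ boundedSubring (𝓝[>] (0 : ℝ)) := by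
    intro e he
    rw [mem_boundedSubring]
    simpa only [Real.rpow_zero] using rpow_isBigO_rpow_nhdsGT_zero he
  let B := boundedSubring (𝓝[>] (0 : ℝ))
  let y : ℕ → B := fun l => ⟨_, hscale u hu l⟩
  let η : ℕ → B := fun l => ⟨_, hscale g hg l⟩
  -- Evaluating the polynomial inside the subring of bounded functions yields its boundedness with
  -- no term-by-term estimate.
  let NS : B := scaledForce N (⟨_, hrpow α hα0⟩ : B) ⟨_, hrpow (1 - α) (sub_nonneg.2 hα1)⟩
    ⟨_, mem_boundedSubring.2 h.isBigO_inv_one_sub⟩ ⟨m, mem_boundedSubring.2 (hM.isBigO_one ℝ)⟩ y η l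
  have hNS : ∀ z, (NS : ℝ → ℝ) z = scaledForce N (z ^ α) (z ^ (1 - α)) (1 - 2 * z * m z)⁻¹ (m z)
      (fun l => (y l : ℝ → ℝ) z) (fun l => (η l : ℝ → ℝ) z) l := fun z =>
    map_scaledForce ((Pi.evalRingHom (fun _ : ℝ => ℝ) z).comp B.subtype) N _ _ _ _ y η l
  have hb : (NS : ℝ → ℝ) =O[𝓝[>] 0] fun _ => (1 : ℝ) := NS.2
  have hmain : ∀ᶠ z in 𝓝[>] (0 : ℝ), z ^ (α * (l + 2)) * (NS : ℝ → ℝ) z = source N u g m l z := by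
    filter_upwards [self_mem_nhdsWithin, h.tendsto_one_sub.eventually_ne one_ne_zero] with z hz hne
    have hz : 0 < z := hz
    have hs : z ^ α ≠ 0 := (Real.rpow_pos_of_pos hz α).ne'
    have hsz : z ^ α * z ^ (1 - α) = z := by
      rw [← Real.rpow_add hz, add_sub_cancel, Real.rpow_one]
    have hyu : ∀ (v : ℕ → ℝ → ℝ), IsScaled (N - 1) (z ^ α) 1 (fun i => v i z) (fun l =>
        if l < N - 1 then (newtonCoeff l fun i => v i z) / (z ^ α) ^ (l + 1) else 0) := by
      intro v l hl
      simp only [if_pos hl]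
      field_simp
    have key := newtonCoeff_gaugeForce (N := N) (s := z ^ α) (ζ := z ^ (1 - α))
      (ν := (1 - 2 * z * m z)⁻¹) (m := m z) (hyu u) (hyu g)
      (by rw [hsz]; exact inv_mul_cancel₀ hne) hl
    rw [hsz, if_pos hl, mul_div_cancel₀ _ (pow_ne_zero _ hs)] at key
    have e : z ^ (α * (l + 2)) = (z ^ α) ^ (l + 2) := by
      rw [← hpow z hz]
      push_cast
      rfl
    rw [source, key, hNS, e, add_sub_cancel_left]
  have := (isBigO_refl (fun z : ℝ => z ^ (α * (l + 2))) (𝓝[>] 0)).mul hb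
  simp only [mul_one] at this
  exact this.congr' hmain EventuallyEq.rfl

/-- The growing combination of the Newton coefficients. -/
theorem hasDerivAt_grow (h : IsAsymptoticSolution N u g m) (hl : l < N - 1) :
    ∀ᶠ z in 𝓝[>] (0 : ℝ), HasDerivAt
      (fun z => (newtonCoeff l fun i => g i z) + (l + 2) * (newtonCoeff l fun i => u i z))
      (((l + 1 : ℝ) * ((newtonCoeff l fun i => g i z) + (l + 2) * (newtonCoeff l fun i => u i z))
        + source N u g m l z) / z) z := by
  filter_upwards [h.hasDerivAt_newtonCoeff_dev, h.hasDerivAt_newtonCoeff_vel] with z h1 h2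
  refine ((h2 l hl).fun_add ((h1 l hl).const_mul (l + 2 : ℝ))).congr_deriv ?_
  ring

/-- The decaying combination of the Newton coefficients. -/
theorem hasDerivAt_decay (h : IsAsymptoticSolution N u g m) (hl : l < N - 1) :
    ∀ᶠ z in 𝓝[>] (0 : ℝ), HasDerivAt
      (fun z => (newtonCoeff l fun i => g i z) - (l + 1) * (newtonCoeff l fun i => u i z))
      ((-(l + 2 : ℝ) * ((newtonCoeff l fun i => g i z) - (l + 1) * (newtonCoeff l fun i => u i z))
        + source N u g m l z) / z) z := by
  filter_upwards [h.hasDerivAt_newtonCoeff_dev, h.hasDerivAt_newtonCoeff_vel] with z h1 h2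
  refine ((h2 l hl).fun_sub ((h1 l hl).const_mul (l + 1 : ℝ))).congr_deriv ?_
  ring

/-- The homogeneous solution `z ^ (-(l + 2))` is excluded because the modes are bounded, so this
combination is exactly as small as its source. -/
theorem isBigO_decay (h : IsAsymptoticSolution N u g m) {p : ℝ} (hp : 0 ≤ p) (hl : l < N - 1)
    (hu : (fun z => newtonCoeff l fun i => u i z) =O[𝓝[>] 0] fun _ => (1 : ℝ))
    (hg : (fun z => newtonCoeff l fun i => g i z) =O[𝓝[>] 0] fun _ => (1 : ℝ))
    (hF : source N u g m l =O[𝓝[>] 0] fun z => z ^ p) :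
    (fun z => (newtonCoeff l fun i => g i z) - (l + 1) * (newtonCoeff l fun i => u i z))
      =O[𝓝[>] 0] fun z => z ^ p := by
  have hl2 : (0 : ℝ) < l + 2 := by positivity
  refine isBigO_rpow_of_fuchsian_of_tendsto_zero (h.hasDerivAt_decay hl) hF (by linarith) ?_
  rw [neg_neg]
  have h1 := (isBigO_refl (fun z : ℝ => z ^ (l + 2 : ℝ)) (𝓝[>] 0)).mul
    (hg.sub (hu.const_mul_left (l + 1 : ℝ)))
  refine h1.trans_tendsto ?_
  simpa using tendsto_rpow_nhdsGT_zero hl2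

/-- The improvement step of the decay estimates. -/
theorem isBigO_step (h : IsAsymptoticSolution N u g m) {β : ℝ} (hα0 : 0 ≤ α) (hα1 : α ≤ 1)
    (hu : ∀ l < N - 1, (fun z => newtonCoeff l fun i => u i z) =O[𝓝[>] 0]
      fun z => z ^ (α * (l + 1)))
    (hg : ∀ l < N - 1, (fun z => newtonCoeff l fun i => g i z) =O[𝓝[>] 0]
      fun z => z ^ (α * (l + 1)))
    (hβ0 : 0 ≤ β) (hβ1 : β < 1) (hβα : β * (N - 1 : ℕ) ≤ α * ((N - 1 : ℕ) + 1)) (hl : l < N - 1) :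
    ((fun z => newtonCoeff l fun i => u i z) =O[𝓝[>] 0] fun z => z ^ (β * (l + 1))) ∧
    ((fun z => newtonCoeff l fun i => g i z) =O[𝓝[>] 0] fun z => z ^ (β * (l + 1))) := by
  have hl' : (l : ℝ) + 1 ≤ (N - 1 : ℕ) := by exact_mod_cast hl
  have hl0 : (0 : ℝ) ≤ l := l.cast_nonneg
  -- The ratio `(l + 2) / (l + 1)` is smallest at the last mode `l = N - 2`, which is where `hβα` is
  -- imposed.
  have hle : β * (l + 1) ≤ α * (l + 2) := by
    have hn : (0 : ℝ) < (N - 1 : ℕ) := by linarith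
    have h1 : β * (N - 1 : ℕ) * (l + 1) ≤ α * ((N - 1 : ℕ) + 1) * (l + 1) := by gcongr
    have h2 : α * ((N - 1 : ℕ) + 1) * (l + 1) ≤ α * (l + 2) * (N - 1 : ℕ) := by nlinarith
    have h3 : β * (l + 1) * (N - 1 : ℕ) ≤ α * (l + 2) * (N - 1 : ℕ) := by linarith
    exact le_of_mul_le_mul_right h3 hn
  have hF := (h.isBigO_source hα0 hα1 hu hg hl).trans (rpow_isBigO_rpow_nhdsGT_zero hle)
  have hbdd : ∀ {f : ℝ → ℝ}, (f =O[𝓝[>] 0] fun z => z ^ (α * (l + 1))) →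
      f =O[𝓝[>] 0] fun _ => (1 : ℝ) := fun hf => by
    have := hf.trans (rpow_isBigO_rpow_nhdsGT_zero (by positivity : (0 : ℝ) ≤ α * (l + 1)))
    simpa only [Real.rpow_zero] using this
  have hs := isBigO_rpow_of_fuchsian_of_lt (h.hasDerivAt_grow hl) hF (by nlinarith)
  have hq := h.isBigO_decay (by positivity) hl (hbdd (hu l hl)) (hbdd (hg l hl)) hF
  have hne : (2 * l + 3 : ℝ) ≠ 0 := by positivity
  constructor
  · refine ((hs.sub hq).const_mul_left ((2 * l + 3 : ℝ)⁻¹)).congr_left fun z => ?_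
    field_simp
    ring
  · refine (((hs.const_mul_left (l + 1 : ℝ)).add (hq.const_mul_left (l + 2 : ℝ))).const_mul_left
      ((2 * l + 3 : ℝ)⁻¹)).congr_left fun z => ?_
    field_simp
    ring

/-- Each step may multiply the weight by `q = N / (N - 1) > 1`, so every weight below `1` is reached
after finitely many steps. The bound `β < 1` keeps the decay slower than the homogeneous solution `z
^ (l + 1)`. -/
theorem isBigO_of_pos (h : IsAsymptoticSolution N u g m) (hα0 : 0 < α)
    (hu : ∀ l < N - 1, (fun z => newtonCoeff l fun i => u i z) =O[𝓝[>] 0]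
      fun z => z ^ (α * (l + 1)))
    (hg : ∀ l < N - 1, (fun z => newtonCoeff l fun i => g i z) =O[𝓝[>] 0]
      fun z => z ^ (α * (l + 1)))
    {β : ℝ} (hβ0 : 0 ≤ β) (hβ1 : β < 1) (hN : 2 ≤ N) : ∀ l < N - 1,
    ((fun z => newtonCoeff l fun i => u i z) =O[𝓝[>] 0] fun z => z ^ (β * (l + 1))) ∧
    ((fun z => newtonCoeff l fun i => g i z) =O[𝓝[>] 0] fun z => z ^ (β * (l + 1))) := by
  have hn : (0 : ℝ) < (N - 1 : ℕ) := by
    have : 0 < N - 1 := by omega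
    exact_mod_cast this
  set q : ℝ := 1 + 1 / (N - 1 : ℕ) with hq
  have hq1 : 1 < q := by
    have : 0 < 1 / ((N - 1 : ℕ) : ℝ) := by positivity
    linarith
  have hqn : q * (N - 1 : ℕ) = (N - 1 : ℕ) + 1 := by
    rw [hq]
    field_simp
  have key : ∀ k : ℕ, ∀ γ : ℝ, 0 ≤ γ → γ < 1 → γ ≤ α * q ^ k → ∀ l < N - 1,
      ((fun z => newtonCoeff l fun i => u i z) =O[𝓝[>] 0] fun z => z ^ (γ * (l + 1))) ∧
      ((fun z => newtonCoeff l fun i => g i z) =O[𝓝[>] 0] fun z => z ^ (γ * (l + 1))) := by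
    intro k
    induction k with
    | zero =>
      intro γ _ _ hγ l hl
      have hle : γ * (l + 1) ≤ α * (l + 1) := by
        have : γ ≤ α := by simpa using hγ
        gcongr
      exact ⟨(hu l hl).trans (rpow_isBigO_rpow_nhdsGT_zero hle),
        (hg l hl).trans (rpow_isBigO_rpow_nhdsGT_zero hle)⟩
    | succ k ih =>
      intro γ hγ0 hγ1 hγ l hl
      have hq0 : 0 < q := by linarith
      have h1 : γ / q < 1 := (div_lt_one hq0).2 (by linarith)
      have ih' := ih (γ / q) (by positivity) h1 (by
        rw [div_le_iff₀ hq0, mul_assoc, ← pow_succ]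
        exact hγ)
      refine h.isBigO_step (by positivity) h1.le (fun l hl => (ih' l hl).1)
        (fun l hl => (ih' l hl).2) hγ0 hγ1 ?_ hl
      rw [← hqn, ← mul_assoc, div_mul_cancel₀ _ hq0.ne']
  obtain ⟨k, hk⟩ := pow_unbounded_of_one_lt (1 / α) hq1
  refine key k β hβ0 hβ1 ?_
  rw [div_lt_iff₀' hα0] at hk
  linarith

/-- The limits of the scaled growing and decaying combinations. -/
theorem exists_tendsto_scaled (h : IsAsymptoticSolution N u g m) (hN : 2 ≤ N) {δ : ℝ} (hδ : 0 < δ)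
    (hu : ∀ i, i + 1 < N → u i =O[𝓝[>] 0] fun z => z ^ δ)
    (hg : ∀ i, i + 1 < N → g i =O[𝓝[>] 0] fun z => z ^ δ) : ∀ l < N - 1,
    (∃ L, Tendsto (fun z => ((newtonCoeff l fun i => g i z)
      + (l + 2) * (newtonCoeff l fun i => u i z)) / z ^ (l + 1)) (𝓝[>] 0) (𝓝 L)) ∧
    Tendsto (fun z => ((newtonCoeff l fun i => g i z)
      - (l + 1) * (newtonCoeff l fun i => u i z)) / z ^ (l + 1)) (𝓝[>] 0) (𝓝 0) := by
  intro l hl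
  have hn : (0 : ℝ) < (N - 1 : ℕ) := by
    have : 0 < N - 1 := by omega
    exact_mod_cast this
  have hl' : (l : ℝ) + 1 ≤ (N - 1 : ℕ) := by exact_mod_cast hl
  have hl0 : (0 : ℝ) ≤ l := l.cast_nonneg
  have hinit : ∀ v : ℕ → ℝ → ℝ, (∀ i, i + 1 < N → v i =O[𝓝[>] 0] fun z => z ^ δ) →
      ∀ l < N - 1, (fun z => newtonCoeff l fun i => v i z) =O[𝓝[>] 0]
        fun z => z ^ (min 1 (δ / (N - 1 : ℕ)) * (l + 1)) := by
    intro v hv l hl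
    have hl' : (l : ℝ) + 1 ≤ (N - 1 : ℕ) := by exact_mod_cast hl
    have h1 : (fun z => newtonCoeff l fun i => v i z) =O[𝓝[>] 0] fun z => z ^ δ := by
      simp only [newtonCoeff_apply]
      refine IsBigO.fun_sum fun k hk => (hv k ?_).const_mul_left _
      rw [Finset.mem_range] at hk
      omega
    refine h1.trans (rpow_isBigO_rpow_nhdsGT_zero ?_)
    calc _ ≤ δ / (N - 1 : ℕ) * (N - 1 : ℕ) := by
          gcongr
          exact min_le_right _ _
      _ = δ := by field_simp
  -- With `n = N - 1`, any `β` strictly between `n / (n + 1)` and `1` works: the source `z ^ (β (l +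
  -- 2))` must be smaller than `z ^ (l + 1)` for every `l < n`.
  set β : ℝ := (2 * (N - 1 : ℕ) + 1) / (2 * (N - 1 : ℕ) + 2) with hβ
  have hβ0 : 0 ≤ β := by positivity
  have hβ1 : β < 1 := by
    rw [hβ, div_lt_one (by positivity)]
    linarith
  have hB := h.isBigO_of_pos (lt_min one_pos (div_pos hδ hn)) (hinit u hu)
    (hinit g hg) hβ0 hβ1 hN
  have hF := h.isBigO_source hβ0 hβ1.le (fun l hl => (hB l hl).1) (fun l hl => (hB l hl).2) hl
  have hlt : (l : ℝ) + 1 < β * (l + 2) := by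
    rw [hβ, div_mul_eq_mul_div, lt_div_iff₀ (by positivity)]
    nlinarith
  have hbdd : ∀ {f : ℝ → ℝ}, (f =O[𝓝[>] 0] fun z => z ^ (β * (l + 1))) →
      f =O[𝓝[>] 0] fun _ => (1 : ℝ) := fun hf => by
    have := hf.trans (rpow_isBigO_rpow_nhdsGT_zero (by positivity : (0 : ℝ) ≤ β * (l + 1)))
    simpa only [Real.rpow_zero] using this
  have hpow : ∀ z > (0 : ℝ), z ^ (-((l : ℝ) + 1)) = (z ^ (l + 1))⁻¹ := fun z hz => by
    rw [Real.rpow_neg hz.le]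
    congr 1
    exact_mod_cast Real.rpow_natCast z (l + 1)
  constructor
  · obtain ⟨L, hL⟩ := exists_tendsto_of_fuchsian_of_lt (h.hasDerivAt_grow hl) hF hlt
    refine ⟨L, hL.congr' ?_⟩
    filter_upwards [self_mem_nhdsWithin] with z hz
    rw [hpow z hz, inv_mul_eq_div]
  · have hq := h.isBigO_decay (by positivity) hl (hbdd (hB l hl).1) (hbdd (hB l hl).2) hF
    have h1 := (isBigO_refl (fun z : ℝ => z ^ (-((l : ℝ) + 1))) (𝓝[>] 0)).mul hq
    have h2 : Tendsto (fun z : ℝ => z ^ (-((l : ℝ) + 1)) * z ^ (β * (l + 2))) (𝓝[>] 0) (𝓝 0) := by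
      refine (tendsto_rpow_nhdsGT_zero (sub_pos.2 hlt)).congr' ?_
      filter_upwards [self_mem_nhdsWithin] with z hz
      have hz : 0 < z := hz
      rw [← Real.rpow_add hz]
      congr 1
      ring
    refine (h1.trans_tendsto h2).congr' ?_
    filter_upwards [self_mem_nhdsWithin] with z hz
    rw [hpow z hz, inv_mul_eq_div]

end IsAsymptoticSolution

end

/-! ### The regular Fuchsian system and analyticity in `1 / r` -/

noncomputable section

/-- The ring of functions analytic at a point. -/
def analyticSubring {E : Type*} [NormedAddCommGroup E] [NormedSpace ℂ E] (p : E) :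
    Subring (E → ℂ) where
  carrier := {f | AnalyticAt ℂ f p}
  mul_mem' {f _} hf hg := AnalyticAt.mul (show AnalyticAt ℂ f p from hf) hg
  one_mem' := analyticAt_const
  add_mem' {f _} hf hg := AnalyticAt.add (show AnalyticAt ℂ f p from hf) hg
  zero_mem' := analyticAt_const
  neg_mem' {f} hf := AnalyticAt.neg (show AnalyticAt ℂ f p from hf)

section FuchsianForm

variable {R : Type*} [CommRing R] (N : ℕ)

/-- The right hand side of the mass equation. -/
def massForce (z m : R) (u g : ℕ → R) : R :=
  -(4 * (1 - 2 * z * m) * scaledKinetic N g + 4 * scaledPotential N u)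

theorem map_massForce {R' : Type*} [CommRing R'] (f : R →+* R') (z m : R) (u g : ℕ → R) :
    f (massForce N z m u g) = massForce N (f z) (f m) (fun i => f (u i)) (fun i => f (g i)) := by
  simp [massForce, map_scaledKinetic, map_scaledPotential, map_ofNat f 2, map_ofNat f 4]

/-- Unknowns of the Fuchsian system: growing and decaying combinations, and the mass. -/
abbrev FuchsIndex (N : ℕ) : Type := Fin (N - 1) ⊕ Fin (N - 1) ⊕ Unit

/-- The indicial exponents of the Fuchsian system. -/
def fuchsExponent : FuchsIndex N → ℕ
  | .inl _ => 0
  | .inr (.inl l) => 2 * l + 3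
  | .inr (.inr _) => 0

variable {N} {K : Type*} [Field K]

/-- The scaled Newton coefficients of the deviations. -/
def fuchsDev (Y : FuchsIndex N → K) (l : ℕ) : K :=
  if h : l < N - 1 then (2 * l + 3 : K)⁻¹ * (Y (.inl ⟨l, h⟩) - Y (.inr (.inl ⟨l, h⟩))) else 0

/-- The scaled Newton coefficients of the velocities. -/
def fuchsVel (Y : FuchsIndex N → K) (l : ℕ) : K :=
  if h : l < N - 1 then
    (2 * l + 3 : K)⁻¹ * ((l + 1) * Y (.inl ⟨l, h⟩) + (l + 2) * Y (.inr (.inl ⟨l, h⟩))) else 0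

/-- The regular part of the Fuchsian system. -/
def fuchsForce (p : K × (FuchsIndex N → K)) : FuchsIndex N → K
  | .inl l => scaledForce N p.1 1 (1 - 2 * p.1 * p.2 (.inr (.inr ())))⁻¹ (p.2 (.inr (.inr ())))
      (fuchsDev p.2) (fuchsVel p.2) l
  | .inr (.inl l) => scaledForce N p.1 1 (1 - 2 * p.1 * p.2 (.inr (.inr ())))⁻¹
      (p.2 (.inr (.inr ()))) (fuchsDev p.2) (fuchsVel p.2) l
  | .inr (.inr _) => massForce N p.1 (p.2 (.inr (.inr ()))) (ofScaled (N - 1) p.1 (fuchsDev p.2))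
      (ofScaled (N - 1) p.1 (fuchsVel p.2))

theorem map_fuchsForce {K' : Type*} [Field K'] (f : K →+* K') (z : K) (Y : FuchsIndex N → K)
    (i : FuchsIndex N) : f (fuchsForce (z, Y) i) = fuchsForce (f z, fun i => f (Y i)) i := by
  have hd : (fun l => f (fuchsDev Y l)) = fuchsDev fun i => f (Y i) := by
    ext l
    unfold fuchsDev
    split_ifs <;> simp [map_ofNat f 2, map_ofNat f 3]
  have hv : (fun l => f (fuchsVel Y l)) = fuchsVel fun i => f (Y i) := by
    ext l
    unfold fuchsVel
    split_ifs <;> simp [map_ofNat f 2, map_ofNat f 3]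
  have hν : f (1 - 2 * z * Y (.inr (.inr ())))⁻¹ =
      (1 - 2 * f z * f (Y (.inr (.inr ()))))⁻¹ := by
    simp [map_ofNat f 2]
  rcases i with l | l | _
  · simp only [fuchsForce, map_scaledForce, hd, hv, hν, map_one]
  · simp only [fuchsForce, map_scaledForce, hd, hv, hν, map_one]
  · simp only [fuchsForce, map_massForce, map_ofScaled, hd, hv]

/-- The only division depending on the unknowns is by `1 - 2 z m`, which equals `1` at `z = 0`; the
rest is polynomial and is evaluated in the ring of functions analytic at the point. -/
theorem analyticAt_fuchsForce (Y₀ : FuchsIndex N → ℂ) :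
    AnalyticAt ℂ (fuchsForce (N := N) (K := ℂ)) (0, Y₀) := by
  let A := analyticSubring ((0 : ℂ), Y₀)
  have hY : ∀ i, (fun p : ℂ × (FuchsIndex N → ℂ) => p.2 i) ∈ A := fun i =>
    analyticAt_pi_iff.1 (show AnalyticAt ℂ (fun p : ℂ × (FuchsIndex N → ℂ) => p.2) (0, Y₀) from
      analyticAt_snd) i
  have hc : ∀ c : ℂ, (fun _ : ℂ × (FuchsIndex N → ℂ) => c) ∈ A := fun c => analyticAt_const
  have hz : (fun p : ℂ × (FuchsIndex N → ℂ) => p.1) ∈ A := analyticAt_fst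
  have hν : (fun p : ℂ × (FuchsIndex N → ℂ) => (1 - 2 * p.1 * p.2 (.inr (.inr ())))⁻¹) ∈ A := by
    have h1 : (fun p : ℂ × (FuchsIndex N → ℂ) => 1 - 2 * p.1 * p.2 (.inr (.inr ()))) ∈ A :=
      A.sub_mem (hc 1) (A.mul_mem (A.mul_mem (hc 2) hz) (hY _))
    exact AnalyticAt.inv h1 (by simp)
  have hdev : ∀ l, (fun p : ℂ × (FuchsIndex N → ℂ) => fuchsDev p.2 l) ∈ A := by
    intro l
    unfold fuchsDev
    split_ifs
    · exact A.mul_mem (hc _) (A.sub_mem (hY _) (hY _))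
    · exact hc 0
  have hvel : ∀ l, (fun p : ℂ × (FuchsIndex N → ℂ) => fuchsVel p.2 l) ∈ A := by
    intro l
    unfold fuchsVel
    split_ifs
    · exact A.mul_mem (hc _) (A.add_mem (A.mul_mem (hc _) (hY _)) (A.mul_mem (hc _) (hY _)))
    · exact hc 0
  let ev : ℂ × (FuchsIndex N → ℂ) → A →+* ℂ := fun p => (Pi.evalRingHom _ p).comp A.subtype
  have hev : ∀ p f (hf : f ∈ A), ev p ⟨f, hf⟩ = f p := fun _ _ _ => rfl
  let sf : ℕ → A := scaledForce N ⟨_, hz⟩ 1 ⟨_, hν⟩ ⟨_, hY (.inr (.inr ()))⟩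
    (fun l => ⟨_, hdev l⟩) (fun l => ⟨_, hvel l⟩)
  let mf : A := massForce N ⟨_, hz⟩ ⟨_, hY (.inr (.inr ()))⟩
    (ofScaled (N - 1) ⟨_, hz⟩ fun l => ⟨_, hdev l⟩) (ofScaled (N - 1) ⟨_, hz⟩ fun l => ⟨_, hvel l⟩)
  have hsf : ∀ l, (sf l : ℂ × (FuchsIndex N → ℂ) → ℂ) = fun p => scaledForce N p.1 1
      (1 - 2 * p.1 * p.2 (.inr (.inr ())))⁻¹ (p.2 (.inr (.inr ()))) (fuchsDev p.2)
      (fuchsVel p.2) l := by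
    intro l
    ext p
    have e : ev p (sf l) = _ := map_scaledForce (ev p) N _ _ _ _ _ _ l
    simp only [hev] at e
    exact e
  have hmf : (mf : ℂ × (FuchsIndex N → ℂ) → ℂ) = fun p => massForce N p.1 (p.2 (.inr (.inr ())))
      (ofScaled (N - 1) p.1 (fuchsDev p.2)) (ofScaled (N - 1) p.1 (fuchsVel p.2)) := by
    ext p
    have e : ev p mf = _ := map_massForce N (ev p) _ _ _ _
    simp only [map_ofScaled] at e
    simp only [hev] at e
    exact e
  refine AnalyticAt.pi fun i => ?_
  rcases i with l | l | _
  · have := (sf l).2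
    rwa [hsf l] at this
  · have := (sf l).2
    rwa [hsf l] at this
  · have := mf.2
    rwa [hmf] at this

end FuchsianForm

namespace IsAsymptoticSolution

variable {N : ℕ} {u g : ℕ → ℝ → ℝ} {m : ℝ → ℝ} {l : ℕ}

/-- The unknowns of the Fuchsian system attached to a solution. -/
def fuchsVars (N : ℕ) (u g : ℕ → ℝ → ℝ) (m : ℝ → ℝ) (z : ℝ) : FuchsIndex N → ℝ
  | .inl l => ((newtonCoeff l fun i => g i z) + (l + 2) * (newtonCoeff l fun i => u i z))
      / z ^ ((l : ℕ) + 1)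
  | .inr (.inl l) => ((newtonCoeff l fun i => g i z) - (l + 1) * (newtonCoeff l fun i => u i z))
      / z ^ ((l : ℕ) + 1)
  | .inr (.inr _) => m z

theorem fuchsDev_fuchsVars {z : ℝ} (hl : l < N - 1) :
    fuchsDev (fuchsVars N u g m z) l = (newtonCoeff l fun i => u i z) / z ^ (l + 1) := by
  have : (2 * l + 3 : ℝ) ≠ 0 := by positivity
  rw [fuchsDev, dif_pos hl]
  simp only [fuchsVars]
  field_simp
  ring

theorem fuchsVel_fuchsVars {z : ℝ} (hl : l < N - 1) :
    fuchsVel (fuchsVars N u g m z) l = (newtonCoeff l fun i => g i z) / z ^ (l + 1) := by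
  have : (2 * l + 3 : ℝ) ≠ 0 := by positivity
  rw [fuchsVel, dif_pos hl]
  simp only [fuchsVars]
  field_simp
  ring

theorem isScaled_fuchsDev {z : ℝ} (hz : z ≠ 0) :
    IsScaled (N - 1) z 1 (fun i => u i z) (fuchsDev (fuchsVars N u g m z)) := by
  intro l hl
  rw [fuchsDev_fuchsVars hl]
  field_simp

theorem isScaled_fuchsVel {z : ℝ} (hz : z ≠ 0) :
    IsScaled (N - 1) z 1 (fun i => g i z) (fuchsVel (fuchsVars N u g m z)) := by
  intro l hl
  rw [fuchsVel_fuchsVars hl]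
  field_simp

theorem source_eq {z : ℝ} (hz : z ≠ 0) (hne : 1 - 2 * z * m z ≠ 0) (hl : l < N - 1) :
    source N u g m l z = z ^ (l + 2) * scaledForce N z 1 (1 - 2 * z * m z)⁻¹ (m z)
      (fuchsDev (fuchsVars N u g m z)) (fuchsVel (fuchsVars N u g m z)) l := by
  have hd := isScaled_fuchsDev (N := N) (u := u) (g := g) (m := m) hz
  have key := newtonCoeff_gaugeForce (ζ := 1) (ν := (1 - 2 * z * m z)⁻¹) (m := m z) hd
    (isScaled_fuchsVel (u := u) (g := g) (m := m) hz) (by rw [mul_one]; exact inv_mul_cancel₀ hne) hl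
  rw [mul_one] at key
  rw [source, key, hd l hl]
  ring

theorem hasDerivAt_div_pow {f : ℝ → ℝ} {z c G : ℝ} (hz : z ≠ 0) (k : ℕ)
    (h : HasDerivAt f ((c * f z + z ^ (k + 1) * G) / z) z) :
    HasDerivAt (fun z => f z / z ^ k) ((c - k) * (f z / z ^ k) / z + G) z := by
  refine (h.fun_div (hasDerivAt_pow k z) (pow_ne_zero k hz)).congr_deriv ?_
  rcases k with _ | k
  · simp
    field_simp
  · simp only [Nat.add_sub_cancel]
    field_simp
    push_cast
    ring

/-- Division by `z ^ (l + 1)` shifts the exponents `l + 1` and `-(l + 2)` to `0` and `-(2l + 3)`.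
The source, of size `z ^ (l + 2)`, becomes regular after this division and the division by `z` in
the equation, so no logarithms arise. -/
theorem hasDerivAt_fuchsVars (h : IsAsymptoticSolution N u g m) :
    ∀ᶠ z in 𝓝[>] (0 : ℝ), ∀ i, HasDerivAt (fun z => fuchsVars N u g m z i)
      (-(fuchsExponent N i : ℝ) * fuchsVars N u g m z i / z
        + fuchsForce (z, fuchsVars N u g m z) i) z := by
  have h1 : ∀ᶠ z in 𝓝[>] (0 : ℝ), ∀ l : Fin (N - 1), _ :=
    eventually_all.2 fun l => h.hasDerivAt_grow l.2
  have h2 : ∀ᶠ z in 𝓝[>] (0 : ℝ), ∀ l : Fin (N - 1), _ :=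
    eventually_all.2 fun l => h.hasDerivAt_decay l.2
  filter_upwards [h1, h2, h.hasDerivAt_mass, self_mem_nhdsWithin,
    h.tendsto_one_sub.eventually_ne one_ne_zero] with z hg hd hm hz hne i
  have hz : z ≠ 0 := ne_of_gt hz
  rcases i with l | l | _
  · have h3 := hg l
    rw [source_eq hz hne l.2] at h3
    refine (hasDerivAt_div_pow hz (l + 1) h3).congr_deriv ?_
    simp [fuchsExponent, fuchsForce, fuchsVars]
  · have h3 := hd l
    rw [source_eq hz hne l.2] at h3
    refine (hasDerivAt_div_pow hz (l + 1) h3).congr_deriv ?_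
    simp only [fuchsExponent, fuchsForce, fuchsVars]
    push_cast
    ring
  · refine HasDerivAt.congr_deriv (f := m) hm ?_
    simp only [fuchsExponent, fuchsForce, fuchsVars, massForce, Nat.cast_zero, neg_zero, zero_mul,
      zero_div, zero_add]
    have e1 := scaledPotential_congr (N := N) fun i hi =>
      (isScaled_fuchsDev (N := N) (u := u) (g := g) (m := m) hz).eq_ofScaled hi
    have e2 : scaledKinetic N (fun i => g i z) =
        scaledKinetic N (ofScaled (N - 1) z (fuchsVel (fuchsVars N u g m z))) :=
      Finset.sum_congr rfl fun i hi => by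
        rw [← (isScaled_fuchsVel (N := N) (u := u) (g := g) (m := m) hz).eq_ofScaled
          (Finset.mem_range.1 hi)]
    rw [e1, e2]

/-- Solutions that decay like a power of `z` are analytic at `z = 0`. -/
theorem exists_analyticAt (h : IsAsymptoticSolution N u g m) (hN : 2 ≤ N) {δ : ℝ} (hδ : 0 < δ)
    (hu : ∀ i, i + 1 < N → u i =O[𝓝[>] 0] fun z => z ^ δ)
    (hg : ∀ i, i + 1 < N → g i =O[𝓝[>] 0] fun z => z ^ δ) :
    (∃ mhat : ℝ → ℝ, AnalyticAt ℝ mhat 0 ∧ ∀ᶠ z in 𝓝[>] 0, m z = mhat z) ∧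
    ∀ i, i + 1 < N → (∃ uhat : ℝ → ℝ, AnalyticAt ℝ uhat 0 ∧ uhat 0 = 0 ∧
      ∀ᶠ z in 𝓝[>] 0, u i z = uhat z) ∧ g i =O[𝓝[>] 0] fun z => z := by
  have hlims := h.exists_tendsto_scaled hN hδ hu hg
  obtain ⟨M, hM⟩ := h.exists_tendsto_mass
  choose L hL using fun l hl => (hlims l hl).1
  -- The limit is `0` wherever the exponent is positive, so `λ (Y - Y₀) = λ Y` and the system has
  -- the required form.
  let Y₀ : FuchsIndex N → ℝ
    | .inl l => L l l.2
    | .inr (.inl _) => 0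
    | .inr (.inr _) => M
  have hY₀ : Tendsto (fuchsVars N u g m) (𝓝[>] 0) (𝓝 Y₀) := by
    rw [tendsto_pi_nhds]
    rintro (l | l | _)
    · exact hL l l.2
    · exact (hlims l l.2).2
    · exact hM
  obtain ⟨H, hH, -, hYH⟩ := exists_analyticAt_of_fuchsian (lam := fuchsExponent N)
    (Y := fun z i => (fuchsVars N u g m z i : ℂ)) (analyticAt_fuchsForce fun i => (Y₀ i : ℂ))
    (by
      rw [tendsto_pi_nhds] at hY₀ ⊢
      exact fun i => (Complex.continuous_ofReal.tendsto _).comp (hY₀ i)) (by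
      filter_upwards [h.hasDerivAt_fuchsVars] with z hz i
      refine (hz i).ofReal_comp.congr_deriv ?_
      have e := map_fuchsForce Complex.ofRealHom z (fuchsVars N u g m z) i
      simp only [Complex.ofRealHom_eq_coe] at e
      push_cast
      rw [e]
      congr 2
      rcases i with l | l | _ <;> simp [fuchsExponent, Y₀])
  have hHi : ∀ i, AnalyticAt ℝ (fun z : ℝ => (H z i).re) 0 := fun i =>
    AnalyticAt.re_ofReal (f := fun z => H z i) (analyticAt_pi_iff.1 hH i)
  have hYi : ∀ᶠ z in 𝓝[>] (0 : ℝ), ∀ i, fuchsVars N u g m z i = (H z i).re := by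
    filter_upwards [hYH] with z hz i
    rw [← hz, Complex.ofReal_re]
  refine ⟨⟨fun z => (H z (.inr (.inr ()))).re, hHi _, ?_⟩, fun i hi => ⟨?_, ?_⟩⟩
  · filter_upwards [hYi] with z hz
    exact hz (.inr (.inr ()))
  · refine ⟨fun z => ofScaled (N - 1) z (fuchsDev fun i => (H z i).re) i, ?_, ?_, ?_⟩
    · unfold ofScaled
      refine Finset.analyticAt_fun_sum _ fun l hl => ?_
      refine ((analyticAt_id.fun_pow (l + 1)).fun_mul ?_).fun_mul analyticAt_const
      simp only [fuchsDev, dif_pos (Finset.mem_range.1 hl)]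
      exact analyticAt_const.fun_mul ((hHi _).fun_sub (hHi _))
    · simp [ofScaled]
    · filter_upwards [hYi, self_mem_nhdsWithin] with z hz hz0
      have hz0 : z ≠ 0 := ne_of_gt hz0
      rw [← funext hz]
      exact (isScaled_fuchsDev hz0).eq_ofScaled (show i < N - 1 by omega)
  · have hbdd : ∀ l < N - 1, (fun z => fuchsVel (fuchsVars N u g m z) l) =O[𝓝[>] 0]
        fun _ => (1 : ℝ) := by
      intro l hl
      simp only [fuchsVel, dif_pos hl]
      rw [tendsto_pi_nhds] at hY₀
      exact ((((hY₀ _).isBigO_one ℝ).const_mul_left _).add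
        (((hY₀ _).isBigO_one ℝ).const_mul_left _)).const_mul_left _
    have hz1 : (fun z : ℝ => z) =O[𝓝[>] 0] fun _ => (1 : ℝ) :=
      (show Tendsto (fun z : ℝ => z) (𝓝[>] 0) (𝓝 0) from nhdsWithin_le_nhds).isBigO_one ℝ
    have hO : (fun z => ofScaled (N - 1) z (fuchsVel (fuchsVars N u g m z)) i)
        =O[𝓝[>] 0] fun z => z := by
      unfold ofScaled
      refine IsBigO.fun_sum fun l hl => ?_
      have h1 := ((((hz1.pow l).mul (isBigO_refl (fun z : ℝ => z) (𝓝[>] 0))).mul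
        (hbdd l (Finset.mem_range.1 hl))).mul
        (isBigO_refl (fun _ : ℝ => (i.choose l : ℝ)) (𝓝[>] 0)))
      have h2 := h1.trans (isBigO_of_le' (c := |(i.choose l : ℝ)|) (g := fun z : ℝ => z) _
        fun z => by simp [mul_comm])
      simpa only [← pow_succ] using h2
    refine hO.congr' ?_ EventuallyEq.rfl
    filter_upwards [self_mem_nhdsWithin] with z hz0
    exact ((isScaled_fuchsVel (ne_of_gt hz0)).eq_ofScaled (show i < N - 1 by omega)).symm

end IsAsymptoticSolution

end

/-! ### Expansions at infinity and membership in the local family -/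

noncomputable section

namespace IsAsymptoticSolution

variable {N : ℕ} {u g : ℕ → ℝ → ℝ} {m : ℝ → ℝ} {M : ℝ}

/-- At the vacuum the potential vanishes to second order and the kinetic term is quadratic.
Integrated, this puts the mass within `O(z³)` of its limit, which is why `μ` has no `r⁻²` or `r⁻³`
term. -/
theorem isBigO_massForce (h : IsAsymptoticSolution N u g m)
    (hu : ∀ i, i + 1 < N → u i =O[𝓝[>] 0] fun z => z)
    (hg : ∀ i, i + 1 < N → g i =O[𝓝[>] 0] fun z => z) :
    (fun z => massForce N z (m z) (fun i => u i z) (fun i => g i z)) =O[𝓝[>] 0]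
      fun z => z ^ 2 := by
  have hz1 : (fun z : ℝ => z) =O[𝓝[>] 0] fun _ => (1 : ℝ) :=
    (show Tendsto (fun z : ℝ => z) (𝓝[>] 0) (𝓝 0) from nhdsWithin_le_nhds).isBigO_one ℝ
  have hK : (fun z => scaledKinetic N fun i => g i z) =O[𝓝[>] 0] fun z => z ^ 2 := by
    unfold scaledKinetic
    refine IsBigO.fun_sum fun i hi => ((hg i ?_).pow 2).const_mul_left _
    rw [Finset.mem_range] at hi
    omega
  have hQ : (fun z => scaledPotential N fun i => u i z) =O[𝓝[>] 0] fun z => z ^ 2 := by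
    have e : (fun z => scaledPotential N fun i => u i z) =
        fun z => scaledPotential N fun i => if i + 1 < N then u i z else 0 := by
      ext z
      exact scaledPotential_congr fun i hi => (if_pos (by omega)).symm
    have hb : ∀ i, (fun z => if i + 1 < N then u i z else 0) =O[𝓝[>] 0] fun z => z := by
      intro i
      split_ifs with hi
      · exact hu i hi
      · exact isBigO_zero _ _
    have hb2 : ∀ i, (fun z => (if i + 1 < N then u i z else 0) +
        (if i + 1 < N then u i z else 0) ^ 2) =O[𝓝[>] 0] fun z => z := by
      intro i
      refine (hb i).add ?_
      have := ((hb i).trans hz1).mul (hb i)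
      simpa only [one_mul, ← pow_two] using this
    rw [e]
    unfold scaledPotential
    exact IsBigO.fun_sum fun j _ => (((hb2 _).const_mul_left _).sub ((hb2 _).const_mul_left _)).pow 2
  have h1 := (((h.tendsto_one_sub.isBigO_one ℝ).const_mul_left 4).mul hK)
  simp only [one_mul] at h1
  exact (h1.add (hQ.const_mul_left 4)).neg_left

theorem isBigO_mass_sub (h : IsAsymptoticSolution N u g m)
    (hu : ∀ i, i + 1 < N → u i =O[𝓝[>] 0] fun z => z)
    (hg : ∀ i, i + 1 < N → g i =O[𝓝[>] 0] fun z => z) (hM : Tendsto m (𝓝[>] 0) (𝓝 M)) :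
    (fun z => m z - M) =O[𝓝[>] 0] fun z => z ^ 3 := by
  have hO := h.isBigO_massForce hu hg
  obtain ⟨C, hC, z₀, hz₀, H⟩ := exists_abs_sub_le_of_hasDerivAt_isBigO_rpow (e := 3) (by norm_num)
    h.hasDerivAt_mass (hO.congr_right fun z => by norm_num)
  refine IsBigO.of_bound C ?_
  filter_upwards [Ioo_mem_nhdsGT hz₀] with y hy
  have h1 : Tendsto (fun x => |m y - m x|) (𝓝[>] 0) (𝓝 |m y - M|) := (hM.const_sub _).abs
  have h2 : Tendsto (fun x : ℝ => C * |y ^ (3 : ℝ) - x ^ (3 : ℝ)|) (𝓝[>] 0)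
      (𝓝 (C * |y ^ (3 : ℝ) - 0|)) :=
    (((tendsto_rpow_nhdsGT_zero (by norm_num)).const_sub _).abs).const_mul C
  have e : y ^ (3 : ℝ) = y ^ 3 := by exact_mod_cast Real.rpow_natCast y 3
  rw [sub_zero, e] at h2
  refine le_of_tendsto_of_tendsto h1 h2 ?_
  filter_upwards [Ioo_mem_nhdsGT hy.1] with x hx
  rw [← e]
  exact H x y hx.1 hx.2.le hy.2

end IsAsymptoticSolution

/-- Second order Taylor expansion of an analytic function vanishing at the origin. -/
theorem AnalyticAt.exists_isBigO_sub_mul {f : ℝ → ℝ} (hf : AnalyticAt ℝ f 0) (h0 : f 0 = 0) :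
    ∃ c, (fun z => f z - c * z) =O[𝓝 0] fun z => z ^ 2 := by
  obtain ⟨p, hp⟩ := hf
  refine ⟨p.coeff 1, ?_⟩
  have h1 := hp.isBigO_sub_partialSum_pow 2
  have hp0 : p.coeff 0 = 0 := (hp.coeff_zero _).trans h0
  refine (h1.congr_left fun z => ?_).congr_right fun z => ?_
  · rw [zero_add, FormalMultilinearSeries.partialSum, Finset.sum_range_succ, Finset.sum_range_one]
    simp [hp0, mul_comm]
  · simp

namespace IsExteriorSolution

variable {N : ℕ} {r Ψ κ S : ℝ → ℝ} {ω U : ℕ → ℝ → ℝ} {rh : ℝ} {T : ℝ → ℝ} {a : ℕ → ℝ}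

theorem isAsymptoticSolution (h : IsExteriorSolution N r Ψ κ S ω U) (hT : IsRadialInverse rh r Ψ T)
    (ha : ∀ j ≤ N, a j ^ 2 = vacuumSq N j)
    (hm : ∃ M, Tendsto (fun x => x * (1 - Ψ (T x) ^ 2) / 2) atTop (𝓝 M)) :
    IsAsymptoticSolution N (relDev a fun j x => ω j (T x)) (relVel a fun j x => ω j (T x))
      (fun z => z⁻¹ * (1 - Ψ (T z⁻¹) ^ 2) / 2) := by
  have hS := h.solvesRadial hT
  have hrh : ∀ᶠ z : ℝ in 𝓝[>] 0, rh < z⁻¹ := tendsto_inv_nhdsGT_zero.eventually_gt_atTop rh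
  have ha' : ∀ j, 1 ≤ j → j < N → a j ^ 2 = vacuumSq N j := fun j _ hj => ha j hj.le
  have hne : ∀ i, i + 1 < N → a (i + 1) ≠ 0 := by
    intro i hi h3
    have h1 := one_le_vacuumSq (show 1 ≤ i + 1 by omega) hi
    have h2 := ha (i + 1) hi.le
    rw [h3] at h2
    linarith
  refine ⟨?_, ?_, ?_, ?_⟩
  · filter_upwards [hrh, self_mem_nhdsWithin] with z h1 h2 i hi
    exact hS.hasDerivAt_relDev h2 h1 hi (hne i hi)
  · filter_upwards [hrh, self_mem_nhdsWithin] with z h1 h2 i hi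
    have hz : z ≠ 0 := ne_of_gt h2
    refine hS.hasDerivAt_relVel ha' h2 h1 ?_ hi (hne i hi)
    have hΨ := (h.Psi_pos _ (hT.pos _ h1)).ne'
    have e : 1 - 2 * z * (z⁻¹ * (1 - Ψ (T z⁻¹) ^ 2) / 2) = Ψ (T z⁻¹) ^ 2 := by
      field_simp
      ring
    rw [e]
    exact pow_ne_zero 2 hΨ
  · filter_upwards [hrh, self_mem_nhdsWithin] with z h1 h2
    exact hS.hasDerivAt_mass ha' h2 h1
  · obtain ⟨M, hM⟩ := hm
    exact ⟨M, hM.comp tendsto_inv_nhdsGT_zero⟩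

/-- The sign `ε_j` is that of `a_j`, so `ε_j a_j = √(j(N-j))`. Since `ω_j = a_j (1 + 2u)` with `u`
analytic and zero at `z = 0`, the constant `c_j` is `-2 √(j(N-j))` times the linear coefficient of
`u`. -/
theorem inLocalFamilyAtInfinity (h : IsExteriorSolution N r Ψ κ S ω U) (hN : 2 ≤ N)
    (hrh : 0 < rh) (hT : IsRadialInverse rh r Ψ T)
    (hω : ∀ i ≤ N, Tendsto (ω i) atTop (𝓝 (a i))) (ha : ∀ j ≤ N, a j ^ 2 = vacuumSq N j)
    (hm : ∃ M, Tendsto (fun x => x * (1 - Ψ (T x) ^ 2) / 2) atTop (𝓝 M)) :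
    InLocalFamilyAtInfinity N (fun x => x * (1 - Ψ (T x) ^ 2) / 2) (fun x => S (T x))
      (fun j x => ω j (T x)) := by
  have hA := h.isAsymptoticSolution hT ha hm
  obtain ⟨δ, hδ, hdec⟩ := h.isBigO_relDev_relVel hT hω ha
  obtain ⟨⟨mhat, hmhat, hmeq⟩, hdev⟩ := hA.exists_analyticAt hN hδ (fun i hi => (hdec i hi).1)
    fun i hi => (hdec i hi).2
  obtain ⟨M, hM⟩ := hm
  have hu : ∀ i, i + 1 < N → relDev a (fun j x => ω j (T x)) i =O[𝓝[>] 0] fun z => z := by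
    intro i hi
    obtain ⟨uhat, h1, h2, h3⟩ := (hdev i hi).1
    have h4 := h1.differentiableAt.isBigO_sub.mono (nhdsWithin_le_nhds (s := Set.Ioi 0))
    simp only [h2, sub_zero] at h4
    exact h4.congr' (h3.mono fun z hz => hz.symm) EventuallyEq.rfl
  have hmO := hA.isBigO_mass_sub hu (fun i hi => (hdev i hi).2) (hM.comp tendsto_inv_nhdsGT_zero)
  have hinv : Tendsto (fun x : ℝ => x⁻¹) atTop (𝓝[>] 0) := tendsto_inv_atTop_nhdsGT_zero
  choose! uhat huhat using fun i hi => (hdev i hi).1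
  choose! c hc using fun i (hi : i + 1 < N) => (huhat i hi).1.exists_isBigO_sub_mul (huhat i hi).2.1
  have hω' : ∀ j, 1 ≤ j → j < N → ∀ᶠ x in atTop, (if 0 < a j then 1 else -1) * ω j (T x) =
      Real.sqrt ((j : ℝ) * ((N : ℝ) - j)) * (1 + 2 * uhat (j - 1) (1 / x)) := by
    intro j h1 hj
    obtain ⟨i, rfl⟩ : ∃ i, j = i + 1 := ⟨j - 1, by omega⟩
    have hpos := one_le_vacuumSq h1 hj
    have haj := ha _ hj.le
    have hne : a (i + 1) ≠ 0 := by
      intro h3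
      rw [h3] at haj
      linarith
    have hsqrt : Real.sqrt (((i + 1 : ℕ) : ℝ) * ((N : ℝ) - (i + 1 : ℕ))) =
        (if 0 < a (i + 1) then 1 else -1) * a (i + 1) := by
      rw [← vacuumSq, ← haj, Real.sqrt_sq_eq_abs]
      split_ifs with hs
      · rw [abs_of_pos hs, one_mul]
      · rw [abs_of_nonpos (not_lt.1 hs), neg_one_mul]
    filter_upwards [hinv.eventually (huhat i hj).2.2] with x hx
    rw [hsqrt, Nat.add_sub_cancel, one_div, ← hx, relDev, inv_inv]
    field_simp
    ring
  refine ⟨⟨rh, hrh, h.solvesRadial hT⟩, M,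
    fun j => -(2 * Real.sqrt ((j : ℝ) * ((N : ℝ) - j)) * c (j - 1)),
    fun j => if 0 < a j then 1 else -1, ⟨fun z => 1 - 2 * (z * mhat z), ?_, ?_⟩, ?_,
    fun j h1 hj => ⟨?_, ⟨fun z => Real.sqrt ((j : ℝ) * ((N : ℝ) - j)) * (1 + 2 * uhat (j - 1) z),
      ?_, ?_⟩, ?_⟩⟩
  · exact analyticAt_const.fun_sub (analyticAt_const.fun_mul (analyticAt_id.fun_mul hmhat))
  · filter_upwards [hinv.eventually hmeq] with x hx
    rw [one_div, ← hx, metricMu, inv_inv]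
    ring
  · have h1 := ((isBigO_refl (fun z : ℝ => -2 * z) (𝓝[>] 0)).mul hmO).comp_tendsto hinv
    refine (h1.congr_left fun x => ?_).trans (IsBigO.of_bound 2 (Eventually.of_forall fun x => ?_))
    · simp only [Function.comp_apply, metricMu, inv_inv]
      ring
    · simp only [Function.comp_apply]
      rw [show -2 * x⁻¹ * x⁻¹ ^ 3 = -2 * (1 / x ^ 4) by ring, norm_mul]
      norm_num
  · dsimp only
    split_ifs <;> simp
  · exact analyticAt_const.fun_mul (analyticAt_const.fun_add (analyticAt_const.fun_mul
      (huhat (j - 1) (by omega)).1))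
  · exact hω' j h1 hj
  · have h2 := (((hc (j - 1) (by omega)).mono nhdsWithin_le_nhds).comp_tendsto hinv).const_mul_left
      (2 * Real.sqrt ((j : ℝ) * ((N : ℝ) - j)))
    refine h2.congr' ?_ (Eventually.of_forall fun x => by simp)
    filter_upwards [hω' j h1 hj] with x hx
    rw [hx, one_div]
    simp only [Function.comp_apply]
    ring

end IsExteriorSolution

end

theorem proposition4 (N : ℕ) (hN : 2 ≤ N) (rh : ℝ) (r Ψ κ S : ℝ → ℝ) (ω U : ℕ → ℝ → ℝ)
    (hsol : IsTauSolution N r Ψ κ S ω U)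
    (hhor : RegularHorizonAlong N (𝓝[>] (0 : ℝ)) rh r (fun τ => Ψ τ ^ 2) ω
      (fun j τ => U j τ / Ψ τ))
    (hΨ : ∀ τ > 0, 0 < Ψ τ)
    (hr : Tendsto r atTop atTop) :
    Tendsto Ψ atTop (𝓝 1) ∧
    (∃ Sinf : ℝ, Sinf ≠ 0 ∧ Tendsto S atTop (𝓝 Sinf)) ∧
    ∃ a : ℕ → ℝ, IsFlatCriticalPoint N a ∧
      (∀ j, 1 ≤ j → j < N →
        Tendsto (ω j) atTop (𝓝 (a j)) ∧ Tendsto (deriv (ω j)) atTop (𝓝 0)) ∧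
      (∀ j, 1 ≤ j → j < N → a j = 0 → ∀ τ > 0, ω j τ = 0) ∧
      ((∃ j, 1 ≤ j ∧ j < N ∧ ∃ τ > 0, ω j τ ≠ 0) → ∃ j, 1 ≤ j ∧ j < N ∧ a j ≠ 0) ∧
      ∃ (m Sr : ℝ → ℝ) (w : ℕ → ℝ → ℝ),
        (∀ τ > 0, metricMu m (r τ) = Ψ τ ^ 2 ∧ Sr (r τ) = S τ ∧
          ∀ j ≤ N, w j (r τ) = ω j τ) ∧
        IsRegularBlackHole N rh m Sr w ∧
        ((∀ j, 1 ≤ j → j < N → ∃ τ > 0, ω j τ ≠ 0) →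
          (∀ j, 1 ≤ j → j < N → a j ^ 2 = (j : ℝ) * ((N : ℝ) - j)) ∧
          InLocalFamilyAtInfinity N m Sr w) := by
  have h := hsol.isExteriorSolution (by omega) hhor.rh_pos hhor.r_lim hhor.mu_lim hΨ hr
  choose! a ha using fun j (hj : j ≤ N) => h.exists_tendsto_omega hj
  have hcrit : IsFlatCriticalPoint N a := h.isFlatCriticalPoint_of_tendsto le_rfl ha
  have hzero : ∀ j, 1 ≤ j → j < N → a j = 0 → ∀ τ > 0, ω j τ = 0 := fun j h1 hj haj =>
    h.omega_eq_zero_of_tendsto_zero ha h1 hj haj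
  obtain ⟨T, hT⟩ := h.exists_isRadialInverse hhor.r_lim
  have hbh := h.isRegularBlackHole hT hhor
  refine ⟨h.tendsto_Psi, h.exists_tendsto_S, a, hcrit, fun j h1 hj => ⟨ha j hj.le, ?_⟩, hzero, ?_,
    _, _, _, fun τ hτ => ⟨?_, ?_, fun j _ => ?_⟩, hbh, fun hne => ?_⟩
  · refine (h.tendsto_r_mul_U h1 hj).congr' ?_
    filter_upwards [eventually_gt_atTop 0] with t ht
    exact (h.omega_eq j h1 hj t ht).deriv.symm
  · rintro ⟨j, h1, hj, τ, hτ, hne⟩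
    exact ⟨j, h1, hj, fun haj => hne (hzero j h1 hj haj τ hτ)⟩
  · rw [IsExteriorSolution.metricMu_comp Ψ T (h.r_pos τ hτ).ne', hT.T_r τ hτ]
  · simp only [hT.T_r τ hτ]
  · simp only [hT.T_r τ hτ]
  -- A vanishing `a_j` would force `ω_j` to vanish identically, so here all factors `F_j` are zero
  -- at `a` and the critical point is the vacuum.
  · have hvac := hcrit.sq_eq_vacuumSq (by omega) fun j h1 hj haj => by
      obtain ⟨τ, hτ, hω⟩ := hne j h1 hj
      exact hω (hzero j h1 hj haj τ hτ)
    exact ⟨fun j _ hj => hvac j hj.le,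
      h.inLocalFamilyAtInfinity hN hhor.rh_pos hT ha hvac hbh.m_flat⟩
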